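/- Let $\tilde{\mathcal A}=\{\sum_{\nu\ge 0}P_\nu(a)b^\nu : P_\nu\in\mathbb C[x]\}$ be the $\mathbb C$-algebra with $ab-ba=b^2$ and $b$-adically continuous multiplication; it contains $\mathbb C[[b]]$. An (a,b)-module is a left $\tilde{\mathcal A}$-module that is free of finite rank over $\mathbb C[[b]]$; its rank is that rank. For $\mu\in\mathbb C$ put $E_\mu=\tilde{\mathcal A}/\tilde{\mathcal A}(a-\mu b)$. For rational $\lambda\in\,]0,1]$ let $\Xi_\lambda^{(N)}=\bigoplus_{j=0}^N\mathbb C[[s]]\,s^{\lambda-1}(\operatorname{Log}s)^j$, where $a$ is multiplication by $s$ and $b$ is the primitive in $s$ without constant. A fresco is a module isomorphic to $\tilde{\mathcal A}\varphi\subset\big(\bigoplus_{\lambda\in\Lambda}\Xi_\lambda^{(N)}\big)\otimes_{\mathbb C}V$ with $\Lambda\subset\mathbb Q\cap\,]0,1]$ finite, $N\in\mathbb N$ and $V$ a finite-dimensional complex vector space; it is a theme if one can take $V=\mathbb C$. A submodule $F$ of $E$ is normal if $F\cap bE=bF$. An (a,b)-module is regular if it embeds in an (a,b)-module $M$ with simple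 pole ($aM\subset bM$); its Bernstein polynomial is the minimal polynomial of $-b^{-1}a$ on $E^\sharp/bE^\sharp$, where $E^\sharp$ is its saturation, i.e. the minimal such $M$. It is $[\lambda]$-primitive if all roots of its Bernstein polynomial lie in $-\lambda+\mathbb Z$, and semi-simple if it embeds in a finite direct sum of regular rank $1$ (a,b)-modules. Let $E$ be a $[\lambda]$-primitive fresco of rank $k\ge 2$, for some $\lambda\in\mathbb Q\cap\,]0,1]$, and let $0=F_0\subset F_1\subset\dots\subset F_k=E$ be its principal Jordan–Hölder sequence with fundamental invariants $\lambda_1,\dots,\lambda_k\in\mathbb Q$: the $F_j$ are normal, $F_j/F_{j-1}\simeq E_{\lambda_j}$, and $j\mapsto\lambda_j+j$ is non-decreasing. Assume that $F_{k-1}$ and $E/F_1$ are semi-simple. Then there are $p_1,\dots,p_{k-1}\in\mathbb N$ with $\lambda_{j+1}=\lambda_j+p_j-1$ for $1\le j\le k-1$, and exactly one number $\alpha(E)\in\mathbb C$ is given by the following recursion. - If $k=2$, $\alpha(E)$ is the parameter of $E$: the number $\alpha$ such that $E\simeq\tilde{\mathcal A}/\tilde{\mathcal A}(a-\lambda_1b)(1+\alpha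 b^{p_1})^{-1}(a-\lambda_2b)$ when $p_1\ge 1$, and by convention $\alpha(E)=1$ when $p_1=0$, in which case $E\simeq\tilde{\mathcal A}/\tilde{\mathcal A}(a-\lambda_1b)(a-(\lambda_1-1)b)$. - If $k\ge 3$, $\alpha(E)=\alpha(G)$, where $G=\tilde{\mathcal A}(a-(\lambda_{k-1}-1)b)e$ and $e$ is any generator of $E$ such that $(a-\lambda_{k-1}b)(a-\lambda_kb)e\in F_{k-2}$. Put $p(E)=\sum_{j=1}^{k-1}p_j$. If $\alpha(E)\ne 0$, then $E$ contains a normal rank $2$ submodule that is a theme, and every normal rank $2$ submodule of $E$ that is a theme is isomorphic to $$\tilde{\mathcal A}\big/\tilde{\mathcal A}\,(a-\lambda_1b)\,(1+\alpha(E)\,b^{p(E)})^{-1}\,(a-(\lambda_k+k-2)b).$$ -/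

import Mathlib

namespace ABModule

/-- Right multiplication by `a` on formal series `∑ P_ν(a) b^ν`, the coefficients being
polynomials in `a`: it sends `P(a) b^ν` to `(a P)(a) b^ν - ν P(a) b^(ν+1)`,
because `b^ν a = a b^ν - ν b^(ν+1)`. -/
noncomputable def rightA :
    Module.End ℂ (PowerSeries (Polynomial ℂ)) where
  toFun f := PowerSeries.C Polynomial.X * f
    - PowerSeries.derivative (Polynomial ℂ) f * PowerSeries.X * PowerSeries.X
  map_add' f g := by simp only [map_add]; ring
  map_smul' c f := by
    have h : ∀ g : PowerSeries (Polynomial ℂ),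
        c • g = PowerSeries.C (Polynomial.C c) * g := by
      intro g
      ext1 n
      rw [PowerSeries.coeff_C_mul, PowerSeries.coeff_smul, Polynomial.smul_eq_C_mul]
    simp only [h, RingHom.id_apply, Derivation.leibniz, PowerSeries.derivative_C,
      smul_eq_mul, mul_zero, add_zero]
    ring

/-- The product of `u = ∑ P_ν(a) b^ν` and `v = ∑ Q_μ(a) b^μ`, namely
`∑_μ (u · Q_μ(a)) b^μ`, where `u · Q(a)` is `Q` evaluated at right multiplication by `a`,
applied to `u`. -/
noncomputable def seriesMul (u v : PowerSeries (Polynomial ℂ)) :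
    PowerSeries (Polynomial ℂ) :=
  PowerSeries.mk fun n => ∑ p ∈ Finset.HasAntidiagonal.antidiagonal n,
    PowerSeries.coeff p.1 (Polynomial.aeval rightA (PowerSeries.coeff p.2 v) u)

theorem rightA_mul_X (f : PowerSeries (Polynomial ℂ)) :
    rightA (f * PowerSeries.X)
      = rightA f * PowerSeries.X - f * PowerSeries.X * PowerSeries.X := by
  simp only [rightA, LinearMap.coe_mk, AddHom.coe_mk, Derivation.leibniz,
    PowerSeries.derivative_X, smul_eq_mul]
  ring

theorem seriesMul_add_left (u u' v : PowerSeries (Polynomial ℂ)) :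
    seriesMul (u + u') v = seriesMul u v + seriesMul u' v := by
  ext1 n
  simp only [seriesMul, PowerSeries.coeff_mk, map_add, Finset.sum_add_distrib]

theorem seriesMul_add_right (u v v' : PowerSeries (Polynomial ℂ)) :
    seriesMul u (v + v') = seriesMul u v + seriesMul u v' := by
  ext1 n
  simp only [seriesMul, PowerSeries.coeff_mk, map_add, Finset.sum_add_distrib,
    LinearMap.add_apply]

theorem seriesMul_C (u : PowerSeries (Polynomial ℂ)) (P : Polynomial ℂ) :
    seriesMul u (PowerSeries.C P) = Polynomial.aeval rightA P u := by
  ext1 n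
  rw [seriesMul, PowerSeries.coeff_mk, Finset.sum_eq_single (n, 0)]
  · simp
  · rintro ⟨i, j⟩ h hne
    rw [Finset.HasAntidiagonal.mem_antidiagonal] at h
    have hj : j ≠ 0 := by
      rintro rfl
      exact hne (by simpa using h)
    simp [PowerSeries.coeff_C, hj]
  · simp

theorem seriesMul_mul_X (u v : PowerSeries (Polynomial ℂ)) :
    seriesMul u (v * PowerSeries.X) = seriesMul u v * PowerSeries.X := by
  ext1 n
  cases n with
  | zero => simp [seriesMul]
  | succ n =>
    rw [PowerSeries.coeff_succ_mul_X, seriesMul, PowerSeries.coeff_mk, seriesMul,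
      PowerSeries.coeff_mk, Finset.Nat.sum_antidiagonal_succ']
    simp [PowerSeries.coeff_succ_mul_X]

/-- An additive map on series which commutes with right multiplication by `b` and kills the
polynomials in `a` is zero. -/
theorem series_ext (H : PowerSeries (Polynomial ℂ) → PowerSeries (Polynomial ℂ))
    (hadd : ∀ f g, H (f + g) = H f + H g) (hC : ∀ P, H (PowerSeries.C P) = 0)
    (hX : ∀ f, H (f * PowerSeries.X) = H f * PowerSeries.X) (f) : H f = 0 := by
  ext1 n
  induction n generalizing f with
  | zero =>
    rw [PowerSeries.eq_shift_mul_X_add_const f, hadd, hX, hC]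
    simp
  | succ n ih =>
    rw [PowerSeries.eq_shift_mul_X_add_const f, hadd, hX, hC, add_zero,
      PowerSeries.coeff_succ_mul_X, ih]
    simp

theorem seriesMul_rightA (u v : PowerSeries (Polynomial ℂ)) :
    seriesMul u (rightA v) = rightA (seriesMul u v) := by
  have h := series_ext (fun v => seriesMul u (rightA v) - rightA (seriesMul u v))
    (fun f g => by simp only [map_add, seriesMul_add_right]; ring)
    (fun P => by
      have h1 : rightA (PowerSeries.C P) = PowerSeries.C (Polynomial.X * P) := by
        simp [rightA]
      simp only [h1]
      simp only [seriesMul_C, map_mul (Polynomial.aeval rightA), Polynomial.aeval_X,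
        Module.End.mul_apply, sub_self])
    (fun f => by
      have h2 : ∀ x y : PowerSeries (Polynomial ℂ),
          seriesMul u (x - y) = seriesMul u x - seriesMul u y := fun x y => by
        rw [eq_sub_iff_add_eq, ← seriesMul_add_right, sub_add_cancel]
      simp only [rightA_mul_X, seriesMul_mul_X, h2]
      ring) v
  exact sub_eq_zero.mp h

theorem seriesMul_aeval (u v : PowerSeries (Polynomial ℂ)) (P : Polynomial ℂ) :
    seriesMul u (Polynomial.aeval rightA P v) = Polynomial.aeval rightA P (seriesMul u v) := by
  induction P using Polynomial.induction_on' with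
  | add p q hp hq => simp only [map_add, LinearMap.add_apply, seriesMul_add_right, hp, hq]
  | monomial n c =>
    have h : ∀ w : PowerSeries (Polynomial ℂ),
        Polynomial.aeval rightA (Polynomial.monomial n c) w = (rightA ^ n) (c • w) := by
      intro w
      rw [Polynomial.aeval_monomial, Module.End.mul_apply, Module.algebraMap_end_apply, map_smul]
    have hc : seriesMul u (c • v) = c • seriesMul u v := by
      ext1 m
      simp [seriesMul, Finset.smul_sum]
    rw [h, h, ← hc]
    generalize c • v = w
    clear h hc
    induction n generalizing w with
    | zero => rfl
    | succ n ih =>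
      rw [pow_succ, Module.End.mul_apply, Module.End.mul_apply, ih, seriesMul_rightA]

theorem seriesMul_assoc (u v w : PowerSeries (Polynomial ℂ)) :
    seriesMul (seriesMul u v) w = seriesMul u (seriesMul v w) := by
  have h := series_ext
    (fun w => seriesMul (seriesMul u v) w - seriesMul u (seriesMul v w))
    (fun f g => by simp only [seriesMul_add_right]; ring)
    (fun P => by simp only [seriesMul_C, seriesMul_aeval, sub_self])
    (fun f => by simp only [seriesMul_mul_X]; ring) w
  exact sub_eq_zero.mp h

theorem C_seriesMul (P : Polynomial ℂ) (v : PowerSeries (Polynomial ℂ)) :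
    seriesMul (PowerSeries.C P) v = PowerSeries.C P * v := by
  have h := series_ext (fun v => seriesMul (PowerSeries.C P) v - PowerSeries.C P * v)
    (fun f g => by simp only [seriesMul_add_right]; ring)
    (fun Q => by
      rw [seriesMul_C, sub_eq_zero, ← map_mul]
      induction Q using Polynomial.induction_on' with
      | add p q hp hq => simp only [map_add, LinearMap.add_apply, hp, hq, mul_add]
      | monomial n c =>
        have hn : ∀ R : Polynomial ℂ, (rightA ^ n) (PowerSeries.C R)
            = PowerSeries.C (R * Polynomial.X ^ n) := by
          induction n with
          | zero => intro R; simp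
          | succ n ih =>
            intro R
            have h1 : rightA (PowerSeries.C R) = PowerSeries.C (R * Polynomial.X) := by
              simp [rightA, mul_comm]
            rw [pow_succ, Module.End.mul_apply, h1, ih]
            congr 1
            ring
        have hc : c • (PowerSeries.C P : PowerSeries (Polynomial ℂ))
            = PowerSeries.C (c • P) := by
          ext1 m
          simp only [PowerSeries.coeff_smul, PowerSeries.coeff_C]
          split_ifs <;> simp
        rw [Polynomial.aeval_monomial, Module.End.mul_apply, Module.algebraMap_end_apply, hn,
          ← Polynomial.C_mul_X_pow_eq_monomial]
        ext1 m
        simp only [PowerSeries.coeff_smul, PowerSeries.coeff_C]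
        split_ifs
        · rw [Polynomial.smul_eq_C_mul]; ring
        · simp)
    (fun f => by simp only [seriesMul_mul_X]; ring) v
  exact sub_eq_zero.mp h

/-- The algebra `Ã` of formal series `∑ P_ν(a) b^ν` with polynomials `P_ν ∈ ℂ[X]` as
coefficients, where `a b - b a = b^2`. -/
@[ext]
structure Atilde where
  series : PowerSeries (Polynomial ℂ)

namespace Atilde

noncomputable instance : Zero Atilde := ⟨⟨0⟩⟩
noncomputable instance : One Atilde := ⟨⟨1⟩⟩
noncomputable instance : Add Atilde := ⟨fun u v => ⟨u.series + v.series⟩⟩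
noncomputable instance : Neg Atilde := ⟨fun u => ⟨-u.series⟩⟩
noncomputable instance : Mul Atilde := ⟨fun u v => ⟨seriesMul u.series v.series⟩⟩

theorem series_zero : (0 : Atilde).series = 0 := rfl
theorem series_one : (1 : Atilde).series = 1 := rfl
theorem series_add (u v : Atilde) : (u + v).series = u.series + v.series := rfl
theorem series_neg (u : Atilde) : (-u).series = -u.series := rfl
theorem series_mul (u v : Atilde) : (u * v).series = seriesMul u.series v.series := rfl

noncomputable instance : Ring Atilde :=
  Ring.ofMinimalAxioms
    (fun u v w => Atilde.ext (add_assoc _ _ _))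
    (fun u => Atilde.ext (zero_add _))
    (fun u => Atilde.ext (neg_add_cancel _))
    (fun u v w => Atilde.ext (seriesMul_assoc _ _ _))
    (fun u => Atilde.ext (by
      rw [series_mul, series_one, ← map_one (PowerSeries.C (R := Polynomial ℂ)), C_seriesMul,
        map_one, one_mul]))
    (fun u => Atilde.ext (by
      rw [series_mul, series_one, ← map_one (PowerSeries.C (R := Polynomial ℂ)), seriesMul_C,
        map_one]
      rfl))
    (fun u v w => Atilde.ext (seriesMul_add_right _ _ _))
    (fun u v w => Atilde.ext (seriesMul_add_left _ _ _))

/-- The inclusion of the commutative ring `ℂ[[b]]` in `Ã`. -/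
noncomputable def ofSeries : PowerSeries ℂ →+* Atilde where
  toFun S := ⟨PowerSeries.map (Polynomial.C (R := ℂ)) S⟩
  map_one' := Atilde.ext (map_one (PowerSeries.map (Polynomial.C (R := ℂ))))
  map_zero' := Atilde.ext (map_zero (PowerSeries.map (Polynomial.C (R := ℂ))))
  map_add' S T := Atilde.ext (map_add (PowerSeries.map (Polynomial.C (R := ℂ))) S T)
  map_mul' S T := by
    apply Atilde.ext
    rw [series_mul, map_mul]
    ext1 n
    rw [seriesMul, PowerSeries.coeff_mk, PowerSeries.coeff_mul]
    refine Finset.sum_congr rfl fun p _ => ?_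
    rw [PowerSeries.coeff_map, PowerSeries.coeff_map, Polynomial.aeval_C,
      Module.algebraMap_end_apply, PowerSeries.coeff_smul, PowerSeries.coeff_map,
      Polynomial.smul_eq_C_mul, mul_comm]

theorem series_ofSeries (S : PowerSeries ℂ) :
    (ofSeries S).series = PowerSeries.map Polynomial.C S := rfl

noncomputable instance : Algebra ℂ Atilde :=
  RingHom.toAlgebra' (ofSeries.comp (PowerSeries.C (R := ℂ))) fun c v => by
    apply Atilde.ext
    rw [RingHom.comp_apply, series_mul, series_mul, series_ofSeries, PowerSeries.map_C,
      C_seriesMul, seriesMul_C, Polynomial.aeval_C, Module.algebraMap_end_apply]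
    ext1 n
    rw [PowerSeries.coeff_C_mul, PowerSeries.coeff_smul, Polynomial.smul_eq_C_mul]

/-- The element `a` of `Ã`. -/
noncomputable def a : Atilde := ⟨PowerSeries.C Polynomial.X⟩

/-- The element `b` of `Ã`. -/
noncomputable def b : Atilde := ofSeries PowerSeries.X

/-- The commutation relation of `ℂ[[b]]` with `a`: `a S = S a + b^2 S'`. -/
theorem a_mul_ofSeries (S : PowerSeries ℂ) :
    a * ofSeries S = ofSeries S * a + b ^ 2 * ofSeries (PowerSeries.derivative ℂ S) := by
  apply Atilde.ext
  have h3 : (b ^ 2 * ofSeries (PowerSeries.derivative ℂ S)).series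
      = PowerSeries.derivative (Polynomial ℂ) (PowerSeries.map Polynomial.C S)
        * PowerSeries.X * PowerSeries.X := by
    rw [b, ← map_pow, ← map_mul, series_ofSeries]
    have h4 : PowerSeries.map Polynomial.C (PowerSeries.derivative ℂ S)
        = PowerSeries.derivative (Polynomial ℂ) (PowerSeries.map Polynomial.C S) := by
      ext1 n
      simp [PowerSeries.coeff_derivative]
    rw [map_mul, map_pow, PowerSeries.map_X, h4]
    ring
  rw [series_add, h3, series_mul, series_mul, a, series_ofSeries, C_seriesMul, seriesMul_C,
    Polynomial.aeval_X]
  simp only [rightA, LinearMap.coe_mk, AddHom.coe_mk]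
  ring

/-- The defining relation `a b - b a = b^2` of `Ã`. -/
theorem a_mul_b_sub : a * b - b * a = b ^ 2 := by
  rw [b, a_mul_ofSeries, PowerSeries.derivative_X, map_one, mul_one, b]
  exact add_sub_cancel_left _ _

end Atilde

section Action

variable {ι : Type}

/-- The action of `u = ∑ P_ν(a) b^ν` on `x` in a finite power of `ℂ[[b]]` on which `a` acts by
the endomorphism `α`: `u x = ∑ P_ν(α) (b^ν x)`, the sum being finite in each degree. -/
noncomputable def act (α : Module.End ℂ (ι → PowerSeries ℂ)) (u : PowerSeries (Polynomial ℂ))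
    (x : ι → PowerSeries ℂ) : ι → PowerSeries ℂ := fun i =>
  PowerSeries.mk fun n => ∑ m ∈ Finset.range (n + 1), PowerSeries.coeff n
    (Polynomial.aeval α (PowerSeries.coeff m u) ((PowerSeries.X ^ m : PowerSeries ℂ) • x) i)

variable (α : Module.End ℂ (ι → PowerSeries ℂ))

theorem act_add_left (u v : PowerSeries (Polynomial ℂ)) (x : ι → PowerSeries ℂ) :
    act α (u + v) x = act α u x + act α v x := by
  funext i
  ext1 n
  simp [act, Finset.sum_add_distrib]

theorem act_add_right (u : PowerSeries (Polynomial ℂ)) (x y : ι → PowerSeries ℂ) :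
    act α u (x + y) = act α u x + act α u y := by
  funext i
  ext1 n
  simp [act, Finset.sum_add_distrib]

theorem act_C (P : Polynomial ℂ) (x : ι → PowerSeries ℂ) :
    act α (PowerSeries.C P) x = Polynomial.aeval α P x := by
  funext i
  ext1 n
  rw [act, PowerSeries.coeff_mk, Finset.sum_eq_single 0]
  · simp
  · intro m _ hm
    simp [PowerSeries.coeff_C, hm]
  · simp

theorem act_X_pow_dvd (hα : ∀ x : ι → PowerSeries ℂ,
      α ((PowerSeries.X : PowerSeries ℂ) • x)
        = (PowerSeries.X : PowerSeries ℂ) • α x + (PowerSeries.X ^ 2 : PowerSeries ℂ) • x)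
    (P : Polynomial ℂ) (m : ℕ) (x : ι → PowerSeries ℂ) :
    ∃ z, Polynomial.aeval α P ((PowerSeries.X ^ m : PowerSeries ℂ) • x)
      = (PowerSeries.X ^ m : PowerSeries ℂ) • z := by
  have h1 : ∀ (m : ℕ) (x : ι → PowerSeries ℂ), ∃ z,
      α ((PowerSeries.X ^ m : PowerSeries ℂ) • x) = (PowerSeries.X ^ m : PowerSeries ℂ) • z := by
    intro m
    induction m with
    | zero => intro x; exact ⟨α x, by simp⟩
    | succ m ih =>
      intro x
      obtain ⟨z, hz⟩ := ih x
      refine ⟨z + (PowerSeries.X : PowerSeries ℂ) • x, ?_⟩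
      rw [pow_succ', mul_smul, hα, hz, smul_add, smul_smul, smul_smul, smul_smul]
      congr 2
      ring
  induction P using Polynomial.induction_on' with
  | add p q hp hq =>
    obtain ⟨z, hz⟩ := hp
    obtain ⟨w, hw⟩ := hq
    exact ⟨z + w, by simp only [map_add, LinearMap.add_apply, hz, hw, smul_add]⟩
  | monomial n c =>
    rw [Polynomial.aeval_monomial, Module.End.mul_apply, Module.algebraMap_end_apply]
    have h2 : ∃ z, (α ^ n) ((PowerSeries.X ^ m : PowerSeries ℂ) • x)
        = (PowerSeries.X ^ m : PowerSeries ℂ) • z := by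
      induction n with
      | zero => exact ⟨x, rfl⟩
      | succ n ih =>
        obtain ⟨z, hz⟩ := ih
        obtain ⟨w, hw⟩ := h1 m z
        exact ⟨w, by rw [pow_succ', Module.End.mul_apply, hz, hw]⟩
    obtain ⟨z, hz⟩ := h2
    exact ⟨c • z, by rw [hz, smul_comm]⟩

theorem coeff_X_pow_smul (m n : ℕ) (h : n < m) (z : ι → PowerSeries ℂ) (i : ι) :
    PowerSeries.coeff n (((PowerSeries.X ^ m : PowerSeries ℂ) • z) i) = 0 := by
  rw [Pi.smul_apply, smul_eq_mul, PowerSeries.coeff_X_pow_mul', if_neg (by omega)]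

theorem act_mul_X (hα : ∀ x : ι → PowerSeries ℂ,
      α ((PowerSeries.X : PowerSeries ℂ) • x)
        = (PowerSeries.X : PowerSeries ℂ) • α x + (PowerSeries.X ^ 2 : PowerSeries ℂ) • x)
    (u : PowerSeries (Polynomial ℂ)) (x : ι → PowerSeries ℂ) :
    act α (u * PowerSeries.X) x = act α u ((PowerSeries.X : PowerSeries ℂ) • x) := by
  funext i
  ext1 n
  rw [act, PowerSeries.coeff_mk, act, PowerSeries.coeff_mk, Finset.sum_range_succ',
    Finset.sum_range_succ]
  have h0 : PowerSeries.coeff n (Polynomial.aeval α (PowerSeries.coeff n u)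
      ((PowerSeries.X ^ n : PowerSeries ℂ) • (PowerSeries.X : PowerSeries ℂ) • x) i) = 0 := by
    obtain ⟨z, hz⟩ := act_X_pow_dvd α hα (PowerSeries.coeff n u) (n + 1) x
    rw [smul_smul, ← pow_succ, hz, coeff_X_pow_smul _ _ (Nat.lt_succ_self n)]
  rw [h0]
  simp only [PowerSeries.coeff_succ_mul_X, PowerSeries.coeff_zero_mul_X, map_zero,
    LinearMap.zero_apply, Pi.zero_apply, add_zero, pow_succ, mul_smul]

theorem act_dvd (hα : ∀ x : ι → PowerSeries ℂ,
      α ((PowerSeries.X : PowerSeries ℂ) • x)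
        = (PowerSeries.X : PowerSeries ℂ) • α x + (PowerSeries.X ^ 2 : PowerSeries ℂ) • x)
    (u : PowerSeries (Polynomial ℂ)) (m n : ℕ) (h : n < m) (x : ι → PowerSeries ℂ) (i : ι) :
    PowerSeries.coeff n (act α u ((PowerSeries.X ^ m : PowerSeries ℂ) • x) i) = 0 := by
  rw [act, PowerSeries.coeff_mk]
  refine Finset.sum_eq_zero fun k _ => ?_
  obtain ⟨z, hz⟩ := act_X_pow_dvd α hα (PowerSeries.coeff k u) (k + m) x
  rw [smul_smul, ← pow_add, hz, coeff_X_pow_smul _ _ (by omega)]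

/-- Two expressions in `u` and `x` agree when their difference is additive in `u`, vanishes on
polynomials in `a`, satisfies `K (u b) x = K u (b x)`, and respects the `b`-adic filtration. -/
theorem act_ext
    (K : PowerSeries (Polynomial ℂ) → (ι → PowerSeries ℂ) → (ι → PowerSeries ℂ))
    (hadd : ∀ u v x, K (u + v) x = K u x + K v x) (hC : ∀ P x, K (PowerSeries.C P) x = 0)
    (hX : ∀ u x, K (u * PowerSeries.X) x = K u ((PowerSeries.X : PowerSeries ℂ) • x))
    (hd : ∀ u m n, n < m → ∀ x i,
      PowerSeries.coeff n (K u ((PowerSeries.X ^ m : PowerSeries ℂ) • x) i) = 0) (u x) :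
    K u x = 0 := by
  have h : ∀ m u x, ∃ v, K u x = K v ((PowerSeries.X ^ m : PowerSeries ℂ) • x) := by
    intro m
    induction m with
    | zero => intro u x; exact ⟨u, by simp⟩
    | succ m ih =>
      intro u x
      have h1 : ∃ w, K u x = K w ((PowerSeries.X : PowerSeries ℂ) • x) := by
        refine ⟨PowerSeries.mk fun p => PowerSeries.coeff (p + 1) u, ?_⟩
        rw [← hX]
        conv_lhs => rw [PowerSeries.eq_shift_mul_X_add_const u]
        rw [hadd, hC, add_zero]
      obtain ⟨w, hw⟩ := h1
      obtain ⟨v, hv⟩ := ih w ((PowerSeries.X : PowerSeries ℂ) • x)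
      exact ⟨v, by rw [hw, hv, smul_smul, pow_succ]⟩
  funext i
  ext1 n
  obtain ⟨v, hv⟩ := h (n + 1) u x
  rw [hv, hd v (n + 1) n (Nat.lt_succ_self n)]
  simp

theorem act_rightA (hα : ∀ x : ι → PowerSeries ℂ,
      α ((PowerSeries.X : PowerSeries ℂ) • x)
        = (PowerSeries.X : PowerSeries ℂ) • α x + (PowerSeries.X ^ 2 : PowerSeries ℂ) • x)
    (u : PowerSeries (Polynomial ℂ)) (x : ι → PowerSeries ℂ) :
    act α (rightA u) x = act α u (α x) := by
  have hsub : ∀ u v x, act α (u - v) x = act α u x - act α v x := fun u v x => by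
    rw [eq_sub_iff_add_eq, ← act_add_left, sub_add_cancel]
  have h := act_ext (fun u x => act α (rightA u) x - act α u (α x))
    (fun u v x => by simp only [map_add, act_add_left]; abel)
    (fun P x => by
      have h1 : rightA (PowerSeries.C P) = PowerSeries.C (P * Polynomial.X) := by
        simp [rightA, mul_comm]
      simp only [h1]
      simp only [act_C, map_mul (Polynomial.aeval α), Polynomial.aeval_X, Module.End.mul_apply,
        sub_self])
    (fun u x => by
      simp only [rightA_mul_X, hsub, act_mul_X α hα, hα, act_add_right, smul_smul, pow_two]
      abel)
    (fun u m n hmn x i => by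
      obtain ⟨z, hz⟩ := act_X_pow_dvd α hα Polynomial.X m x
      rw [Polynomial.aeval_X] at hz
      simp only [hz, Pi.sub_apply, map_sub]
      rw [act_dvd α hα _ _ _ hmn, act_dvd α hα _ _ _ hmn, sub_zero]) u x
  exact sub_eq_zero.mp h

theorem act_mul (hα : ∀ x : ι → PowerSeries ℂ,
      α ((PowerSeries.X : PowerSeries ℂ) • x)
        = (PowerSeries.X : PowerSeries ℂ) • α x + (PowerSeries.X ^ 2 : PowerSeries ℂ) • x)
    (u v : PowerSeries (Polynomial ℂ)) (x : ι → PowerSeries ℂ) :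
    act α (seriesMul u v) x = act α u (act α v x) := by
  have hP : ∀ (P : Polynomial ℂ) (x : ι → PowerSeries ℂ),
      act α (Polynomial.aeval rightA P u) x = act α u (Polynomial.aeval α P x) := by
    intro P
    induction P using Polynomial.induction_on' with
    | add p q hp hq =>
      intro x
      simp only [map_add, LinearMap.add_apply, act_add_left, act_add_right, hp, hq]
    | monomial n c =>
      have hc : ∀ (w : PowerSeries (Polynomial ℂ)) (y : ι → PowerSeries ℂ),
          act α (c • w) y = act α w (c • y) := by
        intro w y
        funext i
        ext1 k
        simp only [act, PowerSeries.coeff_mk]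
        refine Finset.sum_congr rfl fun j _ => ?_
        rw [PowerSeries.coeff_smul, map_smul (Polynomial.aeval α), LinearMap.smul_apply,
          smul_comm (PowerSeries.X ^ j : PowerSeries ℂ) c y,
          map_smul (Polynomial.aeval α (PowerSeries.coeff j w))]
      intro x
      rw [Polynomial.aeval_monomial, Polynomial.aeval_monomial, Module.End.mul_apply,
        Module.End.mul_apply, Module.algebraMap_end_apply, Module.algebraMap_end_apply, hc,
        ← map_smul]
      generalize c • x = y
      clear hc
      induction n generalizing y with
      | zero => rfl
      | succ n ih =>
        rw [pow_succ', Module.End.mul_apply, act_rightA α hα, ih, pow_succ, Module.End.mul_apply]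
  have h := act_ext (fun v x => act α (seriesMul u v) x - act α u (act α v x))
    (fun v w x => by simp only [seriesMul_add_right, act_add_left, act_add_right]; abel)
    (fun P x => by simp only [seriesMul_C, act_C, hP, sub_self])
    (fun v x => by simp only [seriesMul_mul_X, act_mul_X α hα])
    (fun v m n hmn x i => by
      have hz : ∃ z, act α v ((PowerSeries.X ^ m : PowerSeries ℂ) • x)
          = (PowerSeries.X ^ m : PowerSeries ℂ) • z := by
        have hz1 : ∀ i, ∃ f : PowerSeries ℂ,
            act α v ((PowerSeries.X ^ m : PowerSeries ℂ) • x) i = PowerSeries.X ^ m * f := by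
          intro i
          exact PowerSeries.X_pow_dvd_iff.mpr fun k hk => act_dvd α hα v m k hk x i
        choose z hz2 using hz1
        exact ⟨z, funext hz2⟩
      obtain ⟨z, hz⟩ := hz
      simp only [hz, Pi.sub_apply, map_sub]
      rw [act_dvd α hα _ _ _ hmn, act_dvd α hα _ _ _ hmn, sub_zero]) v x
  exact sub_eq_zero.mp h

/-- The `Ã`-module structure on a finite power of `ℂ[[b]]` given by an endomorphism `a` with
`a (b x) = b (a x) + b^2 x`. -/
@[reducible] noncomputable def moduleOfEnd (α : Module.End ℂ (ι → PowerSeries ℂ))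
    (hα : ∀ x : ι → PowerSeries ℂ,
      α ((PowerSeries.X : PowerSeries ℂ) • x)
        = (PowerSeries.X : PowerSeries ℂ) • α x + (PowerSeries.X ^ 2 : PowerSeries ℂ) • x) :
    Module Atilde (ι → PowerSeries ℂ) where
  smul u x := act α u.series x
  one_smul x := by
    change act α 1 x = x
    rw [← map_one (PowerSeries.C (R := Polynomial ℂ)), act_C, map_one]
    rfl
  mul_smul u v x := act_mul α hα u.series v.series x
  smul_zero u := by
    change act α u.series 0 = 0
    funext i
    ext1 n
    simp [act]
  smul_add u x y := act_add_right α u.series x y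
  add_smul u v x := act_add_left α u.series v.series x
  zero_smul x := by
    change act α 0 x = 0
    funext i
    ext1 n
    simp [act]

end Action

/-- The action of `a`, which is multiplication by `s`, on
`Ξ_l^{(N)} = ⊕_{j ≤ N} ℂ[[b]] s^(l-1) (Log s)^j`, in the coordinates of this decomposition.
Since `b` is the primitive in `s` without constant,
`s · s^(l-1) (Log s)^j = b (l s^(l-1) (Log s)^j + j s^(l-1) (Log s)^(j-1))`,
and `a S = S a + b^2 S'` for `S ∈ ℂ[[b]]`. -/
noncomputable def xiA (l : ℚ) (N : ℕ) : Module.End ℂ (Fin (N + 1) → PowerSeries ℂ) where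
  toFun x j := PowerSeries.X ^ 2 * PowerSeries.derivative ℂ (x j)
    + PowerSeries.X * ((l : ℂ) • x j)
    + if h : j.val + 1 < N + 1 then
        PowerSeries.X * (((j.val + 1 : ℕ) : ℂ) • x ⟨j.val + 1, h⟩) else 0
  map_add' x y := by
    funext j
    simp only [Pi.add_apply, map_add, smul_add]
    split_ifs <;> ring
  map_smul' c x := by
    funext j
    have h : PowerSeries.derivative ℂ (c • x j) = c • PowerSeries.derivative ℂ (x j) :=
      Derivation.map_smul _ _ _
    simp only [Pi.smul_apply, h, RingHom.id_apply, smul_add, smul_dite, smul_zero,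
      smul_comm _ c, mul_smul_comm]

theorem xiA_X_smul (l : ℚ) (N : ℕ) (x : Fin (N + 1) → PowerSeries ℂ) :
    xiA l N ((PowerSeries.X : PowerSeries ℂ) • x)
      = (PowerSeries.X : PowerSeries ℂ) • xiA l N x
        + (PowerSeries.X ^ 2 : PowerSeries ℂ) • x := by
  funext j
  simp only [xiA, LinearMap.coe_mk, AddHom.coe_mk, Pi.smul_apply, Pi.add_apply, smul_eq_mul,
    Derivation.leibniz, PowerSeries.derivative_X, PowerSeries.smul_eq_C_mul]
  split_ifs <;> ring

/-- The module `Ξ_l^{(N)}` of formal asymptotic expansions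
`⊕_{j ≤ N} ℂ[[s]] s^(l-1) (Log s)^j = ⊕_{j ≤ N} ℂ[[b]] s^(l-1) (Log s)^j`; an element is given by
its coefficients in `ℂ[[b]]`. -/
def Xi (_l : ℚ) (N : ℕ) : Type := Fin (N + 1) → PowerSeries ℂ

noncomputable instance (l : ℚ) (N : ℕ) : AddCommGroup (Xi l N) :=
  inferInstanceAs (AddCommGroup (Fin (N + 1) → PowerSeries ℂ))

noncomputable instance (l : ℚ) (N : ℕ) : Module Atilde (Xi l N) :=
  moduleOfEnd (xiA l N) (xiA_X_smul l N)

section Modules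

open Atilde

universe u v

/-- An `Ã`-module as a `ℂ[[b]]`-module. -/
@[reducible] noncomputable def seriesModule (E : Type u) [AddCommGroup E] [Module Atilde E] :
    Module (PowerSeries ℂ) E := Module.compHom E ofSeries

/-- An `Ã`-module as a complex vector space. -/
@[reducible] noncomputable def complexModule (E : Type u) [AddCommGroup E] [Module Atilde E] :
    Module ℂ E := Module.compHom E (algebraMap ℂ Atilde)

/-- (a,b)-modules: `Ã`-modules which are free of finite rank over `ℂ[[b]]`. -/
def IsABModule (E : Type u) [AddCommGroup E] [Module Atilde E] : Prop :=
  letI := seriesModule E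
  Module.Free (PowerSeries ℂ) E ∧ Module.Finite (PowerSeries ℂ) E

/-- The rank over `ℂ[[b]]`. -/
noncomputable def rank (E : Type u) [AddCommGroup E] [Module Atilde E] : ℕ :=
  letI := seriesModule E
  Module.finrank (PowerSeries ℂ) E

/-- Simple pole: `a E ⊆ b E`. -/
def HasSimplePole (E : Type u) [AddCommGroup E] [Module Atilde E] : Prop :=
  ∀ x : E, ∃ y : E, a • x = b • y

/-- An (a,b)-module is regular if it embeds in a simple pole (a,b)-module. -/
def IsRegular (E : Type u) [AddCommGroup E] [Module Atilde E] : Prop :=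
  IsABModule E ∧ ∃ (M : Type) (_ : AddCommGroup M) (_ : Module Atilde M),
    IsABModule M ∧ HasSimplePole M ∧ ∃ f : E →ₗ[Atilde] M, Function.Injective f

/-- `f` is the saturation `E → E♯`, i.e. a minimal embedding in a simple pole (a,b)-module. -/
def IsSaturation {E : Type u} [AddCommGroup E] [Module Atilde E] {M : Type v} [AddCommGroup M]
    [Module Atilde M] (f : E →ₗ[Atilde] M) : Prop :=
  IsABModule M ∧ HasSimplePole M ∧ Function.Injective f ∧
    ∀ N : Submodule Atilde M, LinearMap.range f ≤ N → HasSimplePole N → N = ⊤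

/-- The complex subspace `b E` of `E`. -/
def bSub (E : Type u) [AddCommGroup E] [Module Atilde E] :
    letI := complexModule E
    Submodule ℂ E :=
  letI := complexModule E
  { carrier := {x | ∃ y : E, x = b • y}
    zero_mem' := ⟨0, (smul_zero _).symm⟩
    add_mem' := by
      rintro _ _ ⟨y, rfl⟩ ⟨z, rfl⟩
      exact ⟨y + z, (smul_add _ _ _).symm⟩
    smul_mem' := by
      rintro c _ ⟨y, rfl⟩
      refine ⟨algebraMap ℂ Atilde c • y, ?_⟩
      change algebraMap ℂ Atilde c • b • y = _
      rw [smul_smul, smul_smul, Algebra.commutes] }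

/-- `B` is the Bernstein polynomial of the simple pole (a,b)-module `M`: the minimal polynomial
of the endomorphism `D` of `M / b M` induced by `-b⁻¹ a`. -/
def IsSimplePoleBernstein (M : Type u) [AddCommGroup M] [Module Atilde M]
    (B : Polynomial ℂ) : Prop :=
  letI := complexModule M
  ∃ D : Module.End ℂ (M ⧸ bSub M),
    (∀ x y : M, a • x = b • y → D ((bSub M).mkQ x) = -(bSub M).mkQ y) ∧ B = minpoly ℂ D

/-- `B` is the Bernstein polynomial of the regular (a,b)-module `E`, that is, the one of its
saturation. -/
def IsBernstein (E : Type u) [AddCommGroup E] [Module Atilde E] (B : Polynomial ℂ) : Prop :=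
  ∃ (M : Type) (_ : AddCommGroup M) (_ : Module Atilde M) (f : E →ₗ[Atilde] M),
    IsSaturation f ∧ IsSimplePoleBernstein M B

/-- `E` is a `[lam]`-primitive regular (a,b)-module: the roots of its Bernstein polynomial are
in `-lam + ℤ`. -/
def IsPrimitive (lam : ℚ) (E : Type u) [AddCommGroup E] [Module Atilde E] : Prop :=
  IsRegular E ∧ ∃ B : Polynomial ℂ, IsBernstein E B ∧
    ∀ r : ℂ, B.IsRoot r → ∃ n : ℤ, r = -(lam : ℂ) + n

/-- Frescos: modules isomorphic to `Ã φ ⊆ Ξ_Λ^{(N)} ⊗ V`, with `Ξ_Λ^{(N)} = ⊕_{l ∈ Λ} Ξ_l^{(N)}`,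
`Λ ⊂ ℚ ∩ ]0,1]` finite and `V = ℂ^m`. -/
def IsFresco (E : Type u) [AddCommGroup E] [Module Atilde E] : Prop :=
  ∃ (Λ : Finset ℚ) (N m : ℕ) (φ : Fin m → (l : Λ) → Xi l.val N),
    (∀ l ∈ Λ, 0 < l ∧ l ≤ 1) ∧ Nonempty (E ≃ₗ[Atilde] Submodule.span Atilde {φ})

/-- Themes: modules isomorphic to `Ã φ ⊆ Ξ_Λ^{(N)}`. -/
def IsTheme (E : Type u) [AddCommGroup E] [Module Atilde E] : Prop :=
  ∃ (Λ : Finset ℚ) (N : ℕ) (φ : (l : Λ) → Xi l.val N),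
    (∀ l ∈ Λ, 0 < l ∧ l ≤ 1) ∧ Nonempty (E ≃ₗ[Atilde] Submodule.span Atilde {φ})

/-- A submodule `F` of `E` is normal when `F ∩ b E = b F`. -/
def IsNormal {E : Type u} [AddCommGroup E] [Module Atilde E] (F : Submodule Atilde E) : Prop :=
  ∀ x : E, (x ∈ F ∧ ∃ y : E, x = b • y) ↔ ∃ z ∈ F, x = b • z

/-- `E` is semi-simple if it embeds in a finite direct sum of regular (a,b)-modules of rank 1. -/
def IsSemiSimple (E : Type u) [AddCommGroup E] [Module Atilde E] : Prop :=
  ∃ (n : ℕ) (M : Fin n → Type) (_ : ∀ i, AddCommGroup (M i)) (_ : ∀ i, Module Atilde (M i)),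
    (∀ i, IsRegular (M i) ∧ rank (M i) = 1) ∧
      ∃ f : E →ₗ[Atilde] ((i : Fin n) → M i), Function.Injective f

/-- The rank 1 module `E_μ = Ã / Ã (a - μ b)`. -/
abbrev ERankOne (μ : ℂ) : Type := Atilde ⧸ Submodule.span Atilde {a - μ • b}

/-- The rank 2 module `Ã / Ã (a - μ b) S⁻¹ (a - ν b)`, for `S` invertible in `ℂ[[b]]`. -/
abbrev ERankTwo (μ : ℂ) (S : PowerSeries ℂ) (ν : ℂ) : Type :=
  Atilde ⧸ Submodule.span Atilde {(a - μ • b) * ofSeries S⁻¹ * (a - ν • b)}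

/-- `0 = F 0 ⊂ F 1 ⊂ ⋯ ⊂ F k = E` is a principal Jordan-Hölder sequence of `E`, with
`F j / F (j-1) ≃ E_{l j}` for `1 ≤ j ≤ k`; the values `F j` for `j > k`, and `l j` for `j = 0` or
`j > k`, play no role. -/
structure IsPrincipalJH {E : Type u} [AddCommGroup E] [Module Atilde E] (k : ℕ)
    (F : ℕ → Submodule Atilde E) (l : ℕ → ℚ) : Prop where
  zero : F 0 = ⊥
  top : F k = ⊤
  mono : ∀ j < k, F j ≤ F (j + 1)
  normal : ∀ j ≤ k, IsNormal (F j)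
  quot : ∀ j < k, Nonempty
    ((F (j + 1) ⧸ (F j).comap (F (j + 1)).subtype) ≃ₗ[Atilde] ERankOne (l (j + 1) : ℂ))
  principal : ∀ i j : ℕ, 1 ≤ i → i ≤ j → j ≤ k → l i + i ≤ l j + j

/-- `IsAlpha k E α`: the number `α` is the α-invariant of the `[lam]`-primitive fresco `E` of
rank `k ≥ 2`.

In rank 2 it is the parameter of `E`: the number `α` such that
`E ≃ Ã / Ã (a - l₁ b) (1 + α b^p)⁻¹ (a - (l₁ + p - 1) b)` with `p ≥ 1`, and by convention `1` if
`E ≃ Ã / Ã (a - l₁ b) (a - (l₁ - 1) b)`.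

In rank `k ≥ 3` it is the α-invariant of the rank `k - 1` submodule generated by
`(a - (l_{k-1} - 1) b) e`, where `e` is a generator of `E` such that
`(a - l_{k-1} b) (a - l_k b) e ∈ F_{k-2}`. -/
def IsAlpha : ℕ → ∀ (E : Type u) [AddCommGroup E] [Module Atilde E], ℂ → Prop
  | 0, _, _, _, _ => False
  | 1, _, _, _, _ => False
  | 2, E, _, _, α => ∃ l₁ : ℚ,
      (α = 1 ∧ Nonempty (E ≃ₗ[Atilde] ERankTwo (l₁ : ℂ) 1 ((l₁ : ℂ) - 1))) ∨
      (∃ p : ℕ, 1 ≤ p ∧ Nonempty (E ≃ₗ[Atilde]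
        ERankTwo (l₁ : ℂ) (1 + α • PowerSeries.X ^ p) ((l₁ : ℂ) + p - 1)))
  | k + 3, E, _, _, α => ∃ (F : ℕ → Submodule Atilde E) (l : ℕ → ℚ),
      IsPrincipalJH (k + 3) F l ∧ ∃ e : E, Submodule.span Atilde {e} = ⊤ ∧
        (a - (l (k + 2) : ℂ) • b) • (a - (l (k + 3) : ℂ) • b) • e ∈ F (k + 1) ∧
        IsAlpha (k + 2)
          (Submodule.span Atilde {(a - ((l (k + 2) : ℂ) - 1) • b) • e}) α

end Modules

end ABModule

namespace ABModule

open Atilde PowerSeries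

universe u v

attribute [local instance] seriesModule

section

/-! Call `x` an eigenvector for `ν` when `(a - ν b) x = 0`, that is, formally, an eigenvector of
`b⁻¹ a` (`twist ν` is the action of `a - ν b`). Semi-simplicity enters only through `NoLog`:
generalized eigenvectors of order two are eigenvectors. A generator of the fresco produces vectors
`e_1, …, e_k` adapted to the `F_j` such that `(a - l_j b) e_j` is a unit multiple of `e_{j-1}`
modulo `F_{j-2}` (`Flag`). Equations between coefficients become equations for the Euler operator `b
∂_b + σ`. It is diagonal on monomials, so that the only obstruction is one resonant monomial
(`exists_euler`).

The number `α` has an intrinsic description, without recursion. Put `μ = l_k + k - 2 = l_1 + p - 1`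
with `p = p(E)`. As `E / F_1` has no logarithms, there is `h` outside `F_{k-1}`, with leading term a
multiple of `b^(k-2) e_k`, such that `(a - μ b) h ∈ F_1 = ℂ[[b]] e_1`. Correcting `h` by a multiple
of `e_1` brings the right-hand side to the form `c (1 + α b^p) e_1` (`HasParam`, `exists_param`).
The monomial `b^p` is the resonant one and cannot be moved. As `F_{k-1}` has no logarithms either,
two choices of `h` differ, up to constants, by an eigenvector and an element of `F_1`, so `α` is
unique (`param_unique`).

In the recursion, `G` has rank `k - 1`, the same `e_1`, and last invariant `l_k + 1`. Hence `μ` and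
`p` do not change and an `h` for `G` is an `h` for `E`. By induction the recursion computes the `α`
above (`isAlpha_iff`).

If `α ≠ 0`, the module `Ã h` has basis `h, e_1`. Some coordinate of the embedding of `E` in `Ξ ⊗ V`
does not kill `e_1`, and the resonant term makes it injective on `Ã h`, which is therefore a theme
(`exists_theme`). Conversely, eigenspaces in `Ξ` have dimension at most one, so a rank 2 theme `T`
has logarithms (`not_noLog_of_isTheme`). So `T` is not contained in `F_{k-1}`, and it contains `e_1`
by normality. It follows that `T` has basis `h + x, e_1` with `x` an eigenvector for `μ` in
`F_{k-1}`, so it satisfies the same equation as `Ã h` (`equiv_of_isTheme`). -/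

noncomputable instance (priority := 2000) natAlgebraSeries : Algebra ℕ (PowerSeries ℂ) :=
  Semiring.toNatAlgebra

noncomputable instance (priority := 2000) intAlgebraSeries : Algebra ℤ (PowerSeries ℂ) :=
  Ring.toIntAlgebra _

/-! ### The operators `a - ν b` and the Euler operator on `ℂ[[b]]`. -/

section Twist

variable {E : Type u} [AddCommGroup E] [Module Atilde E]

theorem series_smul_def (U : PowerSeries ℂ) (x : E) : U • x = ofSeries U • x := rfl

theorem b_smul (x : E) : b • x = (X : PowerSeries ℂ) • x := rfl

theorem smul_b_eq (ν : ℂ) : ν • b = ofSeries (C ν * X) := by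
  rw [map_mul, Algebra.smul_def]; rfl

/-- The action of `a - ν b`. -/
noncomputable def twist (ν : ℂ) (x : E) : E := (a - ν • b) • x

theorem twist_def (ν : ℂ) (x : E) : twist ν x = a • x - (C ν * X : PowerSeries ℂ) • x := by
  rw [twist, sub_smul, smul_b_eq]; rfl

theorem a_smul_smul (U : PowerSeries ℂ) (x : E) :
    a • U • x = U • a • x + (X ^ 2 * derivative ℂ U) • x := by
  have h := congrArg (fun u : Atilde => u • x) (a_mul_ofSeries U)
  simp only [add_smul, mul_smul] at h
  rw [series_smul_def, h, mul_smul]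
  congr 1
  rw [series_smul_def, series_smul_def, map_pow]
  rfl

theorem twist_add (ν : ℂ) (x y : E) : twist ν (x + y) = twist ν x + twist ν y := smul_add _ _ _

theorem twist_sub (ν : ℂ) (x y : E) : twist ν (x - y) = twist ν x - twist ν y := smul_sub _ _ _

theorem twist_zero (ν : ℂ) : twist ν (0 : E) = 0 := smul_zero _

/-- The Euler operator `b ∂_b + σ` on `ℂ[[b]]`. -/
noncomputable def euler (σ : ℂ) (U : PowerSeries ℂ) : PowerSeries ℂ :=
  X * derivative ℂ U + C σ * U

theorem coeff_euler (σ : ℂ) (U : PowerSeries ℂ) (n : ℕ) :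
    coeff n (euler σ U) = (n + σ) * coeff n U := by
  rw [euler, map_add, coeff_C_mul]
  cases n with
  | zero => simp
  | succ n =>
    rw [coeff_succ_X_mul, coeff_derivative]
    push_cast; ring

theorem euler_X_pow_mul (σ : ℂ) (n : ℕ) (U : PowerSeries ℂ) :
    euler σ (X ^ n * U) = X ^ n * euler (σ + n) U := by
  ext m
  rw [coeff_euler, coeff_X_pow_mul', coeff_X_pow_mul']
  split_ifs with h
  · rw [coeff_euler]
    push_cast [Nat.cast_sub h]
    ring
  · simp

theorem euler_X_mul (σ : ℂ) (U : PowerSeries ℂ) :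
    euler σ (X * U) = X * euler (σ + 1) U := by
  simpa using euler_X_pow_mul σ 1 U

theorem euler_C (σ c : ℂ) : euler σ (C c) = C (σ * c) := by
  simp [euler]

/-- Leibniz rule. If `x` is an eigenvector for `l`, the equation `(a - ν b) (U x) = b V x` is
implied by `euler (l - ν) U = V`, which is solved coefficient by coefficient. -/
theorem twist_smul (ν l : ℂ) (U : PowerSeries ℂ) (x : E) :
    twist ν (U • x) = U • twist l x + (X * euler (l - ν) U) • x := by
  rw [twist_def, twist_def, a_smul_smul, euler, map_sub]
  generalize a • x = y
  module

/-- Multiplication by `b^n` shifts eigenvalues by `n`, because `b ∂_b - n` kills `b^n`. -/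
theorem twist_X_pow_smul (ν : ℂ) (n : ℕ) (x : E) :
    twist (ν + n) ((X ^ n : PowerSeries ℂ) • x) = (X ^ n : PowerSeries ℂ) • twist ν x := by
  rw [twist_smul (ν + n) ν]
  have : euler (ν - (ν + n)) (X ^ n) = 0 := by
    ext m
    rw [coeff_euler, coeff_X_pow]
    split_ifs with h
    · subst h; simp
    · simp
  rw [this]; simp

theorem twist_X_smul (ν : ℂ) (x : E) :
    twist (ν + 1) ((X : PowerSeries ℂ) • x) = (X : PowerSeries ℂ) • twist ν x := by
  simpa using twist_X_pow_smul ν 1 x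

/-- This exchange of factors relates the generator `(a - (l_{k-1} - 1) b) e` of `G` to the element
`(a - l_{k-1} b) (a - l_k b) e`. -/
theorem twist_twist (μ ν : ℂ) (x : E) :
    twist μ (twist ν x) = twist (ν + 1) (twist (μ - 1) x) := by
  simp only [twist_def, smul_sub, a_smul_smul]
  have h : ∀ c : ℂ, derivative ℂ (C c * X : PowerSeries ℂ) = C c := by
    intro c; simp [Derivation.leibniz]
  simp only [h]
  simp only [map_add, map_sub, map_one]
  generalize a • a • x = y
  generalize a • x = z
  module

theorem twist_sub_twist (μ ν : ℂ) (x : E) :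
    twist μ x = twist ν x + (C (ν - μ) * X : PowerSeries ℂ) • x := by
  rw [twist_def, twist_def, map_sub]
  generalize a • x = y
  module

theorem twist_mem (F : Submodule Atilde E) (ν : ℂ) {x : E} (hx : x ∈ F) : twist ν x ∈ F :=
  F.smul_mem _ hx

theorem series_smul_mem (F : Submodule Atilde E) (U : PowerSeries ℂ) {x : E} (hx : x ∈ F) :
    U • x ∈ F :=
  F.smul_mem _ hx

theorem unit_smul_mem_iff (F : Submodule Atilde E) {U : PowerSeries ℂ}
    (hU : constantCoeff U ≠ 0) {x : E} : U • x ∈ F ↔ x ∈ F := by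
  refine ⟨fun h => ?_, series_smul_mem F U⟩
  have := series_smul_mem F U⁻¹ h
  rwa [smul_smul, PowerSeries.inv_mul_cancel _ hU, one_smul] at this

/-- Every series is in the image of `b ∂_b + σ` modulo the kernel. -/
theorem exists_euler (σ : ℂ) (V : PowerSeries ℂ) :
    ∃ U K : PowerSeries ℂ, V = euler σ U + K ∧ euler σ K = 0 := by
  classical
  -- The operator multiplies the coefficient of `b^n` by `n + σ`. Divide wherever this is nonzero,
  -- and put the remaining resonant coefficient in `K`.
  refine ⟨mk fun n => if (n : ℂ) + σ = 0 then 0 else coeff n V / (n + σ),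
    mk fun n => if (n : ℂ) + σ = 0 then coeff n V else 0, ?_, ?_⟩
  · ext n
    rw [map_add, coeff_euler, coeff_mk, coeff_mk]
    split_ifs with h
    · simp
    · field_simp; simp
  · ext n
    rw [coeff_euler, coeff_mk]
    split_ifs with h <;> simp [h]

theorem eq_X_pow_of_euler_eq_zero {σ : ℂ} {K : PowerSeries ℂ} (h : euler σ K = 0) (hK : K ≠ 0) :
    ∃ (n : ℕ) (c : ℂ), c ≠ 0 ∧ K = C c * X ^ n ∧ (n : ℂ) + σ = 0 := by
  obtain ⟨n, hn⟩ : ∃ n, coeff n K ≠ 0 := by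
    by_contra hcon
    push Not at hcon
    exact hK (by ext n; simpa using hcon n)
  have hco : ∀ m : ℕ, (m : ℂ) + σ = 0 ∨ coeff m K = 0 := by
    intro m
    have := congrArg (coeff m) h
    rw [coeff_euler] at this
    simpa using this
  have hnσ : (n : ℂ) + σ = 0 := (hco n).resolve_right hn
  refine ⟨n, coeff n K, hn, ?_, hnσ⟩
  ext m
  rw [coeff_C_mul, coeff_X_pow]
  split_ifs with hm
  · subst hm; simp
  · rcases hco m with h1 | h1
    · exfalso
      apply hm
      have : (m : ℂ) = n := by linear_combination h1 - hnσ
      exact_mod_cast this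
    · rw [h1]; simp

theorem exists_X_pow_mul_unit {U : PowerSeries ℂ} (hU : U ≠ 0) :
    ∃ (n : ℕ) (V : PowerSeries ℂ), constantCoeff V ≠ 0 ∧ U = X ^ n * V := by
  classical
  have hex : ∃ n, coeff n U ≠ 0 := by
    by_contra hcon
    push Not at hcon
    exact hU (by ext n; simpa using hcon n)
  obtain ⟨V, hV⟩ := PowerSeries.X_pow_dvd_iff.mpr
    fun m (hm : m < Nat.find hex) => not_not.mp (Nat.find_min hex hm)
  refine ⟨Nat.find hex, V, fun h0 => Nat.find_spec hex ?_, hV⟩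
  generalize Nat.find hex = n at hV
  rw [hV, coeff_X_pow_mul', if_pos le_rfl]
  simpa using h0

theorem exists_eq_X_mul {U : PowerSeries ℂ} (hU : constantCoeff U = 0) :
    ∃ V : PowerSeries ℂ, U = X * V := PowerSeries.X_dvd_iff.mpr hU

theorem series_eq_const_add (U : PowerSeries ℂ) :
    ∃ V : PowerSeries ℂ, U = C (constantCoeff U) + X * V := by
  obtain ⟨V, hV⟩ := exists_eq_X_mul (U := U - C (constantCoeff U)) (by simp)
  exact ⟨V, by rw [← hV]; ring⟩

end Twist

/-! ### Division by `a - μ b` in `Ã`, and presentations of rank two modules. -/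

section Division

theorem mul_twist_series (w : Atilde) (μ : ℂ) :
    (w * (a - μ • b)).series = C Polynomial.X * w.series
      - derivative (Polynomial ℂ) w.series * X * X
      - C (Polynomial.C μ) * w.series * X := by
  have h1 : w * (a - μ • b) = w * a + -(μ • (w * b)) := by
    rw [mul_sub, mul_smul_comm, sub_eq_add_neg]
  have h2 : (w * b).series = w.series * X := by
    rw [series_mul, b, series_ofSeries, PowerSeries.map_X,
      ← one_mul (X : PowerSeries (Polynomial ℂ)), seriesMul_mul_X,
      ← map_one (C (R := Polynomial ℂ)), seriesMul_C, map_one]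
    rw [map_one, one_mul]; rfl
  have h3 : ∀ v : Atilde, (μ • v).series = C (Polynomial.C μ) * v.series := by
    intro v
    rw [Algebra.smul_def, series_mul]
    change seriesMul (PowerSeries.map Polynomial.C (C μ)) v.series = _
    rw [PowerSeries.map_C, C_seriesMul]
  rw [h1, series_add, series_neg, h3, h2, series_mul]
  change seriesMul w.series (C Polynomial.X) + _ = _
  rw [seriesMul_C, Polynomial.aeval_X]
  simp only [rightA, LinearMap.coe_mk, AddHom.coe_mk]
  ring

theorem coeff_mul_twist_series_zero (w : Atilde) (μ : ℂ) :
    coeff 0 (w * (a - μ • b)).series = Polynomial.X * coeff 0 w.series := by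
  rw [mul_twist_series]; simp

theorem coeff_mul_twist_series_succ (w : Atilde) (μ : ℂ) (n : ℕ) :
    coeff (n + 1) (w * (a - μ • b)).series = Polynomial.X * coeff (n + 1) w.series
      - Polynomial.C (n + μ) * coeff n w.series := by
  rw [mul_twist_series]
  simp only [map_sub, coeff_C_mul, coeff_succ_mul_X]
  cases n with
  | zero => simp
  | succ n =>
    rw [coeff_succ_mul_X, coeff_derivative]
    push_cast
    rw [Polynomial.C_add, Polynomial.C_add]
    simp
    ring

/-- Division with remainder by `a - μ b` in `Ã`. -/
theorem exists_division (μ : ℂ) (v : Atilde) :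
    ∃ (U : PowerSeries ℂ) (w : Atilde), v = ofSeries U + w * (a - μ • b) := by
  -- In degree `n + 1` in `b` the equation reads `v_{n+1} = U_{n+1} + a q_{n+1} - (n + μ) q_n`. So
  -- `q_{n+1}` and the constant `U_{n+1}` are quotient and remainder of `v_{n+1} + (n + μ) q_n` by
  -- `a`.
  let q : ℕ → Polynomial ℂ := fun n => Nat.rec (Polynomial.divX (coeff 0 v.series))
    (fun n q => Polynomial.divX (coeff (n + 1) v.series + Polynomial.C (n + μ) * q)) n
  refine ⟨mk fun n => Nat.casesOn n ((coeff 0 v.series).coeff 0)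
    fun n => (coeff (n + 1) v.series + Polynomial.C (n + μ) * q n).coeff 0, ⟨mk q⟩, ?_⟩
  apply Atilde.ext
  refine PowerSeries.ext fun n => ?_
  rw [series_add, series_ofSeries, map_add, coeff_map, coeff_mk]
  cases n with
  | zero =>
    rw [coeff_mul_twist_series_zero, coeff_mk]
    change _ = Polynomial.C ((coeff 0 v.series).coeff 0)
      + Polynomial.X * Polynomial.divX (coeff 0 v.series)
    rw [add_comm, Polynomial.X_mul_divX_add]
  | succ n =>
    rw [coeff_mul_twist_series_succ, coeff_mk, coeff_mk]
    have h := Polynomial.X_mul_divX_add (coeff (n + 1) v.series + Polynomial.C (n + μ) * q n)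
    have h2 : q (n + 1)
      = Polynomial.divX (coeff (n + 1) v.series + Polynomial.C (n + μ) * q n) := rfl
    rw [h2]
    linear_combination -h

/-- Uniqueness in the division by `a - μ b`. Inductively on the degree in `b`, the equation says
that a constant is a multiple of the polynomial variable `a`. -/
theorem series_eq_zero_of_division {μ : ℂ} {U : PowerSeries ℂ} {w : Atilde}
    (h : ofSeries U = w * (a - μ • b)) : U = 0 ∧ w = 0 := by
  have hX : ∀ (c : ℂ) (P : Polynomial ℂ), Polynomial.C c = Polynomial.X * P → c = 0 ∧ P = 0 := by
    intro c P hP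
    have h0 : c = 0 := by
      have := congrArg (Polynomial.coeff · 0) hP
      simpa using this
    subst h0
    refine ⟨rfl, ?_⟩
    simpa using hP.symm
  have key : ∀ n, coeff n U = 0 ∧ coeff n w.series = 0 := by
    intro n
    have hn := congrArg (fun v : Atilde => coeff n v.series) h
    simp only [series_ofSeries, coeff_map] at hn
    induction n with
    | zero =>
      rw [coeff_mul_twist_series_zero] at hn
      exact hX _ _ hn
    | succ n ih =>
      rw [coeff_mul_twist_series_succ, (ih (by
        have := congrArg (fun v : Atilde => coeff n v.series) h
        simpa only [series_ofSeries, coeff_map] using this)).2, mul_zero, sub_zero] at hn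
      exact hX _ _ hn
  refine ⟨?_, Atilde.ext (PowerSeries.ext fun n => ?_)⟩
  · ext n
    simpa using (key n).1
  · rw [(key n).2, series_zero, map_zero]

variable {E : Type u} [AddCommGroup E] [Module Atilde E]

theorem exists_smul_eq (μ : ℂ) (v : Atilde) (x : E) :
    ∃ (U : PowerSeries ℂ) (w : Atilde), v • x = U • x + w • twist μ x := by
  obtain ⟨U, w, rfl⟩ := exists_division μ v
  exact ⟨U, w, by rw [add_smul, mul_smul]; rfl⟩

theorem equiv_quotient_of_span {w : Atilde} (x : E) (hx : ∀ y : E, ∃ v : Atilde, y = v • x)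
    (hw : ∀ v : Atilde, v • x = 0 ↔ ∃ z, v = z * w) :
    Nonempty (E ≃ₗ[Atilde] Atilde ⧸ Submodule.span Atilde {w}) := by
  have hker : LinearMap.ker (LinearMap.toSpanSingleton Atilde E x) = Submodule.span Atilde {w} := by
    ext v
    rw [LinearMap.mem_ker, LinearMap.toSpanSingleton_apply, hw, Submodule.mem_span_singleton]
    simp only [smul_eq_mul, eq_comm]
  have hsurj : Function.Surjective (LinearMap.toSpanSingleton Atilde E x) := by
    intro y
    obtain ⟨v, hv⟩ := hx y
    exact ⟨v, by rw [LinearMap.toSpanSingleton_apply, hv]⟩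
  exact ⟨((Submodule.quotEquivOfEq _ _ hker).symm.trans
    (LinearMap.quotKerEquivOfSurjective _ hsurj)).symm⟩

/-- A module with `ℂ[[b]]`-basis `h, e`, where `(a - l b) e = 0` and `(a - μ b) h = S e`. -/
theorem equiv_rankTwo {l μ : ℂ} {S : PowerSeries ℂ} (hS : constantCoeff S ≠ 0) {h e : E}
    (he : twist l e = 0) (hh : twist μ h = S • e)
    (hgen : ∀ x : E, ∃ U V : PowerSeries ℂ, x = U • h + V • e)
    (hind : ∀ U V : PowerSeries ℂ, U • h + V • e = 0 → U = 0 ∧ V = 0) :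
    Nonempty (E ≃ₗ[Atilde] ERankTwo l S μ) := by
  have hSS : ofSeries S⁻¹ • twist μ h = e := by
    rw [hh]
    change S⁻¹ • S • e = e
    rw [smul_smul, PowerSeries.inv_mul_cancel _ hS, one_smul]
  refine equiv_quotient_of_span h (fun y => ?_) (fun v => ⟨fun hv => ?_, ?_⟩)
  · obtain ⟨U, V, rfl⟩ := hgen y
    refine ⟨ofSeries U + ofSeries V * ofSeries S⁻¹ * (a - μ • b), ?_⟩
    rw [add_smul, mul_smul, mul_smul]
    change _ = U • h + V • ofSeries S⁻¹ • twist μ h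
    rw [hSS]
  -- Divide the annihilating element by `a - μ b`, then the quotient times `S` by `a - l b`. The two
  -- remainders are the coordinates of `0` in the basis `h, e`.
  · obtain ⟨U, w, rfl⟩ := exists_division μ v
    obtain ⟨V, z, hz⟩ := exists_division l (w * ofSeries S)
    have h1 : w • twist μ h = V • e := by
      rw [hh, series_smul_def, ← mul_smul, hz, add_smul, mul_smul]
      change _ + z • twist l e = _
      rw [he, smul_zero, add_zero]; rfl
    have h2 : U • h + V • e = 0 := by
      rw [← h1, ← hv, add_smul, mul_smul]; rfl
    obtain ⟨rfl, rfl⟩ := hind _ _ h2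
    refine ⟨z, ?_⟩
    have h3 : w = w * ofSeries S * ofSeries S⁻¹ := by
      rw [mul_assoc, ← map_mul, PowerSeries.mul_inv_cancel _ hS, map_one, mul_one]
    rw [h3, hz]
    simp only [map_zero, zero_add, mul_assoc]
  · rintro ⟨z, rfl⟩
    rw [mul_smul, mul_smul, mul_smul]
    change z • (twist l (ofSeries S⁻¹ • twist μ h)) = 0
    rw [hSS, he, smul_zero]

/-- Converse of `equiv_rankTwo`: `h` is the class of `1` and `e = S⁻¹ (a - μ b) h`. Two divisions
with remainder give generation, and their uniqueness gives independence. -/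
theorem exists_basis_rankTwo {l μ : ℂ} {S : PowerSeries ℂ} (hS : constantCoeff S ≠ 0)
    (hE : Nonempty (E ≃ₗ[Atilde] ERankTwo l S μ)) :
    ∃ h e : E, twist l e = 0 ∧ twist μ h = S • e ∧
      (∀ x : E, ∃ U V : PowerSeries ℂ, x = U • h + V • e) ∧
      ∀ U V : PowerSeries ℂ, U • h + V • e = 0 → U = 0 ∧ V = 0 := by
  obtain ⟨f⟩ := hE
  set h := f.symm (Submodule.Quotient.mk 1) with hh
  have hv : ∀ v : Atilde, v • h = f.symm (Submodule.Quotient.mk v) := by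
    intro v
    rw [hh, ← map_smul, ← Submodule.Quotient.mk_smul, smul_eq_mul, mul_one]
  have hv0 : ∀ v : Atilde, v • h = 0 ↔
      ∃ z, z * ((a - l • b) * ofSeries S⁻¹ * (a - μ • b)) = v := by
    intro v
    rw [hv, LinearEquiv.map_eq_zero_iff, Submodule.Quotient.mk_eq_zero,
      Submodule.mem_span_singleton]
    rfl
  have he : twist l (S⁻¹ • twist μ h) = 0 := by
    have := (hv0 _).mpr ⟨1, one_mul _⟩
    rwa [mul_smul, mul_smul] at this
  have hSe : twist μ h = S • S⁻¹ • twist μ h := by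
    rw [smul_smul, PowerSeries.mul_inv_cancel _ hS, one_smul]
  refine ⟨h, S⁻¹ • twist μ h, he, hSe, fun x => ?_, fun U V hUV => ?_⟩
  · obtain ⟨v, hvx⟩ := Submodule.Quotient.mk_surjective _ (f x)
    have hx : x = v • h := by rw [hv, hvx, LinearEquiv.symm_apply_apply]
    obtain ⟨U, w, hU⟩ := exists_smul_eq μ v h
    obtain ⟨V, z, hV⟩ := exists_smul_eq l (w * ofSeries S) (S⁻¹ • twist μ h)
    refine ⟨U, V, ?_⟩
    rw [he, smul_zero, add_zero, mul_smul] at hV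
    rw [hx, hU, ← hV, ← series_smul_def, ← hSe]
  · have h1 : (ofSeries U + ofSeries V * ofSeries S⁻¹ * (a - μ • b)) • h = 0 := by
      rw [add_smul, mul_smul, mul_smul]
      exact hUV
    obtain ⟨z, hz⟩ := (hv0 _).mp h1
    have h2 : ofSeries U
        = (z * (a - l • b) * ofSeries S⁻¹ - ofSeries V * ofSeries S⁻¹) * (a - μ • b) := by
      rw [sub_mul, eq_sub_iff_add_eq, ← hz]
      simp only [mul_assoc]
    obtain ⟨hU, hw⟩ := series_eq_zero_of_division h2
    refine ⟨hU, (series_eq_zero_of_division (μ := l) (w := z) ?_).1⟩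
    have h3 : ∀ v : Atilde, v * ofSeries S⁻¹ * ofSeries S = v := by
      intro v
      rw [mul_assoc, ← map_mul, PowerSeries.inv_mul_cancel _ hS, map_one, mul_one]
    rw [← h3 (ofSeries V), ← sub_eq_zero.mp hw, h3]

end Division

end

/-! ### Flags, their eigenvectors, and uniqueness of the principal one. -/

section

variable {E : Type u} [AddCommGroup E] [Module Atilde E]

/-- A full flag `F 0 = 0 ⊂ ⋯ ⊂ F k = E` of submodules with `F (j+1) = ℂ[[b]] e (j+1) ⊕ F j`,
where `(a - l b) e` is triangular with invertible entries next to the diagonal. -/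
structure Flag (k : ℕ) (F : ℕ → Submodule Atilde E) (l : ℕ → ℚ) (e : ℕ → E) : Prop where
  zero : F 0 = ⊥
  top : F k = ⊤
  le_succ : ∀ j < k, F j ≤ F (j + 1)
  mem : ∀ j < k, e (j + 1) ∈ F (j + 1)
  span : ∀ j < k, ∀ x ∈ F (j + 1), ∃ U : PowerSeries ℂ, x - U • e (j + 1) ∈ F j
  free : ∀ j < k, ∀ U : PowerSeries ℂ, U • e (j + 1) ∈ F j → U = 0
  eig : ∀ j < k, twist (l (j + 1) : ℂ) (e (j + 1)) ∈ F j
  unit : ∀ j, j + 1 < k → ∃ S : PowerSeries ℂ, constantCoeff S ≠ 0 ∧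
    twist (l (j + 2) : ℂ) (e (j + 2)) - S • e (j + 1) ∈ F j

/-- `j ↦ l j + j` is non-decreasing for `1 ≤ j ≤ k`. -/
def Principal (k : ℕ) (l : ℕ → ℚ) : Prop :=
  ∀ i j : ℕ, 1 ≤ i → i ≤ j → j ≤ k → l i + i ≤ l j + j

namespace Flag

variable {k : ℕ} {F : ℕ → Submodule Atilde E} {l : ℕ → ℚ} {e : ℕ → E}

theorem mono (hF : Flag k F l e) {i j : ℕ} (hij : i ≤ j) (hj : j ≤ k) : F i ≤ F j := by
  induction j, hij using Nat.le_induction with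
  | base => exact le_rfl
  | succ j hij ih => exact (ih (by omega)).trans (hF.le_succ j (by omega))

theorem mem_top (hF : Flag k F l e) (x : E) : x ∈ F k := by
  rw [hF.top]; trivial

/-- `E / F j` is torsion-free over `ℂ[[b]]`, being a successive extension of free modules of rank
one. The proof descends from `F k`. -/
theorem mem_of_smul_mem (hF : Flag k F l e) {j : ℕ} (hj : j ≤ k) {U : PowerSeries ℂ} (hU : U ≠ 0)
    {x : E} (h : U • x ∈ F j) : x ∈ F j := by
  have key : ∀ m, j ≤ m → m ≤ k → x ∈ F m → x ∈ F j := by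
    intro m hm
    induction m, hm using Nat.le_induction with
    | base => exact fun _ h => h
    | succ m hm ih =>
      intro hmk hx
      obtain ⟨V, hV⟩ := hF.span m (by omega) x hx
      have h1 : (U * V) • e (m + 1) ∈ F m := by
        have h2 := (F m).sub_mem (hF.mono hm (by omega) h) (series_smul_mem _ U hV)
        convert h2 using 1
        module
      have h3 := hF.free m (by omega) _ h1
      rcases mul_eq_zero.mp h3 with h4 | h4
      · exact absurd h4 hU
      · subst h4
        exact ih (by omega) (by simpa using hV)
  exact key k hj le_rfl (hF.mem_top x)

theorem X_pow_smul_mem_iff (hF : Flag k F l e) {j : ℕ} (hj : j ≤ k) (n : ℕ) {x : E} :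
    (X ^ n : PowerSeries ℂ) • x ∈ F j ↔ x ∈ F j :=
  ⟨hF.mem_of_smul_mem hj (pow_ne_zero _ X_ne_zero), series_smul_mem _ _⟩

theorem smul_eq_zero (hF : Flag k F l e) {U : PowerSeries ℂ} (hU : U ≠ 0) {x : E}
    (h : U • x = 0) : x = 0 := by
  have := hF.mem_of_smul_mem (Nat.zero_le k) hU (x := x) (by rw [hF.zero, h]; exact zero_mem _)
  rwa [hF.zero, Submodule.mem_bot] at this

theorem notMem (hF : Flag k F l e) {j : ℕ} (hj : j < k) : e (j + 1) ∉ F j := by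
  intro h
  exact one_ne_zero (hF.free j hj 1 (by simpa using h))

theorem coeff_unique (hF : Flag k F l e) {j : ℕ} (hj : j < k) {U V : PowerSeries ℂ} {x : E}
    (hU : x - U • e (j + 1) ∈ F j) (hV : x - V • e (j + 1) ∈ F j) : U = V := by
  have h := (F j).sub_mem hV hU
  have := hF.free j hj (U - V) (by convert h using 1; module)
  exact sub_eq_zero.mp this

theorem twist_coeff (hF : Flag k F l e) {j : ℕ} (hj : j < k) (ν : ℂ) {U : PowerSeries ℂ} {x : E}
    (hU : x - U • e (j + 1) ∈ F j) :
    twist ν x - (X * euler (l (j + 1) - ν) U) • e (j + 1) ∈ F j := by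
  have h1 := (F j).add_mem (twist_mem _ ν hU) (series_smul_mem _ U (hF.eig j hj))
  rw [twist_sub, twist_smul ν (l (j + 1))] at h1
  convert h1 using 1
  module

/-- The term `U * S` coming from the level above carries no factor `b`, whereas all diagonal terms
do. This is how the units `S` are exploited below. -/
theorem twist_coeff_two (hF : Flag k F l e) {j : ℕ} (hj : j + 1 < k) (ν : ℂ)
    {S U W : PowerSeries ℂ} {x : E}
    (hS : twist (l (j + 2) : ℂ) (e (j + 2)) - S • e (j + 1) ∈ F j)
    (hU : x - U • e (j + 2) - W • e (j + 1) ∈ F j) :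
    twist ν x - (X * euler (l (j + 2) - ν) U) • e (j + 2)
      - (U * S + X * euler (l (j + 1) - ν) W) • e (j + 1) ∈ F j := by
  have h1 := (F j).add_mem ((F j).add_mem (twist_mem _ ν hU)
    (series_smul_mem _ W (hF.eig j (by omega)))) (series_smul_mem _ U hS)
  rw [twist_sub, twist_sub, twist_smul ν (l (j + 1)) W, twist_smul ν (l (j + 2)) U] at h1
  convert h1 using 1
  module

/-- A vector killed by `a - ν b` modulo `F j` has a monomial as leading coefficient. -/
theorem coeff_of_twist_mem (hF : Flag k F l e) {j : ℕ} (hj : j < k) {ν : ℂ} {U : PowerSeries ℂ}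
    {x : E} (hU : x - U • e (j + 1) ∈ F j) (hx : twist ν x ∈ F j) (hU0 : U ≠ 0) :
    ∃ (n : ℕ) (c : ℂ), c ≠ 0 ∧ U = C c * X ^ n ∧ ν = l (j + 1) + n := by
  have h1 := (F j).sub_mem hx (hF.twist_coeff hj ν hU)
  have h2 := hF.free j hj (X * euler (l (j + 1) - ν) U) (by convert h1 using 1; module)
  have h3 : euler (l (j + 1) - ν) U = 0 := (mul_eq_zero.mp h2).resolve_left X_ne_zero
  obtain ⟨n, c, hc, hK, hn⟩ := eq_X_pow_of_euler_eq_zero h3 hU0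
  exact ⟨n, c, hc, hK, by linear_combination -hn⟩

/-- On `E / b E`, the endomorphism induced by `a` is a single nilpotent Jordan block. -/
theorem mem_of_a_smul_mem (hF : Flag k F l e) {j : ℕ} (hj : j < k) {y z : E}
    (h : a • y - (X : PowerSeries ℂ) • z ∈ F j) :
    ∃ z' : E, y - (X : PowerSeries ℂ) • z' ∈ F (j + 1) := by
  -- Descending induction on `m`, from `F k`. If `V` is the top coefficient of `y` modulo `b E`,
  -- then the next coefficient of `a y` is `V S` modulo `b`. It must vanish there, so `b` divides
  -- `V`, and the top term moves into `b E`.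
  have key : ∀ d m, m + d = k → j + 1 ≤ m → ∃ z' : E, y - (X : PowerSeries ℂ) • z' ∈ F m := by
    intro d
    induction d with
    | zero =>
      rintro m rfl -
      exact ⟨0, hF.mem_top _⟩
    | succ d ih =>
      intro m hmd hjm
      obtain ⟨i, rfl⟩ : ∃ i, m = i + 1 := ⟨m - 1, by omega⟩
      obtain ⟨z', hz'⟩ := ih (i + 1 + 1) (by omega) (by omega)
      obtain ⟨V, hV⟩ := hF.span (i + 1) (by omega) _ hz'
      obtain ⟨W, hW⟩ := hF.span i (by omega) _ hV
      obtain ⟨S, hS0, hS⟩ := hF.unit i (by omega)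
      have h1 := hF.twist_coeff_two (by omega) 0 hS hW
      have h2 := (F i).sub_mem h1 (hF.mono (by omega : j ≤ i) (by omega) h)
      rw [twist_def, smul_sub, a_smul_smul] at h2
      set A := euler (l (i + 2) - 0) V
      set B := euler (l (i + 1) - 0) W
      have h3 : (V * S) • e (i + 1) - (X : PowerSeries ℂ) • (z - a • z'
          - (X * derivative ℂ X : PowerSeries ℂ) • z' - A • e (i + 2) - B • e (i + 1)) ∈ F i := by
        have h4 := (F i).neg_mem h2
        convert h4 using 1
        simp only [map_zero, zero_mul, zero_smul, sub_zero]
        generalize a • y = y1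
        generalize a • z' = z1
        module
      generalize (z - a • z'
          - (X * derivative ℂ X : PowerSeries ℂ) • z' - A • e (i + 2) - B • e (i + 1)) = q at h3
      have hq : q ∈ F (i + 1) := by
        have h5 := (F (i + 1)).sub_mem (series_smul_mem _ (V * S) (hF.mem i (by omega)))
          (hF.le_succ i (by omega) h3)
        rw [sub_sub_cancel] at h5
        exact hF.mem_of_smul_mem (by omega) X_ne_zero h5
      obtain ⟨Q, hQ⟩ := hF.span i (by omega) q hq
      have h6 := hF.free i (by omega) (V * S - X * Q) (by
        have := (F i).add_mem h3 (series_smul_mem _ X hQ)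
        convert this using 1
        module)
      have h7 := congrArg constantCoeff h6
      simp only [map_sub, map_mul, constantCoeff_X, zero_mul, sub_zero, map_zero] at h7
      obtain ⟨V', rfl⟩ := exists_eq_X_mul ((mul_eq_zero.mp h7).resolve_right hS0)
      refine ⟨z' + V' • e (i + 2), ?_⟩
      convert hV using 1
      module
  exact key (k - (j + 1)) (j + 1) (by omega) le_rfl

/-- An eigenvector modulo `F s` gains a factor `b` at each level. If `x ≡ b^t z` modulo `F (s + t)`,
cancelling `b^t` gives `a z ∈ F (s + t) + b E`, hence `z ∈ F (s + t + 1) + b E` by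
`mem_of_a_smul_mem`. -/
theorem exists_of_twist_mem (hF : Flag k F l e) {s : ℕ} {ν : ℂ} {x : E} (hx : twist ν x ∈ F s)
    (t : ℕ) (ht : s + t ≤ k) : ∃ z : E, x - (X ^ t : PowerSeries ℂ) • z ∈ F (s + t) := by
  induction t with
  | zero => exact ⟨x, by simp⟩
  | succ t ih =>
    obtain ⟨z, hz⟩ := ih (by omega)
    have h1 := (F (s + t)).sub_mem (hF.mono (by omega : s ≤ s + t) (by omega) hx)
      (twist_mem _ ν hz)
    have h2 := twist_X_pow_smul (ν - t) t z
    rw [sub_add_cancel] at h2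
    rw [twist_sub, h2, sub_sub_cancel, hF.X_pow_smul_mem_iff (by omega), twist_def, mul_comm,
      mul_smul] at h1
    obtain ⟨z', hz'⟩ := hF.mem_of_a_smul_mem (by omega) h1
    refine ⟨z', ?_⟩
    have h3 := (F (s + t + 1)).add_mem (hF.le_succ (s + t) (by omega) hz)
      (series_smul_mem _ (X ^ t) hz')
    rw [← add_assoc s t 1]
    convert h3 using 1
    module

theorem exists_level (hF : Flag k F l e) {s : ℕ} (hs : s ≤ k) {x : E} (hx : x ∉ F s) :
    ∃ J, s ≤ J ∧ J < k ∧ x ∉ F J ∧ x ∈ F (J + 1) := by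
  by_contra hcon
  push Not at hcon
  have key : ∀ J, s ≤ J → J ≤ k → x ∉ F J := by
    intro J hJ
    induction J, hJ using Nat.le_induction with
    | base => exact fun _ => hx
    | succ J hJ ih => exact fun h => hcon J hJ (by omega) (ih (by omega))
  exact key k hs le_rfl (hF.mem_top x)

theorem coeff_dvd (hF : Flag k F l e) {j : ℕ} (hj : j < k) {t : ℕ} {U : PowerSeries ℂ} {x z : E}
    (hU : x - U • e (j + 1) ∈ F j) (hz : x - (X ^ t : PowerSeries ℂ) • z ∈ F j) :
    X ^ t ∣ U := by
  have h1 : (X ^ t : PowerSeries ℂ) • z ∈ F (j + 1) := by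
    have h2 := (F (j + 1)).sub_mem ((F (j + 1)).add_mem (hF.le_succ j hj hU)
      (series_smul_mem _ U (hF.mem j hj))) (hF.le_succ j hj hz)
    convert h2 using 1
    module
  rw [hF.X_pow_smul_mem_iff (by omega)] at h1
  obtain ⟨W, hW⟩ := hF.span j hj z h1
  have h3 := hF.coeff_unique hj hU (V := X ^ t * W) (by
    have := (F j).add_mem hz (series_smul_mem _ (X ^ t) hW)
    convert this using 1
    module)
  exact ⟨W, h3⟩

/-- This characterizes `l (s + 1)` as the least rational eigenvalue modulo `F s`, with its
eigenvectors in `F (s + 1)`. If the leading term of `x` is `c b^n e (J + 1)`, then `ν = l (J + 1) +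
n`. Moreover `n ≥ J - s` by `exists_of_twist_mem`, and monotonicity of `l j + j` concludes. -/
theorem le_of_twist_mem (hF : Flag k F l e) (hp : Principal k l) {s : ℕ} (hs : s < k) {ν : ℚ}
    {x : E} (hx : twist (ν : ℂ) x ∈ F s) (hxs : x ∉ F s) :
    l (s + 1) ≤ ν ∧ (ν = l (s + 1) → x ∈ F (s + 1)) := by
  obtain ⟨J, hsJ, hJk, hxJ, hxJ'⟩ := hF.exists_level hs.le hxs
  obtain ⟨U, hU⟩ := hF.span J hJk x hxJ'
  have hU0 : U ≠ 0 := by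
    rintro rfl
    exact hxJ (by simpa using hU)
  obtain ⟨n, c, hc, rfl, hν⟩ := hF.coeff_of_twist_mem hJk hU (hF.mono hsJ hJk.le hx) hU0
  have hνq : ν = l (J + 1) + n := by exact_mod_cast hν
  obtain ⟨z, hz⟩ := hF.exists_of_twist_mem hx (J - s) (by omega)
  rw [Nat.add_sub_cancel' hsJ] at hz
  have hn : J - s ≤ n := by
    by_contra hcon
    have h1 := (PowerSeries.X_pow_dvd_iff.mp (hF.coeff_dvd hJk hU hz)) n (by omega)
    rw [coeff_C_mul, coeff_X_pow_self, mul_one] at h1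
    exact hc h1
  have hn' : (J : ℚ) ≤ s + n := by exact_mod_cast (by omega : J ≤ s + n)
  have h1 := hp (s + 1) (J + 1) (by omega) (by omega) (by omega)
  push_cast at h1
  refine ⟨by linarith, fun heq => ?_⟩
  rcases Nat.eq_or_lt_of_le hsJ with rfl | hlt
  · exact hxJ'
  exfalso
  -- Equality at a level `J > s` forces `l (i + 1) = l (i + 2) + 1` and `n = J - s`. The coefficient
  -- of `e (i + 1)` in `(a - ν b) x` is then `b^n (c S + b ∂_b B)`. Its vanishing contradicts `c
  -- S(0) ≠ 0`.
  obtain ⟨i, rfl⟩ : ∃ i, J = i + 1 := ⟨J - 1, by omega⟩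
  have h2 := hp (s + 1) (i + 1) (by omega) (by omega) (by omega)
  have h3 := hp (i + 1) (i + 1 + 1) (by omega) (by omega) (by omega)
  push_cast at h1 h2 h3 hn'
  have hl : l (i + 1) = l (i + 2) + 1 := by
    change l (i + 1) = l (i + 1 + 1) + 1
    linarith
  have hns : (n : ℚ) = i + 1 - s := by linarith
  have hns' : n = i - s + 1 := by
    have : (n + s : ℚ) = i + 1 := by linarith
    have : n + s = i + 1 := by exact_mod_cast this
    omega
  obtain ⟨W, hW⟩ := hF.span i (by omega) _ hU
  obtain ⟨S, hS0, hS⟩ := hF.unit i hJk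
  obtain ⟨y, hy⟩ := hF.exists_of_twist_mem hx (i - s) (by omega)
  rw [Nat.add_sub_cancel' (by omega : s ≤ i)] at hy
  have hdiv : X ^ (i - s) ∣ W := by
    refine hF.coeff_dvd (by omega) (x := x - (C c * X ^ n : PowerSeries ℂ) • e (i + 2))
      (z := y - (C c * X : PowerSeries ℂ) • e (i + 2)) hW ?_
    convert hy using 1
    rw [hns']
    module
  obtain ⟨B, rfl⟩ := hdiv
  have h4 := hF.twist_coeff_two hJk ν hS hW
  have h5 := (F i).sub_mem (hF.mono (by omega : s ≤ i) (by omega) hx) h4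
  have h6 : euler (l (i + 2) - ν) (C c * X ^ n) = 0 := by
    rw [hν, mul_comm (C c), euler_X_pow_mul, euler_C]
    simp
  rw [h6, euler_X_pow_mul] at h5
  have h7 := hF.free i (by omega) (C c * X ^ n * S
    + X * (X ^ (i - s) * euler (l (i + 1) - ν + ((i - s : ℕ) : ℂ)) B)) (by convert h5 using 1; module)
  have h8 : X ^ n * (C c * S + euler (l (i + 1) - ν + ((i - s : ℕ) : ℂ)) B) = 0 := by
    rw [← h7, hns', pow_succ]
    ring
  have h9 : (l (i + 1) : ℂ) - ν + ((i - s : ℕ) : ℂ) = 0 := by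
    rw [hν, hl, hns']
    push_cast
    ring
  have h10 := congrArg constantCoeff
    ((mul_eq_zero.mp h8).resolve_left (pow_ne_zero _ X_ne_zero))
  rw [h9] at h10
  simp [euler] at h10
  exact h10.elim hc hS0

/-- Given `F j`, the number `l (j + 1)` and the submodule `F (j + 1)` are determined by
`le_of_twist_mem`, applied to each flag with the first vector of the other. -/
theorem unique (hF : Flag k F l e) (hp : Principal k l) {F' : ℕ → Submodule Atilde E}
    {l' : ℕ → ℚ} {e' : ℕ → E} (hF' : Flag k F' l' e') (hp' : Principal k l') :
    (∀ j ≤ k, F j = F' j) ∧ ∀ j < k, l (j + 1) = l' (j + 1) := by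
  have key : ∀ {F F' : ℕ → Submodule Atilde E} {l l' : ℕ → ℚ} {e e' : ℕ → E},
      Flag k F l e → Principal k l → Flag k F' l' e' → ∀ j < k, F j = F' j →
      l (j + 1) ≤ l' (j + 1) ∧ (l' (j + 1) = l (j + 1) → F' (j + 1) ≤ F (j + 1)) := by
    intro F F' l l' e e' hF hp hF' j hj hFF
    have h1 := hF.le_of_twist_mem hp hj (ν := l' (j + 1)) (x := e' (j + 1))
      (by rw [hFF]; exact hF'.eig j hj) (by rw [hFF]; exact hF'.notMem hj)
    refine ⟨h1.1, fun heq x hx => ?_⟩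
    obtain ⟨U, hU⟩ := hF'.span j hj x hx
    rw [← hFF] at hU
    have := (F (j + 1)).add_mem (hF.le_succ j hj hU) (series_smul_mem _ U (h1.2 heq))
    rwa [sub_add_cancel] at this
  have h : ∀ j ≤ k, F j = F' j := by
    intro j
    induction j with
    | zero => intro _; rw [hF.zero, hF'.zero]
    | succ j ih =>
      intro hj
      have hj' := ih (by omega)
      have h1 := key hF hp hF' j (by omega) hj'
      have h2 := key hF' hp' hF j (by omega) hj'.symm
      have h3 := le_antisymm h1.1 h2.1
      exact le_antisymm (h2.2 h3) (h1.2 h3.symm)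
  refine ⟨h, fun j hj => le_antisymm ?_ ?_⟩
  · exact (key hF hp hF' j hj (h j hj.le)).1
  · exact (key hF' hp' hF j hj (h j hj.le).symm).1

/-- After normalization, applying `a - l (j + 1) b` removes the leading term and leaves a unit
leading coefficient one level below, thanks to the unit `S`. Induction then recovers the lower
levels. -/
theorem le_span (hF : Flag k F l e) {j : ℕ} (hj : j < k) {D : PowerSeries ℂ}
    (hD : constantCoeff D ≠ 0) {x : E} (hx : x - D • e (j + 1) ∈ F j) :
    F (j + 1) ≤ Submodule.span Atilde {x} := by
  induction j generalizing D x with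
  | zero =>
    intro y hy
    obtain ⟨U, hU⟩ := hF.span 0 hj y hy
    rw [hF.zero, Submodule.mem_bot, sub_eq_zero] at hx hU
    subst hx hU
    refine series_smul_mem _ _ ?_
    rw [← unit_smul_mem_iff _ hD]
    exact Submodule.mem_span_singleton_self _
  | succ j ih =>
    have hx' : D⁻¹ • x ∈ Submodule.span Atilde {x} :=
      series_smul_mem _ _ (Submodule.mem_span_singleton_self _)
    have h1 : D⁻¹ • x - (1 : PowerSeries ℂ) • e (j + 2) ∈ F (j + 1) := by
      have := series_smul_mem _ D⁻¹ hx
      rwa [smul_sub, smul_smul, PowerSeries.inv_mul_cancel _ hD] at this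
    obtain ⟨W, hW⟩ := hF.span j (by omega) _ h1
    obtain ⟨S, hS0, hS⟩ := hF.unit j (by omega)
    have h2 := hF.twist_coeff_two hj (l (j + 2)) hS hW
    have h3 : euler ((l (j + 2) : ℂ) - l (j + 2)) 1 = 0 := by simp [euler]
    rw [h3, mul_zero, zero_smul, sub_zero] at h2
    have h4 := ih (by omega) (by simpa using hS0) h2
    have h5 : F (j + 1) ≤ Submodule.span Atilde {x} :=
      h4.trans ((Submodule.span_singleton_le_iff_mem _ _).mpr (twist_mem _ _ hx'))
    have h6 : e (j + 2) ∈ Submodule.span Atilde {x} := by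
      have := (Submodule.span Atilde {x}).sub_mem hx' (h5 h1)
      rwa [sub_sub_cancel, one_smul] at this
    intro y hy
    obtain ⟨U, hU⟩ := hF.span (j + 1) hj y hy
    have := (Submodule.span Atilde {x}).add_mem (h5 hU) (series_smul_mem _ U h6)
    rwa [sub_add_cancel] at this

end Flag

end

section

variable {E : Type u} [AddCommGroup E] [Module Atilde E]

/-! ### From a principal Jordan–Hölder sequence of a cyclic module to a flag, and back. -/

section JordanHolder

theorem exists_generator_of_quot {P Q : Submodule Atilde E} {l : ℂ}
    (h : Nonempty ((Q ⧸ P.comap Q.subtype) ≃ₗ[Atilde] ERankOne l)) :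
    ∃ x ∈ Q, twist l x ∈ P ∧ (∀ y ∈ Q, ∃ U : PowerSeries ℂ, y - U • x ∈ P) ∧
      ∀ U : PowerSeries ℂ, U • x ∈ P → U = 0 := by
  obtain ⟨f⟩ := h
  obtain ⟨⟨x, hxQ⟩, hx⟩ := Submodule.Quotient.mk_surjective _
    (f.symm (Submodule.Quotient.mk 1))
  have hmem : ∀ v : Atilde, v • x ∈ P ↔ ∃ w, v = w * (a - l • b) := by
    intro v
    have h1 : v • x ∈ P ↔ f (v • (Submodule.Quotient.mk ⟨x, hxQ⟩)) = 0 := by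
      rw [LinearEquiv.map_eq_zero_iff, ← Submodule.Quotient.mk_smul,
        Submodule.Quotient.mk_eq_zero]
      rfl
    rw [h1, map_smul, hx, LinearEquiv.apply_symm_apply, ← Submodule.Quotient.mk_smul,
      Submodule.Quotient.mk_eq_zero, Submodule.mem_span_singleton]
    simp only [smul_eq_mul, mul_one, eq_comm]
  have htw : twist l x ∈ P := (hmem _).mpr ⟨1, (one_mul _).symm⟩
  refine ⟨x, hxQ, htw, fun y hy => ?_, fun U hU => ?_⟩
  · obtain ⟨v, hv⟩ := Submodule.Quotient.mk_surjective _ (f (Submodule.Quotient.mk ⟨y, hy⟩))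
    have h2 : y - v • x ∈ P := by
      have h3 : f (Submodule.Quotient.mk (⟨y, hy⟩ - v • ⟨x, hxQ⟩)) = 0 := by
        rw [Submodule.Quotient.mk_sub, Submodule.Quotient.mk_smul, map_sub, map_smul, hx,
          LinearEquiv.apply_symm_apply, ← hv, ← Submodule.Quotient.mk_smul]
        simp
      rw [LinearEquiv.map_eq_zero_iff, Submodule.Quotient.mk_eq_zero] at h3
      exact h3
    obtain ⟨U, w, hU⟩ := exists_smul_eq l v x
    refine ⟨U, ?_⟩
    have := P.add_mem h2 (P.smul_mem w htw)
    rw [hU] at this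
    convert this using 1
    abel
  · obtain ⟨w, hw⟩ := (hmem (ofSeries U)).mp hU
    exact (series_eq_zero_of_division hw).1

theorem span_unit_smul {V : PowerSeries ℂ} (hV : constantCoeff V ≠ 0) (g : E) :
    Submodule.span Atilde {V • g} = Submodule.span Atilde {g} := by
  apply le_antisymm <;> rw [Submodule.span_singleton_le_iff_mem]
  · exact series_smul_mem _ _ (Submodule.mem_span_singleton_self _)
  · rw [← unit_smul_mem_iff _ hV]
    exact Submodule.mem_span_singleton_self _

/-- A unit multiple of the generator `g` of `Q` is an eigenvector for `l` modulo `P`. Dividing an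
element of `P` by `a - l b` then leaves no remainder, so `P` is again cyclic, generated by the image
of that vector under `a - l b`. -/
theorem exists_normalized_generator {P Q : Submodule Atilde E} {l : ℂ} (hPQ : P ≤ Q)
    (h : Nonempty ((Q ⧸ P.comap Q.subtype) ≃ₗ[Atilde] ERankOne l)) {g : E}
    (hg : Submodule.span Atilde {g} = Q) :
    ∃ x ∈ Q, (∃ V : PowerSeries ℂ, constantCoeff V ≠ 0 ∧ g = V • x) ∧ twist l x ∈ P ∧
      (∀ y ∈ Q, ∃ U : PowerSeries ℂ, y - U • x ∈ P) ∧
      (∀ U : PowerSeries ℂ, U • x ∈ P → U = 0) ∧ Submodule.span Atilde {twist l x} = P := by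
  obtain ⟨x, hxQ, hxP, hspan, hfree⟩ := exists_generator_of_quot h
  have hgQ : g ∈ Q := hg ▸ Submodule.mem_span_singleton_self g
  obtain ⟨D, hD⟩ := hspan g hgQ
  have hD0 : D ≠ 0 := by
    rintro rfl
    have h1 : Q ≤ P := by
      rw [← hg, Submodule.span_singleton_le_iff_mem]
      simpa using hD
    exact one_ne_zero (hfree 1 (by simpa using h1 hxQ))
  obtain ⟨n, V, hV, rfl⟩ := exists_X_pow_mul_unit hD0
  have hVinv : constantCoeff V⁻¹ ≠ 0 := by simpa using hV
  have hg' : Submodule.span Atilde {V⁻¹ • g} = Q := by rw [span_unit_smul hVinv, hg]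
  have hgg : g = V • V⁻¹ • g := by
    rw [smul_smul, PowerSeries.mul_inv_cancel _ hV, one_smul]
  have hx' : V⁻¹ • g - (X ^ n : PowerSeries ℂ) • x ∈ P := by
    have := series_smul_mem _ V⁻¹ hD
    rwa [smul_sub, smul_smul, mul_left_comm, PowerSeries.inv_mul_cancel _ hV, mul_one] at this
  generalize V⁻¹ • g = g' at hg' hgg hx'
  -- Modulo `P`, the span of `g'` consists of multiples of `b^n x`. Since it contains `x`, this
  -- forces `n = 0`.
  have hn : n = 0 := by
    have h1 : twist (l + n) g' ∈ P := by
      have := P.add_mem (twist_mem _ (l + n) hx') (series_smul_mem _ (X ^ n) hxP)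
      rwa [twist_sub, twist_X_pow_smul, sub_add_cancel] at this
    obtain ⟨v, hv⟩ := Submodule.mem_span_singleton.mp (hg'.symm ▸ hxQ : x ∈ _)
    obtain ⟨U, w, hU⟩ := exists_smul_eq (l + n) v g'
    have h2 : (1 - U * X ^ n) • x ∈ P := by
      have := P.add_mem (series_smul_mem _ U hx') (P.smul_mem w h1)
      convert this using 1
      rw [sub_smul, one_smul]
      nth_rw 1 [← hv]
      rw [hU, smul_sub, smul_smul]
      abel
    have h3 := congrArg constantCoeff (hfree _ h2)
    by_contra hn
    simp [hn] at h3
  subst hn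
  rw [pow_zero, one_smul] at hx'
  have htw : twist l g' ∈ P := by
    have := P.add_mem (twist_mem _ l hx') hxP
    rwa [twist_sub, sub_add_cancel] at this
  have hfree' : ∀ U : PowerSeries ℂ, U • g' ∈ P → U = 0 := by
    intro U hU
    refine hfree U ?_
    have := P.sub_mem hU (series_smul_mem _ U hx')
    rwa [smul_sub, sub_sub_cancel] at this
  refine ⟨g', hg' ▸ Submodule.mem_span_singleton_self g', ⟨V, hV, hgg⟩, htw, fun y hy => ?_,
    hfree', le_antisymm ?_ fun y hy => ?_⟩
  · obtain ⟨U, hU⟩ := hspan y hy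
    refine ⟨U, ?_⟩
    have := P.sub_mem hU (series_smul_mem _ U hx')
    convert this using 1
    module
  · rwa [Submodule.span_singleton_le_iff_mem]
  · obtain ⟨v, hv⟩ := Submodule.mem_span_singleton.mp (hg'.symm ▸ hPQ hy : y ∈ _)
    obtain ⟨U, w, hU⟩ := exists_smul_eq l v g'
    rw [hv] at hU
    have h1 : U • g' ∈ P := by
      have := P.sub_mem hy (P.smul_mem w htw)
      rw [hU] at this
      simpa using this
    rw [hfree' U h1, zero_smul, zero_add] at hU
    rw [hU]
    exact Submodule.smul_mem _ _ (Submodule.mem_span_singleton_self _)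

/-- Descend from a generator of `E`: once `e_m` is normalized, `(a - l_m b) e_m` generates `F (m -
1)` and so is a unit multiple of the next vector `e_{m-1}`. This is the source of the units in
`Flag`. -/
theorem IsPrincipalJH.exists_flag {k : ℕ} {F : ℕ → Submodule Atilde E} {l : ℕ → ℚ}
    (hF : IsPrincipalJH k F l) {g : E} (hg : Submodule.span Atilde {g} = ⊤) :
    ∃ e, Flag k F l e := by
  have key : ∀ m ≤ k, ∀ g, Submodule.span Atilde {g} = F m → ∃ e : ℕ → E,
      (∀ j < m, e (j + 1) ∈ F (j + 1) ∧
        (∀ x ∈ F (j + 1), ∃ U : PowerSeries ℂ, x - U • e (j + 1) ∈ F j) ∧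
        (∀ U : PowerSeries ℂ, U • e (j + 1) ∈ F j → U = 0) ∧
        twist (l (j + 1) : ℂ) (e (j + 1)) ∈ F j) ∧
      (∀ j, j + 1 < m → ∃ S : PowerSeries ℂ, constantCoeff S ≠ 0 ∧
        twist (l (j + 2) : ℂ) (e (j + 2)) - S • e (j + 1) ∈ F j) ∧
      (0 < m → ∃ V : PowerSeries ℂ, constantCoeff V ≠ 0 ∧ g = V • e m) := by
    intro m
    induction m with
    | zero => intro _ g _; exact ⟨fun _ => 0, by simp, by simp, by simp⟩
    | succ m ih =>
      intro hm g hg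
      obtain ⟨x, hxQ, hgx, hx, hspan, hfree, hP⟩ := exists_normalized_generator
        (hF.mono m (by omega)) (hF.quot m (by omega)) hg
      obtain ⟨e, he1, he2, he3⟩ := ih (by omega) _ hP
      have hne : ∀ j < m, Function.update e (m + 1) x (j + 1) = e (j + 1) := fun j hj =>
        Function.update_of_ne (by omega) _ _
      have hself : Function.update e (m + 1) x (m + 1) = x := Function.update_self _ _ _
      refine ⟨Function.update e (m + 1) x, fun j hj => ?_, fun j hj => ?_, fun _ => ?_⟩
      · rcases Nat.lt_succ_iff_lt_or_eq.mp hj with hjm | rfl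
        · rw [hne j hjm]
          exact he1 j hjm
        · rw [hself]
          exact ⟨hxQ, hspan, hfree, hx⟩
      · rw [hne j (by omega)]
        rcases Nat.lt_succ_iff_lt_or_eq.mp hj with hjm | rfl
        · rw [hne (j + 1) hjm]
          exact he2 j hjm
        · rw [hself]
          obtain ⟨V, hV, hVx⟩ := he3 (by omega)
          exact ⟨V, hV, by rw [hVx, sub_self]; exact zero_mem _⟩
      · rw [hself]
        exact hgx
  obtain ⟨e, he1, he2, -⟩ := key k le_rfl g (by rw [hg, hF.top])
  exact ⟨e, hF.zero, hF.top, hF.mono, fun j hj => (he1 j hj).1, fun j hj => (he1 j hj).2.1,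
    fun j hj => (he1 j hj).2.2.1, fun j hj => (he1 j hj).2.2.2, he2⟩

theorem Flag.isPrincipalJH {k : ℕ} {F : ℕ → Submodule Atilde E} {l : ℕ → ℚ} {e : ℕ → E}
    (hF : Flag k F l e) (hp : Principal k l) : IsPrincipalJH k F l where
  zero := hF.zero
  top := hF.top
  mono := hF.le_succ
  normal j hj x := by
    constructor
    · rintro ⟨hx, y, rfl⟩
      exact ⟨y, hF.mem_of_smul_mem hj X_ne_zero hx, rfl⟩
    · rintro ⟨z, hz, rfl⟩
      exact ⟨Submodule.smul_mem _ _ hz, z, rfl⟩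
  quot j hj := by
    refine equiv_quotient_of_span (Submodule.Quotient.mk ⟨e (j + 1), hF.mem j hj⟩)
      (fun y => ?_) fun v => ?_
    · obtain ⟨⟨y, hy⟩, rfl⟩ := Submodule.Quotient.mk_surjective _ y
      obtain ⟨U, hU⟩ := hF.span j hj y hy
      refine ⟨ofSeries U, ?_⟩
      rw [← Submodule.Quotient.mk_smul, Submodule.Quotient.eq]
      exact hU
    · rw [← Submodule.Quotient.mk_smul, Submodule.Quotient.mk_eq_zero]
      change v • e (j + 1) ∈ F j ↔ _
      constructor
      · intro hv
        obtain ⟨U, w, rfl⟩ := exists_division (l (j + 1) : ℂ) v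
        refine ⟨w, ?_⟩
        have h1 := (F j).sub_mem hv ((F j).smul_mem w (hF.eig j hj))
        have h2 : U • e (j + 1) ∈ F j := by
          convert h1 using 1
          rw [add_smul, mul_smul]
          exact (add_sub_cancel_right _ _).symm
        rw [hF.free j hj U h2, map_zero, zero_add]
      · rintro ⟨z, rfl⟩
        rw [mul_smul]
        exact (F j).smul_mem z (hF.eig j hj)
  principal := hp

end JordanHolder

/-! ### Consequences of the absence of logarithms. -/

/-- No logarithms in `P` modulo `Q`: the generalized eigenvectors of order two of `b⁻¹ a` are
eigenvectors. -/
def NoLog (P Q : Submodule Atilde E) : Prop :=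
  ∀ x ∈ P, ∀ μ : ℂ, twist (μ + 1) (twist μ x) ∈ Q → twist μ x ∈ Q

theorem NoLog.mono {P P' Q : Submodule Atilde E} (h : NoLog P Q) (hP : P' ≤ P) : NoLog P' Q :=
  fun x hx => h x (hP hx)

/-- The elements `∑ U_i b^(i-s) e_i` modulo `F s`, with `s < i ≤ s + t`. -/
def InStair (F : ℕ → Submodule Atilde E) (e : ℕ → E) (s : ℕ) : ℕ → E → Prop
  | 0, y => y ∈ F s
  | t + 1, y => ∃ (U : PowerSeries ℂ) (z : E), InStair F e s t z ∧
      y = (X ^ (t + 1) * U : PowerSeries ℂ) • e (s + t + 1) + z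

theorem InStair.add {F : ℕ → Submodule Atilde E} {e : ℕ → E} {s : ℕ} {t : ℕ} {x y : E}
    (hx : InStair F e s t x) (hy : InStair F e s t y) : InStair F e s t (x + y) := by
  induction t generalizing x y with
  | zero => exact (F s).add_mem hx hy
  | succ t ih =>
    obtain ⟨U, z, hz, rfl⟩ := hx
    obtain ⟨V, w, hw, rfl⟩ := hy
    exact ⟨U + V, z + w, ih hz hw, by module⟩

theorem InStair.smul {F : ℕ → Submodule Atilde E} {e : ℕ → E} {s : ℕ} {t : ℕ}
    (W : PowerSeries ℂ) {x : E} (hx : InStair F e s t x) : InStair F e s t (W • x) := by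
  induction t generalizing x with
  | zero => exact series_smul_mem _ W hx
  | succ t ih =>
    obtain ⟨U, z, hz, rfl⟩ := hx
    exact ⟨W * U, W • z, ih hz, by module⟩

namespace Flag

variable {k : ℕ} {F : ℕ → Submodule Atilde E} {l : ℕ → ℚ} {e : ℕ → E}

/-- Modulo `F j` the obstruction is a multiple `U ε`. Solving two Euler equations removes it up to a
resonant monomial, which one further factor kills. The hypothesis is then applied twice, to lower
the order of a generalized eigenvector from three to one. -/
theorem noLog_succ (hF : Flag k F l e) {j m : ℕ} (hj : j < m) (hm : m ≤ k)
    (h : NoLog (F m) (F j)) : NoLog (F m) (F (j + 1)) := by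
  intro x hx μ hxx
  obtain ⟨U, hU⟩ := hF.span j (by omega) _ hxx
  obtain ⟨W₁, K₁, hW₁, hK₁⟩ := exists_euler (l (j + 1) - (μ + 2)) U
  obtain ⟨W₂, K₂, hW₂, hK₂⟩ := exists_euler (l (j + 1) - (μ + 2)) W₁
  set ε := e (j + 1) with hε
  have hεm : ε ∈ F (j + 1) := hF.mem j (by omega)
  have hεm' : ε ∈ F m := hF.mono (by omega) hm hεm
  -- Two operators applied to `W₂ ε` produce a factor `b^2`, which the multiplication of `x` by
  -- `b^2` matches.
  let y := (X ^ 2 : PowerSeries ℂ) • x - W₂ • ε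
  have hy : y ∈ F m := (F m).sub_mem (series_smul_mem _ _ hx) (series_smul_mem _ _ hεm')
  have hx2 : twist (μ + 2) ((X ^ 2 : PowerSeries ℂ) • x)
      = (X ^ 2 : PowerSeries ℂ) • twist μ x := by
    simpa using twist_X_pow_smul μ 2 x
  have hx3 : twist (μ + 3) (twist (μ + 2) ((X ^ 2 : PowerSeries ℂ) • x))
      = (X ^ 2 : PowerSeries ℂ) • twist (μ + 1) (twist μ x) := by
    rw [hx2]
    have := twist_X_pow_smul (μ + 1) 2 (twist μ x)
    rw [← this]
    congr 1
    push_cast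
    ring
  have hWε : twist (μ + 3) (twist (μ + 2) (W₂ • ε))
      - (X ^ 2 * euler (l (j + 1) - (μ + 2)) (euler (l (j + 1) - (μ + 2)) W₂)) • ε ∈ F j := by
    have h1 : W₂ • ε - W₂ • e (j + 1) ∈ F j := by rw [sub_self]; exact zero_mem _
    have h2 := hF.twist_coeff (by omega) (μ + 2) h1
    have h3 := hF.twist_coeff (by omega) (μ + 3) h2
    rw [euler_X_mul] at h3
    have h4 : (l (j + 1) : ℂ) - (μ + 3) + 1 = l (j + 1) - (μ + 2) := by ring
    rwa [h4, ← mul_assoc, ← pow_two] at h3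
  have hyy : twist (μ + 3) (twist (μ + 2) y) - (X ^ 2 * K₁) • ε ∈ F j := by
    have h1 := (F j).sub_mem (series_smul_mem _ (X ^ 2) hU) hWε
    have h2 : U = euler (l (j + 1) - (μ + 2)) (euler (l (j + 1) - (μ + 2)) W₂) + K₁ := by
      have h3 : euler (l (j + 1) - (μ + 2)) W₁
          = euler (l (j + 1) - (μ + 2)) (euler (l (j + 1) - (μ + 2)) W₂) := by
        conv_lhs => rw [hW₂]
        rw [euler, map_add, mul_add, mul_add, add_add_add_comm]
        change euler _ _ + euler _ _ = _
        rw [hK₂, add_zero]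
      rw [← h3]
      exact hW₁
    rw [h2] at h1
    simp only [y, twist_sub, hx3]
    convert h1 using 1
    module
  have hy3 : twist (μ + 3 + 1) (twist (μ + 3) (twist (μ + 2) y)) ∈ F j := by
    have h1 := hF.twist_coeff (by omega) (μ + 3 + 1) hyy
    have h2 : euler (l (j + 1) - (μ + 3 + 1)) (X ^ 2 * K₁) = 0 := by
      rw [euler_X_pow_mul]
      have : (l (j + 1) : ℂ) - (μ + 3 + 1) + (2 : ℕ) = l (j + 1) - (μ + 2) := by
        push_cast; ring
      rw [this, hK₁, mul_zero]
    rw [h2] at h1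
    simpa using h1
  have hy2 := h _ (twist_mem _ _ hy) _ hy3
  have h23 : μ + 3 = μ + 2 + 1 := by ring
  rw [h23] at hy2
  have hy1 := hF.le_succ j (by omega) (h _ hy _ hy2)
  have hfin := (F (j + 1)).add_mem hy1 (twist_mem _ (μ + 2) (series_smul_mem _ W₂ hεm))
  rw [← twist_add, sub_add_cancel, hx2, hF.X_pow_smul_mem_iff (by omega)] at hfin
  exact hfin

theorem noLog_of_le (hF : Flag k F l e) {i j m : ℕ} (hij : i ≤ j) (hj : j ≤ m) (hm : m ≤ k)
    (h : NoLog (F m) (F i)) : NoLog (F m) (F j) := by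
  induction j, hij using Nat.le_induction with
  | base => exact h
  | succ j hij ih => exact hF.noLog_succ (by omega) hm (ih (by omega))

theorem inStair_of_mem (hF : Flag k F l e) {s t : ℕ} (hst : s + t ≤ k) {x : E}
    (hx : x ∈ F (s + t)) : InStair F e s t ((X ^ t : PowerSeries ℂ) • x) := by
  induction t generalizing x with
  | zero => simpa [InStair] using hx
  | succ t ih =>
    obtain ⟨U, hU⟩ := hF.span (s + t) (by omega) x hx
    exact ⟨U, _, (ih (by omega) hU).smul X, by module⟩

/-- Triangular solving from the top level down. The term `b^(t+1) U e` is cancelled by `-b^t A e` up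
to a resonant monomial. The factor `b^t` keeps the lower terms created by this correction in the
stair. -/
theorem exists_add_twist_mem (hF : Flag k F l e) {P : Submodule Atilde E} {s t : ℕ}
    (hst : s + t ≤ k) (hP : F (s + t) ≤ P)
    (hN : ∀ i, s ≤ i → i < s + t → NoLog P (F i)) {ν : ℂ} {x : E} (hx : x ∈ P)
    (hxt : InStair F e s t (twist ν x)) : ∃ w ∈ F (s + t), twist ν (x + w) ∈ F s := by
  induction t generalizing x with
  | zero => exact ⟨0, zero_mem _, by rw [add_zero]; exact hxt⟩
  | succ t ih =>
    obtain ⟨U, z, hz, hUz⟩ := hxt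
    obtain ⟨A, K, hA, hK⟩ := exists_euler (l (s + t + 1) - ν + t) U
    have hle : F (s + t) ≤ F (s + t + 1) := hF.le_succ _ (by omega)
    have hεm : e (s + t + 1) ∈ F (s + t + 1) := hF.mem _ (by omega)
    have heig := hF.eig (s + t) (by omega)
    have hfree := hF.free (s + t) (by omega)
    have hco := fun ν U x => hF.twist_coeff (j := s + t) (by omega) ν (U := U) (x := x)
    have hst' : ∀ {x}, x ∈ F (s + t) → InStair F e s t ((X ^ t : PowerSeries ℂ) • x) :=
      fun hx => hF.inStair_of_mem (by omega) hx
    have hzm : ∀ t, s + t ≤ k → ∀ z, InStair F e s t z → z ∈ F (s + t) := by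
      intro t
      induction t with
      | zero => exact fun _ _ h => h
      | succ t ih =>
        rintro hk _ ⟨U, z, hz, rfl⟩
        exact (F (s + (t + 1))).add_mem (series_smul_mem _ _ (hF.mem (s + t) hk))
          (hF.le_succ (s + t) hk (ih (Nat.le_of_succ_le hk) z hz))
    set ε := e (s + t + 1) with hε
    have hx' : twist ν (x + -(X ^ t * A) • ε)
        = (z + -A • (X ^ t : PowerSeries ℂ) • twist (l (s + t + 1)) ε)
          + (X ^ (t + 1) * K) • ε := by
      rw [twist_add, twist_smul ν (l (s + t + 1)), hUz]
      have h1 : euler (l (s + t + 1) - ν) (-(X ^ t * A))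
          = -(X ^ t * euler (l (s + t + 1) - ν + t) A) := by
        rw [← mul_neg, euler_X_pow_mul, ← mul_neg]
        congr 1
        rw [euler, euler, map_neg]
        ring
      rw [h1, pow_succ]
      conv_lhs => rw [hA]
      module
    have hxP : x + -(X ^ t * A) • ε ∈ P := P.add_mem hx (series_smul_mem _ _ (hP hεm))
    have hstair : InStair F e s t
        (z + -A • (X ^ t : PowerSeries ℂ) • twist (l (s + t + 1)) ε) :=
      hz.add ((hst' heig).smul _)
    have hmem := hzm t (by omega) _ hstair
    -- The resonant term is itself an eigenvector for `ν + 1` modulo `F (s + t)`. If it were nonzero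
    -- it would be a logarithm, which `hN` excludes.
    have hK0 : (X ^ (t + 1) * K) • ε ∈ F (s + t) := by
      have h1 : twist ν (x + -(X ^ t * A) • ε) - (X ^ (t + 1) * K) • ε ∈ F (s + t) := by
        rwa [hx', add_sub_cancel_right]
      have h2 := hco (ν + 1) _ _ h1
      have h3 : euler (l (s + t + 1) - (ν + 1)) (X ^ (t + 1) * K) = 0 := by
        rw [euler_X_pow_mul]
        have : (l (s + t + 1) : ℂ) - (ν + 1) + (t + 1 : ℕ) = l (s + t + 1) - ν + t := by
          push_cast; ring
        rw [this, hK, mul_zero]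
      rw [h3, mul_zero, zero_smul, sub_zero] at h2
      have h4 := hN (s + t) (by omega) (by omega) _ hxP ν h2
      have := (F (s + t)).sub_mem h4 h1
      rwa [sub_sub_cancel] at this
    rw [hfree _ hK0, zero_smul, add_zero] at hx'
    obtain ⟨w, hw, hw2⟩ := ih (by omega) (hle.trans hP)
      (fun i hi hi' => hN i hi (by omega)) hxP (hx' ▸ hstair)
    refine ⟨-(X ^ t * A) • ε + w, (F (s + t + 1)).add_mem (series_smul_mem _ _ hεm) (hle hw), ?_⟩
    rwa [← add_assoc]

/-- For `n ≥ j - s` the image of `b^n e (j + 1)` under `a - (l (j + 1) + n) b` is `b^n` times an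
element of `F j`. It lies in the stair, so a correction in `F j` gives an eigenvector modulo `F s`.
-/
theorem exists_twist_mem (hF : Flag k F l e) {s j n : ℕ} (hsj : s ≤ j) (hjk : j < k)
    (hn : j ≤ s + n) (hN : NoLog (F (j + 1)) (F s)) :
    ∃ x ∈ F (j + 1), x - (X ^ n : PowerSeries ℂ) • e (j + 1) ∈ F j ∧
      twist (l (j + 1) + n) x ∈ F s := by
  obtain ⟨t, rfl⟩ := Nat.exists_eq_add_of_le hsj
  obtain ⟨r, rfl⟩ := Nat.exists_eq_add_of_le (by omega : t ≤ n)
  have hmem := hF.mem (s + t) hjk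
  obtain ⟨w, hw, hw2⟩ := hF.exists_add_twist_mem (P := F (s + t + 1)) (by omega)
    (hF.le_succ _ hjk) (fun i hi hi' => hF.noLog_of_le hi (by omega) hjk hN)
    (ν := l (s + t + 1) + (t + r : ℕ))
    (x := (X ^ (t + r) : PowerSeries ℂ) • e (s + t + 1)) (series_smul_mem _ _ hmem)
    (by
      rw [twist_X_pow_smul, pow_add, mul_comm, mul_smul]
      exact (hF.inStair_of_mem (by omega) (hF.eig _ hjk)).smul _)
  refine ⟨_, (F (s + t + 1)).add_mem (series_smul_mem _ _ hmem) (hF.le_succ _ hjk hw), ?_, hw2⟩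
  rwa [add_sub_cancel_left]

/-- The eigenvectors modulo `F 1` in `F m` come from eigenvectors. -/
theorem exists_eigenvector (hF : Flag k F l e) {m : ℕ} (hm : m ≤ k) (hN : NoLog (F m) (F 0))
    {μ : ℚ} (hμ : ∀ j, 1 ≤ j → j < m → l (j + 1) + j ≤ μ) (i : ℕ) {y : E} (hy : y ∈ F m)
    (hyt : twist ((μ : ℂ) + i) y ∈ F 1) :
    ∃ x ∈ F m, twist (μ : ℂ) x = 0 ∧ y - (X ^ i : PowerSeries ℂ) • x ∈ F 1 := by
  have key : ∀ j, j + 1 ≤ m → ∀ y ∈ F (j + 1), twist ((μ : ℂ) + i) y ∈ F 1 →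
      ∃ x ∈ F m, twist (μ : ℂ) x = 0 ∧ y - (X ^ i : PowerSeries ℂ) • x ∈ F 1 := by
    intro j
    induction j with
    | zero => exact fun _ y hy _ => ⟨0, zero_mem _, twist_zero _, by simpa using hy⟩
    | succ j ih =>
      intro hj y hy hyt
      obtain ⟨U, hU⟩ := hF.span (j + 1) (by omega) y hy
      rcases eq_or_ne U 0 with rfl | hU0
      · exact ih (by omega) y (by simpa using hU) hyt
      obtain ⟨n, c, -, rfl, hn⟩ := hF.coeff_of_twist_mem (by omega) hU
        (hF.mono (by omega) (by omega) hyt) hU0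
      have hnq : μ + i = l (j + 1 + 1) + n := by exact_mod_cast hn
      have h1 := hμ (j + 1) (by omega) (by omega)
      -- The lower bound on `μ` leaves at least `j + 1` factors `b` after removing `b^i`. That is
      -- what `exists_twist_mem` needs, with `s = 0`, to produce a genuine eigenvector with the same
      -- leading term.
      have h2 : i + (j + 1) ≤ n := by
        have : ((i + (j + 1) : ℕ) : ℚ) ≤ n := by push_cast at h1 ⊢; linarith
        exact_mod_cast this
      obtain ⟨r, rfl⟩ := Nat.exists_eq_add_of_le (by omega : i ≤ n)
      obtain ⟨x, hx, hx1, hx2⟩ := hF.exists_twist_mem (s := 0) (j := j + 1) (n := r)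
        (by omega) (by omega) (by omega) (hN.mono (hF.mono hj hm))
      have hrμ : (l (j + 1 + 1) : ℂ) + r = μ := by
        have : l (j + 1 + 1) + r = μ := by push_cast at hnq; linarith
        exact_mod_cast this
      rw [hrμ, hF.zero, Submodule.mem_bot] at hx2
      have hxm : x ∈ F m := hF.mono hj hm hx
      have hcx : ∀ c : ℂ, twist (μ : ℂ) ((C c : PowerSeries ℂ) • x) = 0 := by
        intro c
        rw [twist_smul μ μ, hx2, euler_C]
        simp
      obtain ⟨x', hx'm, hx't, hx'1⟩ := ih (by omega)
        (y - (X ^ i : PowerSeries ℂ) • (C c : PowerSeries ℂ) • x)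
        (by
          have := (F (j + 1)).sub_mem hU (series_smul_mem _ (X ^ i * C c) hx1)
          convert this using 1
          rw [pow_add]
          module)
        (by rwa [twist_sub, twist_X_pow_smul, hcx, smul_zero, sub_zero])
      refine ⟨(C c : PowerSeries ℂ) • x + x', (F m).add_mem (series_smul_mem _ _ hxm) hx'm,
        by rw [twist_add, hcx, hx't, add_zero], ?_⟩
      convert hx'1 using 1
      module
  rcases m with _ | m
  · exact ⟨0, zero_mem _, twist_zero _, by
      rw [hF.zero, Submodule.mem_bot] at hy
      simp [hy]⟩
  · exact key m le_rfl y hy hyt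

/-- Two consecutive quotients of a flag without logarithms. -/
theorem exists_lift (hF : Flag k F l e) {j : ℕ} (hj : j + 1 < k)
    (hN : NoLog (F (j + 2)) (F j)) :
    l (j + 1) ≠ l (j + 2) + 1 ∧ ∃ x ∈ F (j + 2), x - e (j + 2) ∈ F (j + 1) ∧
      twist (l (j + 1) : ℂ) (twist (l (j + 2) : ℂ) x) ∈ F j := by
  obtain ⟨S, hS0, hS⟩ := hF.unit j hj
  have hm2 : e (j + 2) ∈ F (j + 2) := hF.mem (j + 1) hj
  have hm1 : e (j + 1) ∈ F (j + 1) := hF.mem j (by omega)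
  have hm12 := hF.le_succ (j + 1) hj hm1
  obtain ⟨S₁, hS₁⟩ := series_eq_const_add S
  set s := constantCoeff S with hs
  -- Subtracting `A e (j + 1)` reduces the unit `S` to its constant term `s` plus a resonant term `b
  -- K`.
  obtain ⟨A, K, hA, hK⟩ := exists_euler (l (j + 1) - l (j + 2)) S₁
  have hx : twist (l (j + 2) : ℂ) (e (j + 2) + -A • e (j + 1)) - (C s + X * K) • e (j + 1)
      ∈ F j := by
    have h1 : e (j + 2) + -A • e (j + 1) - (1 : PowerSeries ℂ) • e (j + 2)
        - (-A) • e (j + 1) ∈ F j := by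
      convert zero_mem (F j) using 1
      module
    have h2 := hF.twist_coeff_two hj (l (j + 2)) hS h1
    have h3 : euler ((l (j + 2) : ℂ) - l (j + 2)) 1 = 0 := by simp [euler]
    have h4 : euler ((l (j + 1) : ℂ) - l (j + 2)) (-A) = -euler (l (j + 1) - l (j + 2)) A := by
      rw [euler, euler, map_neg]; ring
    rw [h3, h4] at h2
    convert h2 using 1
    rw [hS₁, hA]
    module
  have hxm : e (j + 2) + -A • e (j + 1) ∈ F (j + 2) :=
    (F (j + 2)).add_mem hm2 (series_smul_mem _ _ hm12)
  have hxe : e (j + 2) + -A • e (j + 1) - e (j + 2) ∈ F (j + 1) := by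
    rw [add_sub_cancel_left]
    exact series_smul_mem _ _ hm1
  set x := e (j + 2) + -A • e (j + 1)
  -- In case of equality there is no resonant monomial, so `K = 0`. Then `(a - l (j + 2) b) x ≡ s e
  -- (j + 1)` with `s ≠ 0` makes `x` a generalized eigenvector that is not an eigenvector.
  have hne : l (j + 1) ≠ l (j + 2) + 1 := by
    intro heq
    have hl : (l (j + 1) : ℂ) = l (j + 2) + 1 := by exact_mod_cast heq
    have hK0 : K = 0 := by
      by_contra hK0
      obtain ⟨n, c, -, -, hn⟩ := eq_X_pow_of_euler_eq_zero hK hK0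
      rw [hl] at hn
      have h1 : ((n + 1 : ℕ) : ℂ) = 0 := by push_cast; linear_combination hn
      exact absurd h1 (by norm_cast)
    rw [hK0, mul_zero, add_zero] at hx
    have h1 := hF.twist_coeff (by omega) (l (j + 2) + 1) hx
    rw [euler_C, hl, sub_self, zero_mul, map_zero, mul_zero, zero_smul, sub_zero] at h1
    have h2 := (F j).sub_mem (hN x hxm _ h1) hx
    rw [sub_sub_cancel] at h2
    have := congrArg constantCoeff (hF.free j (by omega) _ h2)
    simp only [constantCoeff_C, map_zero] at this
    exact hS0 this
  refine ⟨hne, x, hxm, hxe, ?_⟩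
  have hq : (l (j + 2) : ℂ) - l (j + 1) + 1 ≠ 0 := by
    intro h
    apply hne
    have : (l (j + 1) : ℂ) = ((l (j + 2) + 1 : ℚ) : ℂ) := by
      push_cast; linear_combination -h
    exact_mod_cast this
  -- With this constant, `w e (j + 1)` cancels the contribution of `s` to the image of `b x`. Only
  -- `b^2 K` is left; it would be a logarithm, so it vanishes.
  set w := s / ((l (j + 2) : ℂ) - l (j + 1) + 1) with hw
  have hy : twist (l (j + 2) + 1 : ℂ) ((X : PowerSeries ℂ) • x + (C w : PowerSeries ℂ) • e (j + 1))
      - (X * (X * K)) • e (j + 1) ∈ F j := by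
    rw [twist_add, twist_X_smul]
    have h1 : (C w : PowerSeries ℂ) • e (j + 1) - (C w : PowerSeries ℂ) • e (j + 1) ∈ F j := by
      rw [sub_self]; exact zero_mem _
    have h2 := hF.twist_coeff (by omega) (l (j + 2) + 1) h1
    have h3 : (l (j + 1) - (l (j + 2) + 1)) * w = -s := by
      rw [hw]; field_simp; ring
    rw [euler_C, h3] at h2
    have := (F j).add_mem (series_smul_mem _ X hx) h2
    convert this using 1
    rw [map_neg]
    module
  have hyy := hF.twist_coeff (by omega) (l (j + 2) + 1 + 1) hy
  have h5 : euler (l (j + 1) - (l (j + 2) + 1 + 1)) (X * (X * K)) = 0 := by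
    rw [euler_X_mul, euler_X_mul]
    have : (l (j + 1) : ℂ) - (l (j + 2) + 1 + 1) + 1 + 1 = l (j + 1) - l (j + 2) := by ring
    rw [this, hK]
    simp
  rw [h5, mul_zero, zero_smul, sub_zero] at hyy
  have h6 := (F j).sub_mem (hN _ ((F (j + 2)).add_mem (series_smul_mem _ X hxm)
    (series_smul_mem _ _ hm12)) _ hyy) hy
  rw [sub_sub_cancel] at h6
  have h7 := hF.free j (by omega) _ h6
  have hK0 : K = 0 := by
    have := (mul_eq_zero.mp h7).resolve_left X_ne_zero
    exact (mul_eq_zero.mp this).resolve_left X_ne_zero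
  rw [hK0, mul_zero, add_zero] at hx
  have h8 := hF.twist_coeff (by omega) (l (j + 1)) hx
  rw [euler_C, sub_self, zero_mul, map_zero, mul_zero, zero_smul, sub_zero] at h8
  exact h8

end Flag

end

/-! ### Good flags and the parameter of the equation relating `h` and `e 1`. -/

section

/-- A flag of a `[lam]`-primitive fresco `E` of rank `k` with `F (k-1)` and `E / F 1`
semi-simple. -/
structure GoodFlag {E : Type u} [AddCommGroup E] [Module Atilde E] (k : ℕ)
    (F : ℕ → Submodule Atilde E) (l : ℕ → ℚ) (e : ℕ → E) : Prop extends Flag k F l e where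
  principal : Principal k l
  integral : ∀ i < k, ∀ j < k, ∃ n : ℤ, l (i + 1) - l (j + 1) = n
  noLog_top : NoLog (F k) (F 1)
  noLog_bot : NoLog (F (k - 1)) (F 0)

/-- `α` is the parameter of a rank two submodule with basis `h`, `e 1`. -/
def HasParam {E : Type u} [AddCommGroup E] [Module Atilde E] (m p : ℕ)
    (F : ℕ → Submodule Atilde E) (l : ℕ → ℚ) (e : ℕ → E) (α : ℂ) : Prop :=
  ∃ c : ℂ, c ≠ 0 ∧ ∃ h : E, h ∉ F (m + 1) ∧
    twist ((l (m + 2) : ℂ) + m) h = ((1 + C α * X ^ p) * C c : PowerSeries ℂ) • e 1 ∧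
    (p = 0 → α = 1)

variable {E : Type u} [AddCommGroup E] [Module Atilde E]

theorem span_singleton_eq_of_unit {k : ℕ} {F : ℕ → Submodule Atilde E} {l : ℕ → ℚ} {e : ℕ → E}
    (hF : Flag k F l e) {j : ℕ} (hj : j < k) {D : PowerSeries ℂ} (hD : constantCoeff D ≠ 0) {x : E}
    (hx : x - D • e (j + 1) ∈ F j) : Submodule.span Atilde {x} = F (j + 1) := by
  refine le_antisymm ?_ (hF.le_span hj hD hx)
  rw [Submodule.span_singleton_le_iff_mem]
  have := (F (j + 1)).add_mem (hF.le_succ j hj hx) (series_smul_mem _ D (hF.mem j hj))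
  rwa [sub_add_cancel] at this

namespace Flag

variable {k : ℕ} {F : ℕ → Submodule Atilde E} {l : ℕ → ℚ} {e : ℕ → E}

theorem mem_one_iff (hF : Flag k F l e) (hk : 0 < k) {x : E} :
    x ∈ F 1 ↔ ∃ U : PowerSeries ℂ, x = U • e 1 := by
  constructor
  · intro hx
    obtain ⟨U, hU⟩ := hF.span 0 hk x hx
    rw [hF.zero, Submodule.mem_bot, sub_eq_zero] at hU
    exact ⟨U, hU⟩
  · rintro ⟨U, rfl⟩
    exact series_smul_mem _ _ (hF.mem 0 hk)

theorem smul_one_eq_zero (hF : Flag k F l e) (hk : 0 < k) {U : PowerSeries ℂ}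
    (h : U • e 1 = 0) : U = 0 :=
  hF.free 0 hk U (by rw [h]; exact zero_mem _)

theorem twist_one (hF : Flag k F l e) (hk : 0 < k) : twist (l 1 : ℂ) (e 1) = 0 := by
  have := hF.eig 0 hk
  rwa [hF.zero, Submodule.mem_bot] at this

theorem twist_smul_one (hF : Flag k F l e) (hk : 0 < k) (ν : ℂ) (U : PowerSeries ℂ) :
    twist ν (U • e 1) = (X * euler (l 1 - ν) U) • e 1 := by
  rw [twist_smul ν (l 1), hF.twist_one hk, smul_zero, zero_add]

/-- It gives the normality of `Ã h`. If `x ∈ b E + F 1`, then `(a - ν b) x ∈ b E`, and `V e 1 ∈ b E`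
forces `b ∣ V` because `E / F 1` is torsion-free. -/
theorem notMem_of_twist (hF : Flag k F l e) (hk : 0 < k) {ν : ℂ} {V : PowerSeries ℂ}
    (hV : constantCoeff V ≠ 0) {x : E} (hx : twist ν x = V • e 1) (z : E) :
    x - (X : PowerSeries ℂ) • z ∉ F 1 := by
  intro h
  obtain ⟨W, hW⟩ := (hF.mem_one_iff hk).mp h
  have h1 := twist_X_smul (ν - 1) z
  rw [sub_add_cancel] at h1
  have h2 : (X : PowerSeries ℂ) • (twist (ν - 1) z + euler (l 1 - ν) W • e 1) = V • e 1 := by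
    rw [← hx, ← sub_add_cancel x ((X : PowerSeries ℂ) • z), hW, twist_add,
      hF.twist_smul_one hk, h1]
    module
  have h3 : twist (ν - 1) z + euler (l 1 - ν) W • e 1 ∈ F 1 := by
    refine hF.mem_of_smul_mem (by omega) X_ne_zero ?_
    rw [h2]
    exact series_smul_mem _ _ (hF.mem 0 hk)
  obtain ⟨Q, hQ⟩ := (hF.mem_one_iff hk).mp h3
  rw [hQ] at h2
  have h4 := hF.smul_one_eq_zero hk (U := X * Q - V) (by rw [sub_smul, mul_smul, h2, sub_self])
  have := congrArg constantCoeff h4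
  simp at this
  exact hV this

theorem eq_of_twist_zero (hF : Flag k F l e) {j : ℕ} (hj : j < k) {ν : ℚ} {U : PowerSeries ℂ}
    {x : E} (hU : x - U • e (j + 1) ∈ F j) (hx : twist (ν : ℂ) x ∈ F j) (hxj : x ∉ F j) :
    ∃ (n : ℕ) (c : ℂ), c ≠ 0 ∧ U = C c * X ^ n ∧ ν = l (j + 1) + n := by
  obtain ⟨n, c, hc, h1, h2⟩ := hF.coeff_of_twist_mem hj hU hx (by
    rintro rfl
    exact hxj (by simpa using hU))
  exact ⟨n, c, hc, h1, by exact_mod_cast h2⟩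

end Flag

namespace GoodFlag

theorem noLog_top_of_le {k : ℕ} {F : ℕ → Submodule Atilde E} {l : ℕ → ℚ} {e : ℕ → E}
    (hF : GoodFlag k F l e) {i : ℕ} (hi : 1 ≤ i) (hik : i ≤ k) : NoLog (F k) (F i) :=
  hF.noLog_of_le hi hik le_rfl hF.noLog_top

variable {m : ℕ} {F : ℕ → Submodule Atilde E} {l : ℕ → ℚ} {e : ℕ → E}

/-- Monotonicity of `l j + j` gives a difference at least `-1`. It is an integer, and the value `-1`
is excluded by `exists_lift`. -/
theorem last_le (hF : GoodFlag (m + 2) F l e) (hm : 1 ≤ m) : l (m + 1) ≤ l (m + 2) := by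
  have h1 := (hF.exists_lift (j := m) (by omega) (hF.noLog_top_of_le hm (by omega))).1
  have h2 := hF.principal (m + 1) (m + 2) (by omega) (by omega) (by omega)
  obtain ⟨n, hn⟩ := hF.integral (m + 1) (by omega) m (by omega)
  push_cast at h2
  have h3 : (-1 : ℚ) ≤ n := by rw [← hn]; change _ ≤ l (m + 2) - l (m + 1); linarith
  have h4 : n ≠ -1 := by
    rintro rfl
    apply h1
    push_cast at hn
    change l (m + 2) - l (m + 1) = -1 at hn
    linarith
  have h5 : -1 ≤ n := by exact_mod_cast h3
  have h6 : (0 : ℚ) ≤ n := by exact_mod_cast (by omega : 0 ≤ n)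
  rw [← hn] at h6
  change 0 ≤ l (m + 2) - l (m + 1) at h6
  linarith

theorem level_le (hF : GoodFlag (m + 2) F l e) (j : ℕ) (hj : 1 ≤ j) (hjm : j < m + 1) :
    l (j + 1) + j ≤ l (m + 2) + m := by
  have h1 := hF.last_le (by omega)
  have h2 := hF.principal (j + 1) (m + 1) (by omega) (by omega) (by omega)
  push_cast at h2
  linarith

theorem exists_eigen (hF : GoodFlag (m + 2) F l e) (i : ℕ) {y : E} (hy : y ∈ F (m + 1))
    (hyt : twist ((l (m + 2) : ℂ) + m + i) y ∈ F 1) :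
    ∃ x ∈ F (m + 1), twist ((l (m + 2) : ℂ) + m) x = 0 ∧
      y - (X ^ i : PowerSeries ℂ) • x ∈ F 1 := by
  have := hF.exists_eigenvector (m := m + 1) (by omega) hF.noLog_bot (μ := l (m + 2) + m)
    hF.level_le i hy (by push_cast; exact hyt)
  push_cast at this
  exact this

/-- The resonance behind the invariance of `α`: with `ν = l 1 + p - 1`, the image of `V e 1` under
`a - ν b` has no term in `b^p`. -/
theorem coeff_euler_critical (p n : ℕ) (hn : n + 1 = p) (V : PowerSeries ℂ) :
    coeff n (euler (1 - p : ℂ) V) = 0 := by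
  rw [coeff_euler, ← hn]
  push_cast
  ring

/-- The combination of `h` and `h'` without leading term is an eigenvector modulo `F 1` in `F (m +
1)`. By `exists_eigen` it is a genuine eigenvector plus some `V e 1`. So the two right-hand sides,
suitably scaled, differ by the image of `V e 1`, which has neither a constant term nor a term in
`b^p`. These two coefficients give first the ratio of the constants, then `α = β`. -/
theorem param_unique (hF : GoodFlag (m + 2) F l e) {p : ℕ}
    (hp : l (m + 2) + m = l 1 + p - 1) {α β : ℂ} (hα : HasParam m p F l e α)
    (hβ : HasParam m p F l e β) : α = β := by
  obtain ⟨c, hc, h, hh, htw, hα1⟩ := hα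
  obtain ⟨c', hc', h', hh', htw', hβ1⟩ := hβ
  rcases Nat.eq_zero_or_pos p with hp0 | hp0
  · rw [hα1 hp0, hβ1 hp0]
  have h1m : e 1 ∈ F (m + 1) := hF.mono (by omega) (by omega) (hF.mem 0 (by omega))
  have hμ : ((l (m + 2) + m : ℚ) : ℂ) = (l (m + 2) : ℂ) + m := by push_cast; rfl
  obtain ⟨U, hU⟩ := hF.span (m + 1) (by omega) h (hF.mem_top h)
  obtain ⟨U', hU'⟩ := hF.span (m + 1) (by omega) h' (hF.mem_top h')
  obtain ⟨n, d, hd, rfl, hn⟩ := hF.eq_of_twist_zero (by omega) (ν := l (m + 2) + m) hU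
    (by rw [hμ, htw]; exact series_smul_mem _ _ h1m) hh
  obtain ⟨n', d', hd', rfl, hn'⟩ := hF.eq_of_twist_zero (by omega) (ν := l (m + 2) + m) hU'
    (by rw [hμ, htw']; exact series_smul_mem _ _ h1m) hh'
  have hnn : n = n' := by
    have : (n : ℚ) = n' := by linarith
    exact_mod_cast this
  subst hnn
  have hy : (C d' : PowerSeries ℂ) • h - (C d : PowerSeries ℂ) • h' ∈ F (m + 1) := by
    have := (F (m + 1)).sub_mem (series_smul_mem _ (C d') hU) (series_smul_mem _ (C d) hU')
    convert this using 1
    module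
  have hcs : ∀ (c : ℂ) (x : E), twist ((l (m + 2) : ℂ) + m) ((C c : PowerSeries ℂ) • x)
      = (C c : PowerSeries ℂ) • twist ((l (m + 2) : ℂ) + m) x := by
    intro c x
    rw [twist_smul _ ((l (m + 2) : ℂ) + m), euler_C]
    simp
  have hyt : twist ((l (m + 2) : ℂ) + m) ((C d' : PowerSeries ℂ) • h - (C d : PowerSeries ℂ) • h')
      = (C d' * ((1 + C α * X ^ p) * C c) - C d * ((1 + C β * X ^ p) * C c')) • e 1 := by
    rw [twist_sub, hcs, hcs, htw, htw']
    module
  obtain ⟨x, -, hx, hyx⟩ := hF.exists_eigen 0 hy (by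
    rw [Nat.cast_zero, add_zero, hyt]
    exact series_smul_mem _ _ (hF.mem 0 (by omega)))
  rw [pow_zero, one_smul] at hyx
  obtain ⟨V, hV⟩ := (hF.mem_one_iff (by omega)).mp hyx
  have h1 := congrArg (twist ((l (m + 2) : ℂ) + m)) hV
  rw [twist_sub, hyt, hx, sub_zero, hF.twist_smul_one (by omega)] at h1
  have hl : (l 1 : ℂ) - (l (m + 2) + m) = 1 - p := by
    have : l 1 - (l (m + 2) + m) = 1 - p := by linarith
    exact_mod_cast this
  rw [hl] at h1
  have h2 := hF.smul_one_eq_zero (by omega)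
    (U := C d' * ((1 + C α * X ^ p) * C c) - C d * ((1 + C β * X ^ p) * C c')
      - X * euler (1 - p : ℂ) V) (by rw [sub_smul, h1, sub_self])
  have h3 := congrArg constantCoeff h2
  simp [hp0.ne'] at h3
  have h4 := congrArg (coeff p) h2
  obtain ⟨q, rfl⟩ : ∃ q, p = q + 1 := ⟨p - 1, by omega⟩
  have h5 : ∀ d c α : ℂ, coeff (q + 1) (C d * ((1 + C α * X ^ (q + 1)) * C c)
      : PowerSeries ℂ) = d * c * α := by
    intro d c α
    rw [coeff_C_mul, coeff_mul_C, map_add, coeff_C_mul, coeff_X_pow_self, coeff_one]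
    simp
    ring
  rw [map_sub, map_sub, h5, h5, coeff_succ_X_mul, coeff_euler_critical _ _ rfl] at h4
  simp only [map_zero, sub_zero] at h4
  have h6 : d' * c ≠ 0 := mul_ne_zero hd' hc
  apply mul_left_cancel₀ h6
  linear_combination h4 - β * h3

/-- Start from an eigenvector modulo `F 1` with leading term `b^m e (m + 2)`. Its image is `V e 1`,
and a multiple of `e 1` removes from `V` everything but the constant term and the resonant `b^p`. -/
theorem exists_param (hF : GoodFlag (m + 2) F l e) {p : ℕ}
    (hp : l (m + 2) + m = l 1 + p - 1) : ∃ α, HasParam m p F l e α := by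
  obtain ⟨x, -, hx, htx⟩ := hF.exists_twist_mem (s := 1) (j := m + 1) (n := m) (by omega)
    (by omega) (by omega) (hF.noLog_top)
  obtain ⟨V, hV⟩ := (hF.mem_one_iff (by omega)).mp htx
  -- If `b ∣ V`, then `a x ∈ b E`, hence `x ∈ F 1 + b E`. This yields one more factor `b` than
  -- `exists_of_twist_mem` grants, so `b^(m+1)` would divide the leading coefficient `b^m`.
  have hV0 : constantCoeff V ≠ 0 := by
    intro h0
    obtain ⟨V', rfl⟩ := exists_eq_X_mul h0
    obtain ⟨z, hz⟩ := hF.mem_of_a_smul_mem (j := 0) (by omega) (y := x)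
      (z := V' • e 1 + (C ((l (m + 2) : ℂ) + m) : PowerSeries ℂ) • x) (by
        rw [twist_def] at hV
        convert zero_mem (F 0) using 1
        rw [← sub_eq_zero] at hV
        rw [← hV]
        generalize a • x = y
        change y - (X : PowerSeries ℂ) • (V' • e 1 + (C ((l (m + 2) : ℂ) + m) : PowerSeries ℂ) • x)
          = y - (C ((l (m + 2) : ℂ) + m) * X : PowerSeries ℂ) • x - (X * V') • e 1
        module)
    have h1 := (F 1).sub_mem htx (twist_mem _ ((l (m + 2) : ℂ) + m) hz)
    have h2 := twist_X_smul ((l (m + 2) : ℂ) + m - 1) z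
    rw [sub_add_cancel] at h2
    change twist ((l (m + 2) : ℂ) + m) x - _ ∈ F 1 at h1
    rw [twist_sub, sub_sub_cancel, h2] at h1
    obtain ⟨w, hw⟩ := hF.exists_of_twist_mem (hF.mem_of_smul_mem (by omega) X_ne_zero h1) m
      (by omega)
    rw [add_comm 1 m] at hw
    have h3 := hF.coeff_dvd (j := m + 1) (t := m + 1) (by omega) (U := X ^ m) (x := x) (z := w) hx
      (by
        have h4 := (F (m + 1)).add_mem (hF.mono (by omega : 1 ≤ m + 1) (by omega) hz)
          (series_smul_mem _ X hw)
        convert h4 using 1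
        module)
    have h4 := PowerSeries.X_pow_dvd_iff.mp h3 m (by omega)
    rw [coeff_X_pow_self] at h4
    exact one_ne_zero h4
  obtain ⟨V', hV'⟩ := series_eq_const_add V
  set s := constantCoeff V with hs
  have hl : (l 1 : ℂ) - (l (m + 2) + m) = 1 - p := by
    have : l 1 - (l (m + 2) + m) = 1 - p := by linarith
    exact_mod_cast this
  obtain ⟨A, K, hA, hK⟩ := exists_euler (1 - p : ℂ) V'
  have hxm : x - A • e 1 ∉ F (m + 1) := by
    intro hcon
    have h1 := (F (m + 1)).add_mem hcon (series_smul_mem _ A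
      (hF.mono (by omega : 1 ≤ m + 1) (by omega) (hF.mem 0 (by omega))))
    rw [sub_add_cancel] at h1
    have h2 := (F (m + 1)).sub_mem h1 hx
    rw [sub_sub_cancel] at h2
    exact pow_ne_zero m X_ne_zero (hF.free (m + 1) (by omega) _ h2)
  have htw : twist ((l (m + 2) : ℂ) + m) (x - A • e 1) = (C s + X * K) • e 1 := by
    have h1 : twist ((l (m + 2) : ℂ) + m) x = V • e 1 := hV
    rw [twist_sub, h1, hF.twist_smul_one (by omega), hl, hV', hA]
    module
  rcases Nat.eq_zero_or_pos p with rfl | hp0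
  · have hK0 : K = 0 := by
      by_contra hK0
      obtain ⟨n, c, -, -, hn⟩ := eq_X_pow_of_euler_eq_zero hK hK0
      have h1 : ((n + 1 : ℕ) : ℂ) = 0 := by push_cast; push_cast at hn; linear_combination hn
      exact absurd h1 (by norm_cast)
    -- For `p = 0` and `α = 1` the factor `1 + α b^p` is the constant `2`.
    refine ⟨1, s / 2, by simpa using hV0, _, hxm, ?_, fun _ => rfl⟩
    rw [htw, hK0]
    congr 1
    have : (C s : PowerSeries ℂ) = C (2 * (s / 2)) := by congr 1; ring
    rw [this, map_mul]
    have h2 : (C 2 : PowerSeries ℂ) = 2 := map_ofNat C 2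
    rw [h2, map_one]
    ring
  · have hXK : ∃ γ : ℂ, X * K = C γ * X ^ p := by
      rcases eq_or_ne K 0 with rfl | hK0
      · exact ⟨0, by simp⟩
      · obtain ⟨n, c, -, rfl, hn⟩ := eq_X_pow_of_euler_eq_zero hK hK0
        refine ⟨c, ?_⟩
        have : n + 1 = p := by
          have : ((n + 1 : ℕ) : ℂ) = p := by push_cast; linear_combination hn
          exact_mod_cast this
        rw [← this]
        ring
    obtain ⟨γ, hγ⟩ := hXK
    refine ⟨γ / s, s, hV0, _, hxm, ?_, fun h => absurd h hp0.ne'⟩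
    rw [htw, hγ]
    congr 1
    have : (C γ : PowerSeries ℂ) = C (γ / s * s) := by congr 1; field_simp [hV0]
    rw [this, map_mul]
    ring

theorem exists_generator (hF : GoodFlag (m + 3) F l e) :
    ∃ x : E, Submodule.span Atilde {x} = ⊤ ∧
      twist (l (m + 2) : ℂ) (twist (l (m + 3) : ℂ) x) ∈ F (m + 1) := by
  obtain ⟨-, x, -, hx, hxt⟩ := hF.exists_lift (j := m + 1) (by omega)
    (hF.noLog_top_of_le (i := m + 1) (by omega) (by omega))
  refine ⟨x, ?_, hxt⟩
  have h1 : x - (1 : PowerSeries ℂ) • e (m + 3) ∈ F (m + 2) := by simpa using hx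
  rw [← hF.top]
  exact span_singleton_eq_of_unit hF.toFlag (by omega) (by simp) h1

/-- The submodule generated by `(a - (l_{k-1} - 1) b) x` has a good flag. -/
theorem exists_goodFlag_sub (hF : GoodFlag (m + 3) F l e) {x : E}
    (hx : Submodule.span Atilde {x} = ⊤)
    (hxt : twist (l (m + 2) : ℂ) (twist (l (m + 3) : ℂ) x) ∈ F (m + 1)) :
    ∃ (F' : ℕ → Submodule Atilde (Submodule.span Atilde {twist ((l (m + 2) : ℂ) - 1) x}))
      (l' : ℕ → ℚ) (e' : ℕ → Submodule.span Atilde {twist ((l (m + 2) : ℂ) - 1) x}),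
      GoodFlag (m + 2) F' l' e' ∧ l' 1 = l 1 ∧ l' (m + 2) = l (m + 3) + 1 ∧ (e' 1 : E) = e 1 ∧
      ∀ h, h ∉ F' (m + 1) → (h : E) ∉ F (m + 2) := by
  classical
  have hl := hF.last_le (m := m + 1) (by omega)
  change l (m + 2) ≤ l (m + 3) at hl
  -- the leading coefficient of `x` is constant
  obtain ⟨D, hD⟩ := hF.span (m + 2) (by omega) x (hF.mem_top x)
  have hDx := hF.twist_coeff (j := m + 2) (by omega) (l (m + 3)) hD
  have hDxx := hF.twist_coeff (j := m + 2) (by omega) (l (m + 2)) hDx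
  have hxt' := hF.mono (by omega : m + 1 ≤ m + 2) (by omega) hxt
  have hD1 := hF.free (m + 2) (by omega) (X * euler (l (m + 3) - l (m + 2))
    (X * euler (l (m + 3) - l (m + 3)) D)) (by
      have := (F (m + 2)).sub_mem hxt' hDxx
      rwa [sub_sub_cancel] at this)
  -- Since `l_k ≥ l_{k-1}`, the operator `b ∂_b + (l_k - l_{k-1})` is injective on multiples of `b`.
  -- Hence `b ∂_b D = 0`.
  have hD2 : euler (l (m + 3) - l (m + 3)) D = 0 := by
    have h1 := (mul_eq_zero.mp hD1).resolve_left X_ne_zero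
    by_contra h0
    obtain ⟨n, c, -, -, hn⟩ := eq_X_pow_of_euler_eq_zero h1 (mul_ne_zero X_ne_zero h0)
    have h2 : (n : ℚ) + (l (m + 3) - l (m + 2)) = 0 := by exact_mod_cast hn
    have hn0 : (0 : ℚ) ≤ n := Nat.cast_nonneg n
    have hnz : n = 0 := by
      have : (n : ℚ) = 0 := by linarith
      exact_mod_cast this
    subst hnz
    have h3 : euler ((l (m + 3) : ℂ) - l (m + 2) + 1) (euler (l (m + 3) - l (m + 3)) D) = 0 := by
      rw [euler_X_mul] at h1
      exact (mul_eq_zero.mp h1).resolve_left X_ne_zero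
    obtain ⟨n', c', -, -, hn'⟩ := eq_X_pow_of_euler_eq_zero h3 h0
    have h4 : (n' : ℚ) + (l (m + 3) - l (m + 2) + 1) = 0 := by exact_mod_cast hn'
    have hn0' : (0 : ℚ) ≤ n' := Nat.cast_nonneg n'
    linarith
  have hxF : x ∉ F (m + 2) := by
    intro hcon
    have h1 : (⊤ : Submodule Atilde E) ≤ F (m + 2) := by
      rw [← hx, Submodule.span_singleton_le_iff_mem]
      exact hcon
    exact hF.notMem (j := m + 2) (by omega) (h1 trivial)
  have hD0 : D ≠ 0 := by
    rintro rfl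
    exact hxF (by simpa using hD)
  obtain ⟨n, d, hd, rfl, hn⟩ := eq_X_pow_of_euler_eq_zero hD2 hD0
  have hn0 : n = 0 := by
    rw [sub_self, add_zero] at hn
    exact_mod_cast hn
  subst hn0
  rw [pow_zero, mul_one] at hD
  -- the leading coefficient of `(a - l_k b) x` is constant
  obtain ⟨W, hW⟩ := hF.span (m + 1) (by omega) _ hD
  obtain ⟨S, hS0, hS⟩ := hF.unit (m + 1) (by omega)
  have hx1 := hF.twist_coeff_two (j := m + 1) (by omega) (l (m + 3)) hS hW
  change twist (l (m + 3) : ℂ) x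
    - (X * euler ((l (m + 3) : ℂ) - l (m + 3)) (C d)) • e (m + 3) - _ ∈ F (m + 1) at hx1
  rw [euler_C, sub_self, zero_mul, map_zero, mul_zero, zero_smul, sub_zero] at hx1
  set D' := C d * S + X * euler ((l (m + 2) : ℂ) - l (m + 3)) W with hD'
  have hD'0 : constantCoeff D' ≠ 0 := by simp [hD', hd, hS0]
  change twist (l (m + 3) : ℂ) x - D' • e (m + 2) ∈ F (m + 1) at hx1
  obtain ⟨n, d', hd', hDd, hn⟩ := hF.coeff_of_twist_mem (by omega) hx1 hxt
    (by rintro h; simp [h] at hD'0)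
  have hn0 : n = 0 := by
    have : (n : ℂ) = 0 := by linear_combination -hn
    exact_mod_cast this
  subst hn0
  rw [pow_zero, mul_one] at hDd
  rw [hDd] at hx1
  -- the generator `y` of `F (k-2)`
  obtain ⟨W', hW'⟩ := hF.span m (by omega) _ hx1
  obtain ⟨S', hS'0, hS'⟩ := hF.unit m (by omega)
  have hx2 := hF.twist_coeff_two (j := m) (by omega) (l (m + 2)) hS' hW'
  rw [euler_C, sub_self, zero_mul, map_zero, mul_zero, zero_smul, sub_zero] at hx2
  have hyspan := span_singleton_eq_of_unit hF.toFlag (j := m) (by omega) (by simp [hd', hS'0]) hx2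
  -- Exchanging the factors shows that the generator of `F (k-2)` is `(a - (l_k + 1) b) g`. So the
  -- last invariant of `G` is `l_k + 1`.
  have hg := twist_twist (l (m + 2)) (l (m + 3)) x
  rw [hg] at hyspan hx2 hxt
  -- the leading coefficient of `g`
  have hgc := hF.twist_coeff (j := m + 2) (by omega) (l (m + 2) - 1) hD
  rw [euler_C] at hgc
  -- The leading coefficient of `g` is `q b`, with `q` proportional to `l_k - l_{k-1} + 1 ≥ 1`. So
  -- `ℂ[[b]] g` meets `F (k-1)` only in zero.
  have hq : ((l (m + 2 + 1) : ℂ) - (l (m + 2) - 1)) * d ≠ 0 := by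
    refine mul_ne_zero ?_ hd
    intro h0
    have : l (m + 3) - (l (m + 2) - 1) = 0 := by exact_mod_cast h0
    linarith
  generalize ((l (m + 2 + 1) : ℂ) - (l (m + 2) - 1)) * d = q at hgc hq
  generalize twist ((l (m + 2) : ℂ) - 1) x = g at *
  set G := Submodule.span Atilde {g} with hGdef
  have hgG : g ∈ G := Submodule.mem_span_singleton_self g
  have hFG : F (m + 1) ≤ G := by
    rw [← hyspan, Submodule.span_singleton_le_iff_mem]
    exact twist_mem _ _ hgG
  have hGg : ∀ y ∈ G, ∃ U : PowerSeries ℂ, y - U • g ∈ F (m + 1) := by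
    intro y hy
    obtain ⟨v, rfl⟩ := Submodule.mem_span_singleton.mp hy
    obtain ⟨U, w, hU⟩ := exists_smul_eq ((l (m + 3) : ℂ) + 1) v g
    refine ⟨U, ?_⟩
    rw [hU, add_sub_cancel_left]
    exact Submodule.smul_mem _ _ hxt
  have hgfree : ∀ U : PowerSeries ℂ, U • g ∈ F (m + 2) → U = 0 := by
    intro U hU
    have h1 := (F (m + 2)).sub_mem hU (series_smul_mem _ U hgc)
    rw [smul_sub, sub_sub_cancel, smul_smul] at h1
    have h2 := hF.free (m + 2) (by omega) _ h1
    rcases mul_eq_zero.mp h2 with h3 | h3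
    · exact h3
    · exfalso
      have h4 := (mul_eq_zero.mp h3).resolve_left X_ne_zero
      have := congrArg constantCoeff h4
      simp only [constantCoeff_C, map_zero] at this
      exact hq this
  have heG : ∀ j, j < m + 1 → e (j + 1) ∈ G := fun j hj =>
    hFG (hF.mono (by omega : j + 1 ≤ m + 1) (by omega) (hF.mem j (by omega)))
  -- The levels up to `k - 2` are kept and `G` is put on top of them, with `g` as last vector. Level
  -- `k - 1` of the old flag is skipped.
  let F' : ℕ → Submodule Atilde G := fun j => if j < m + 2 then (F j).comap G.subtype else ⊤
  let l' : ℕ → ℚ := fun j => if j < m + 2 then l j else l (m + 3) + 1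
  let e' : ℕ → G := fun j => if h : e j ∈ G ∧ j < m + 2 then ⟨e j, h.1⟩ else ⟨g, hgG⟩
  have hF'1 : ∀ j, j < m + 2 → F' j = (F j).comap G.subtype := fun j hj => if_pos hj
  have hF'2 : F' (m + 2) = ⊤ := if_neg (by omega)
  have hl'1 : ∀ j, j < m + 2 → l' j = l j := fun j hj => if_pos hj
  have hl'2 : l' (m + 2) = l (m + 3) + 1 := if_neg (by omega)
  have he'1 : ∀ j, j < m + 1 → (e' (j + 1) : E) = e (j + 1) := by
    intro j hj
    simp only [e', dif_pos (⟨heG j hj, by omega⟩ : e (j + 1) ∈ G ∧ j + 1 < m + 2)]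
  have he'2 : (e' (m + 2) : E) = g := by
    simp only [e', lt_irrefl, and_false, dite_false]
  have hmem : ∀ j, j < m + 2 → ∀ y : G, y ∈ F' j ↔ (y : E) ∈ F j := by
    intro j hj y
    rw [hF'1 j hj]
    rfl
  have hsm : ∀ (U : PowerSeries ℂ) (y : G), ((U • y : G) : E) = U • (y : E) := fun _ _ => rfl
  have htw : ∀ (ν : ℂ) (y : G), ((twist ν y : G) : E) = twist ν (y : E) := fun _ _ => rfl
  refine ⟨F', l', e', ⟨⟨?_, hF'2, ?_, ?_, ?_, ?_, ?_, ?_⟩, ?_, ?_, ?_, ?_⟩, hl'1 1 (by omega),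
    hl'2, he'1 0 (by omega), ?_⟩
  · rw [hF'1 0 (by omega), hF.zero]
    simp
  · intro j hj
    rcases Nat.lt_succ_iff_lt_or_eq.mp hj with hj | rfl
    · rw [hF'1 _ (by omega), hF'1 _ (by omega)]
      exact Submodule.comap_mono (hF.le_succ j (by omega))
    · rw [hF'2]
      exact le_top
  · intro j hj
    rcases Nat.lt_succ_iff_lt_or_eq.mp hj with hj | rfl
    · rw [hmem _ (by omega), he'1 j hj]
      exact hF.mem j (by omega)
    · rw [hF'2]
      trivial
  · intro j hj y hy
    rcases Nat.lt_succ_iff_lt_or_eq.mp hj with hj | rfl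
    · rw [hmem _ (by omega)] at hy
      obtain ⟨U, hU⟩ := hF.span j (by omega) _ hy
      refine ⟨U, ?_⟩
      rw [hmem _ (by omega), Submodule.coe_sub, hsm, he'1 j hj]
      exact hU
    · obtain ⟨U, hU⟩ := hGg y y.2
      refine ⟨U, ?_⟩
      rw [hmem _ (by omega), Submodule.coe_sub, hsm, he'2]
      exact hU
  · intro j hj U hU
    rw [hmem _ (by omega), hsm] at hU
    rcases Nat.lt_succ_iff_lt_or_eq.mp hj with hj | rfl
    · rw [he'1 j hj] at hU
      exact hF.free j (by omega) U hU
    · rw [he'2] at hU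
      exact hgfree U (hF.le_succ _ (by omega) hU)
  · intro j hj
    rw [hmem _ (by omega), htw]
    rcases Nat.lt_succ_iff_lt_or_eq.mp hj with hj | rfl
    · rw [he'1 j hj, hl'1 _ (by omega)]
      exact hF.eig j (by omega)
    · rw [he'2, hl'2]
      push_cast
      exact hxt
  · intro j hj
    rcases Nat.lt_succ_iff_lt_or_eq.mp hj with hj | hj
    · obtain ⟨S, hS, hSj⟩ := hF.unit j (by omega)
      refine ⟨S, hS, ?_⟩
      rw [hmem _ (by omega), Submodule.coe_sub, hsm, htw, he'1 (j + 1) hj, he'1 j (by omega),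
        hl'1 _ (by omega)]
      exact hSj
    · obtain rfl : j = m := by omega
      refine ⟨C d' * S' + X * euler ((l (j + 1) : ℂ) - l (j + 2)) W', by simp [hd', hS'0], ?_⟩
      rw [hmem _ (by omega), Submodule.coe_sub, hsm, htw, he'2, he'1 j (by omega), hl'2]
      push_cast
      exact hx2
  · intro i j hi hij hj
    rcases Nat.lt_succ_iff_lt_or_eq.mp (Nat.lt_succ_of_le hj) with hj | rfl
    · rw [hl'1 _ (by omega), hl'1 _ (by omega)]
      exact hF.principal i j hi hij (by omega)
    · rcases Nat.lt_succ_iff_lt_or_eq.mp (Nat.lt_succ_of_le hij) with hi' | rfl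
      · rw [hl'1 _ (by omega), hl'2]
        have := hF.principal i (m + 3) hi (by omega) le_rfl
        push_cast at this ⊢
        linarith
      · exact le_rfl
  · have hl'i : ∀ i < m + 2, ∃ i' < m + 3, ∃ n : ℤ, l' (i + 1) = l (i' + 1) + n := by
      intro i hi
      rcases Nat.lt_succ_iff_lt_or_eq.mp hi with hi | rfl
      · exact ⟨i, by omega, 0, by rw [hl'1 _ (by omega)]; simp⟩
      · exact ⟨m + 2, by omega, 1, by rw [hl'2]; simp⟩
    intro i hi j hj
    obtain ⟨i', hi', n, hn⟩ := hl'i i hi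
    obtain ⟨j', hj', n', hn'⟩ := hl'i j hj
    obtain ⟨r, hr⟩ := hF.integral i' hi' j' hj'
    exact ⟨r + n - n', by rw [hn, hn']; push_cast; linarith⟩
  · intro y _ μ hy
    rw [hmem _ (by omega)] at hy ⊢
    exact hF.noLog_top y (hF.mem_top _) μ hy
  · intro y hy μ hyy
    change y ∈ F' (m + 1) at hy
    rw [hmem _ (by omega)] at hy hyy ⊢
    exact hF.noLog_bot y (hF.mono (by omega : m + 1 ≤ m + 2) (by omega) hy) μ hyy
  · intro h hh hcon
    apply hh
    rw [hmem _ (by omega)]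
    obtain ⟨U, hU⟩ := hGg h h.2
    have h1 := (F (m + 2)).sub_mem hcon (hF.le_succ (m + 1) (by omega) hU)
    rw [sub_sub_cancel] at h1
    rw [hgfree U h1, zero_smul, sub_zero] at hU
    exact hU

end GoodFlag

end

/-! ### The recursive invariant equals the parameter. -/

section

variable {E : Type u} [AddCommGroup E] [Module Atilde E]

theorem constantCoeff_one_add {α : ℂ} {p : ℕ} (hp : p ≠ 0 ∨ α = 1) :
    constantCoeff (1 + C α * X ^ p : PowerSeries ℂ) ≠ 0 := by
  rcases Nat.eq_zero_or_pos p with rfl | hp0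
  · rcases hp with h | rfl
    · exact absurd rfl h
    · simp
  · simp [hp0.ne']

/-- A flag from a basis `h, f` of a module of rank two. -/
theorem flag_of_basis {l₁ μ : ℚ} {S : PowerSeries ℂ} (hS : constantCoeff S ≠ 0) {h f : E}
    (hf : twist (l₁ : ℂ) f = 0) (hh : twist (μ : ℂ) h = S • f)
    (hgen : ∀ x : E, ∃ U V : PowerSeries ℂ, x = U • h + V • f)
    (hind : ∀ U V : PowerSeries ℂ, U • h + V • f = 0 → U = 0 ∧ V = 0) :
    Flag 2 (fun j => if j = 0 then ⊥ else if j = 1 then Submodule.span Atilde {f} else ⊤)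
      (fun j => if j = 1 then l₁ else μ) (fun j => if j = 1 then f else h) := by
  have hspan : ∀ x, x ∈ Submodule.span Atilde {f} ↔ ∃ V : PowerSeries ℂ, x = V • f := by
    intro x
    rw [Submodule.mem_span_singleton]
    constructor
    · rintro ⟨v, rfl⟩
      obtain ⟨U, w, hU⟩ := exists_smul_eq (l₁ : ℂ) v f
      exact ⟨U, by rw [hU, hf, smul_zero, add_zero]⟩
    · rintro ⟨V, rfl⟩
      exact ⟨ofSeries V, rfl⟩
  refine ⟨by simp, by simp, fun j hj => ?_, fun j hj => ?_, fun j hj => ?_, fun j hj => ?_,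
    fun j hj => ?_, fun j hj => ?_⟩
  · interval_cases j <;> simp
  · interval_cases j
    · simp
    · simp
  · intro x hx
    interval_cases j
    · obtain ⟨V, rfl⟩ := (hspan x).mp (by simpa using hx)
      exact ⟨V, by simp⟩
    · obtain ⟨U, V, rfl⟩ := hgen x
      refine ⟨U, ?_⟩
      simp only [one_ne_zero, if_false, if_true]
      exact (hspan _).mpr ⟨V, by norm_num⟩
  · intro U hU
    interval_cases j
    · exact (hind 0 U (by simpa using hU)).2
    · simp only [one_ne_zero, if_false, if_true] at hU
      obtain ⟨V, hV⟩ := (hspan _).mp hU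
      norm_num at hV
      exact (hind U (-V) (by rw [hV]; module)).1
  · interval_cases j
    · simpa using hf
    · simp only [one_ne_zero, if_false, if_true]
      exact (hspan _).mpr ⟨S, by norm_num; exact hh⟩
  · obtain rfl : j = 0 := by omega
    refine ⟨S, hS, ?_⟩
    norm_num
    rw [hh, sub_self]

/-- A presentation of rank two with `q ≥ 0` yields a principal flag, which `Flag.unique` identifies
with the given one. Then `f` and `e 1` are eigenvectors in `F 1` with the same eigenvalue, so they
are proportional. -/
theorem GoodFlag.hasParam_of_basis {F : ℕ → Submodule Atilde E} {l : ℕ → ℚ} {e : ℕ → E}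
    (hF : GoodFlag 2 F l e) {l₁ : ℚ} {q : ℕ} {S : PowerSeries ℂ} (hS : constantCoeff S ≠ 0)
    {h f : E} (hf : twist (l₁ : ℂ) f = 0) (hh : twist ((l₁ + q - 1 : ℚ) : ℂ) h = S • f)
    (hgen : ∀ x : E, ∃ U V : PowerSeries ℂ, x = U • h + V • f)
    (hind : ∀ U V : PowerSeries ℂ, U • h + V • f = 0 → U = 0 ∧ V = 0) :
    l₁ = l 1 ∧ l 2 = l₁ + q - 1 ∧ h ∉ F 1 ∧
      ∃ c : ℂ, c ≠ 0 ∧ f = (C c : PowerSeries ℂ) • e 1 := by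
  have hflag := flag_of_basis hS hf hh hgen hind
  have hprin : Principal 2 (fun j => if j = 1 then l₁ else l₁ + q - 1) := by
    intro i j hi hij hj
    have hq : (0 : ℚ) ≤ q := Nat.cast_nonneg q
    obtain ⟨rfl, rfl⟩ | ⟨rfl, rfl⟩ | ⟨rfl, rfl⟩ :
        (i = 1 ∧ j = 1) ∨ (i = 1 ∧ j = 2) ∨ (i = 2 ∧ j = 2) := by omega
    · exact le_rfl
    · norm_num
      linarith
    · exact le_rfl
  obtain ⟨h1, h2⟩ := hF.unique hF.principal hflag hprin
  have hF1 := h1 1 (by omega)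
  have hl1 := h2 0 (by omega)
  have hl2 := h2 1 (by omega)
  norm_num at hF1 hl1 hl2
  refine ⟨hl1.symm, hl2, fun hcon => ?_, ?_⟩
  · have := hflag.notMem (j := 1) (by omega)
    norm_num at this
    exact this (hF1 ▸ hcon)
  · obtain ⟨U, hU⟩ := (hF.mem_one_iff (by omega) (x := f)).mp
      (hF1.symm ▸ Submodule.mem_span_singleton_self f)
    have hU0 : U ≠ 0 := by
      rintro rfl
      rw [zero_smul] at hU
      exact one_ne_zero (hind 0 1 (by rw [hU]; simp)).2
    obtain ⟨n, c, hc, rfl, hn⟩ := hF.coeff_of_twist_mem (j := 0) (by omega) (ν := (l₁ : ℂ))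
      (U := U) (x := f) (by rw [hU, sub_self]; exact zero_mem _)
      (by rw [hf]; exact zero_mem _) hU0
    have hn0 : n = 0 := by
      rw [← hl1] at hn
      have : (n : ℂ) = 0 := by linear_combination -hn
      exact_mod_cast this
    subst hn0
    exact ⟨c, hc, by rw [hU]; simp⟩

theorem GoodFlag.isAlpha_two_iff {F : ℕ → Submodule Atilde E} {l : ℕ → ℚ} {e : ℕ → E}
    (hF : GoodFlag 2 F l e) {p : ℕ} (hp : l 2 = l 1 + p - 1) (α : ℂ) :
    IsAlpha 2 E α ↔ HasParam 0 p F l e α := by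
  constructor
  · rintro ⟨l₁, ⟨rfl, hE⟩ | ⟨q, hq, hE⟩⟩
    · have h0 : ((l₁ : ℂ) - 1) = ((l₁ + (0 : ℕ) - 1 : ℚ) : ℂ) := by push_cast; ring
      rw [h0] at hE
      obtain ⟨h, f, hf, hh, hgen, hind⟩ := exists_basis_rankTwo (by simp) hE
      obtain ⟨h1, h2, h3, c, hc, hfc⟩ := hF.hasParam_of_basis (by simp) hf hh hgen hind
      have hp0 : p = 0 := by
        have : (p : ℚ) = 0 := by push_cast at h2; linarith
        exact_mod_cast this
      -- The convention `α = 1` for `p = 0` makes `1 + α b^p` equal to `2`, which the constant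
      -- absorbs.
      refine ⟨c / 2, by simpa using hc, h, h3, ?_, fun _ => rfl⟩
      have h4 : ((l (0 + 2) : ℂ) + (0 : ℕ)) = ((l₁ + (0 : ℕ) - 1 : ℚ) : ℂ) := by
        rw [← h2]
        simp
      rw [h4, hh, one_smul, hfc, hp0]
      congr 1
      have : (C c : PowerSeries ℂ) = C (2 * (c / 2)) := by congr 1; ring
      rw [this, map_mul]
      have h2 : (C 2 : PowerSeries ℂ) = 2 := map_ofNat C 2
      rw [h2, map_one]
      ring
    · have h0 : ((l₁ : ℂ) + q - 1) = ((l₁ + q - 1 : ℚ) : ℂ) := by push_cast; ring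
      have hS := constantCoeff_one_add (α := α) (p := q) (Or.inl (by omega))
      rw [h0, PowerSeries.smul_eq_C_mul] at hE
      obtain ⟨h, f, hf, hh, hgen, hind⟩ := exists_basis_rankTwo hS hE
      obtain ⟨h1, h2, h3, c, hc, hfc⟩ := hF.hasParam_of_basis hS hf hh hgen hind
      have hpq : p = q := by
        have : (p : ℚ) = q := by linarith
        exact_mod_cast this
      subst hpq
      refine ⟨c, hc, h, h3, ?_, fun h => by omega⟩
      rw [h2, Nat.cast_zero, add_zero, hh, hfc, smul_smul]
  · rintro ⟨c, hc, h, hh, htw, hα⟩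
    rw [Nat.cast_zero, add_zero] at htw
    -- The eigenvalue of `h` is exactly `l 2`, so its leading coefficient is a nonzero constant, and
    -- `h, e 1` is a basis of `E`.
    obtain ⟨D, hD⟩ := hF.span 1 (by omega) h (hF.mem_top h)
    obtain ⟨n, d, hd, rfl, hn⟩ := hF.eq_of_twist_zero (j := 1) (by omega) hD
      (by rw [htw]; exact series_smul_mem _ _ (hF.mem 0 (by omega))) hh
    have hn0 : n = 0 := by
      change l 2 = l 2 + n at hn
      have : (n : ℚ) = 0 := by linarith
      exact_mod_cast this
    subst hn0
    rw [pow_zero, mul_one] at hD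
    have hdd : (C d⁻¹ * C d : PowerSeries ℂ) = 1 := by
      rw [← map_mul, inv_mul_cancel₀ hd, map_one]
    have hgen : ∀ x : E, ∃ U V : PowerSeries ℂ, x = U • h + V • e 1 := by
      intro x
      obtain ⟨U, hU⟩ := hF.span 1 (by omega) x (hF.mem_top x)
      have h1 := (F 1).sub_mem hU (series_smul_mem _ (U * C d⁻¹) hD)
      obtain ⟨V, hV⟩ := (hF.mem_one_iff (by omega)).mp h1
      refine ⟨U * C d⁻¹, V, ?_⟩
      rw [← hV]
      have : U • e 2 = (U * (C d⁻¹ * C d)) • e 2 := by rw [hdd, mul_one]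
      change x = _ + (x - U • e 2 - (U * C d⁻¹) • (h - (C d : PowerSeries ℂ) • e 2))
      rw [this]
      module
    have hind : ∀ U V : PowerSeries ℂ, U • h + V • e 1 = 0 → U = 0 ∧ V = 0 := by
      intro U V hUV
      have hU : U = 0 := by
        by_contra hU
        apply hh
        refine hF.mem_of_smul_mem (by omega) hU ?_
        rw [eq_neg_of_add_eq_zero_left hUV]
        exact (F 1).neg_mem (series_smul_mem _ _ (hF.mem 0 (by omega)))
      subst hU
      exact ⟨rfl, hF.smul_one_eq_zero (by omega) (by simpa using hUV)⟩
    have hbase : ∀ (S : PowerSeries ℂ) (c : ℂ), c ≠ 0 → constantCoeff S ≠ 0 →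
        twist (l 2 : ℂ) h = (S * C c) • e 1 →
        Nonempty (E ≃ₗ[Atilde] ERankTwo (l 1 : ℂ) S (l 2)) := by
      intro S c hc hS htw
      have hcc : (C c⁻¹ * C c : PowerSeries ℂ) = 1 := by
        rw [← map_mul, inv_mul_cancel₀ hc, map_one]
      refine equiv_rankTwo hS (h := h) (e := (C c : PowerSeries ℂ) • e 1) ?_ ?_ ?_ ?_
      · rw [hF.twist_smul_one (by omega), sub_self, euler_C, zero_mul, map_zero, mul_zero,
          zero_smul]
      · rw [htw, mul_smul]
      · intro x
        obtain ⟨U, V, rfl⟩ := hgen x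
        exact ⟨U, V * C c⁻¹, by rw [smul_smul, mul_assoc, hcc, mul_one]⟩
      · intro U V hUV
        rw [smul_smul] at hUV
        obtain ⟨h1, h2⟩ := hind _ _ hUV
        refine ⟨h1, ?_⟩
        rw [← mul_one V, ← hcc, mul_comm (C c⁻¹), ← mul_assoc, h2, zero_mul]
    refine ⟨l 1, ?_⟩
    rcases Nat.eq_zero_or_pos p with rfl | hp0
    · refine Or.inl ⟨hα rfl, ?_⟩
      have h2 : ((l 1 : ℂ) - 1) = l 2 := by rw [hp]; push_cast; ring
      rw [h2]
      refine hbase 1 (2 * c) (mul_ne_zero two_ne_zero hc) (by simp) ?_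
      rw [htw, hα rfl]
      congr 1
      have h2 : (C 2 : PowerSeries ℂ) = 2 := map_ofNat C 2
      rw [map_mul, h2, map_one]
      ring
    · refine Or.inr ⟨p, hp0, ?_⟩
      have h2 : ((l 1 : ℂ) + p - 1) = l 2 := by rw [hp]; push_cast; ring
      rw [h2, PowerSeries.smul_eq_C_mul]
      exact hbase _ c hc (constantCoeff_one_add (Or.inl hp0.ne')) htw

/-- From `E` to `G` the rank drops by one and the last invariant grows by one. Thus `l (m + 2) + m`,
`e 1` and `p` do not change, and the equation defining the parameter in `G` is literally one in `E`.
The sequence chosen in `IsAlpha` is the given one by `Flag.unique`. -/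
theorem isAlpha_iff (m : ℕ) : ∀ {E : Type u} [AddCommGroup E] [Module Atilde E]
    {F : ℕ → Submodule Atilde E} {l : ℕ → ℚ} {e : ℕ → E} (_ : GoodFlag (m + 2) F l e) {p : ℕ}
    (_ : l (m + 2) + m = l 1 + p - 1) (α : ℂ),
    IsAlpha (m + 2) E α ↔ HasParam m p F l e α := by
  induction m with
  | zero =>
    intro E _ _ F l e hF p hp α
    exact hF.isAlpha_two_iff (by simpa using hp) α
  | succ m ih =>
    intro E _ _ F l e hF p hp α
    have hsub : ∀ x : E, Submodule.span Atilde {x} = ⊤ →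
        twist (l (m + 2) : ℂ) (twist (l (m + 3) : ℂ) x) ∈ F (m + 1) →
        ∃ (F' : ℕ → Submodule Atilde (Submodule.span Atilde {twist ((l (m + 2) : ℂ) - 1) x}))
          (l' : ℕ → ℚ) (e' : ℕ → Submodule.span Atilde {twist ((l (m + 2) : ℂ) - 1) x}),
          GoodFlag (m + 2) F' l' e' ∧ l' (m + 2) + m = l' 1 + p - 1 ∧
          ∀ β, HasParam m p F' l' e' β → HasParam (m + 1) p F l e β := by
      intro x hx hxt
      obtain ⟨F', l', e', hF', hl1, hl2, he1, hmem⟩ := hF.exists_goodFlag_sub hx hxt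
      refine ⟨F', l', e', hF', ?_, ?_⟩
      · rw [hl1, hl2, ← hp]
        push_cast
        ring
      · rintro β ⟨c, hc, h, hh, htw, hβ⟩
        refine ⟨c, hc, h, hmem h hh, ?_, hβ⟩
        have h1 := congrArg (Subtype.val) htw
        change twist ((l' (m + 2) : ℂ) + m) (h : E) = ((1 + C β * X ^ p) * C c : PowerSeries ℂ)
          • (e' 1 : E) at h1
        rw [he1, hl2] at h1
        rw [← h1]
        congr 1
        push_cast
        ring
    constructor
    · rintro ⟨F', l', hF', x, hx, hxt, hα⟩
      obtain ⟨e', he'⟩ := hF'.exists_flag hx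
      obtain ⟨h1, h2⟩ := hF.unique hF.principal he' hF'.principal
      have hl2 : l (m + 2) = l' (m + 2) := h2 (m + 1) (by omega)
      have hl3 : l (m + 3) = l' (m + 3) := h2 (m + 2) (by omega)
      have hF1 : F (m + 1) = F' (m + 1) := h1 (m + 1) (by omega)
      rw [← hl2, ← hl3, ← hF1] at hxt
      rw [← hl2] at hα
      obtain ⟨G, lG, eG, hG, hpG, hparam⟩ := hsub x hx hxt
      exact hparam α ((ih hG hpG α).mp hα)
    · intro hα
      obtain ⟨x, hx, hxt⟩ := hF.exists_generator
      obtain ⟨G, lG, eG, hG, hpG, hparam⟩ := hsub x hx hxt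
      -- Parameters are only transported from `G` to `E`. For the converse, take any parameter of
      -- `G`; it is one of `E`, so it equals `α` by uniqueness.
      obtain ⟨β, hβ⟩ := hG.exists_param hpG
      have hβα := hF.param_unique hp (hparam β hβ) hα
      subst hβα
      exact ⟨F, l, hF.isPrincipalJH hF.principal, x, hx, hxt, (ih hG hpG β).mpr hβ⟩

end

section

/-! ### Semi-simple modules have no logarithms. -/

section Krull

theorem eq_zero_of_forall_X_pow {Q : Type*} [AddCommGroup Q] [Module (PowerSeries ℂ) Q]
    [Module.Finite (PowerSeries ℂ) Q] {x : Q}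
    (h : ∀ s : ℕ, ∃ z : Q, x = (X ^ s : PowerSeries ℂ) • z) : x = 0 := by
  have hI : (Ideal.span {(X : PowerSeries ℂ)}) ≠ ⊤ := by
    rw [Ne, Ideal.span_singleton_eq_top]
    exact PowerSeries.X_prime.not_isUnit
  have h1 := Ideal.iInf_pow_smul_eq_bot_of_isLocalRing (M := Q) _ hI
  have h2 : x ∈ (⊥ : Submodule (PowerSeries ℂ) Q) := by
    rw [← h1, Submodule.mem_iInf]
    intro s
    obtain ⟨z, rfl⟩ := h s
    rw [Ideal.span_singleton_pow]
    exact Submodule.smul_mem_smul (Ideal.mem_span_singleton_self _) trivial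
  simpa using h2

/-- An `Ã`-linear map as a `ℂ[[b]]`-linear map. -/
noncomputable def toSeriesLinear {E : Type u} {M : Type v} [AddCommGroup E] [Module Atilde E] [AddCommGroup M]
    [Module Atilde M] (f : E →ₗ[Atilde] M) : E →ₗ[PowerSeries ℂ] M where
  toFun := f
  map_add' := map_add f
  map_smul' U x := map_smul f (ofSeries U) x

theorem map_series_smul {E : Type u} {M : Type v} [AddCommGroup E] [Module Atilde E]
    [AddCommGroup M] [Module Atilde M] (f : E →ₗ[Atilde] M) (U : PowerSeries ℂ) (x : E) :
    f (U • x) = U • f x := map_smul f (ofSeries U) x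

theorem map_twist {E : Type u} {M : Type v} [AddCommGroup E] [Module Atilde E]
    [AddCommGroup M] [Module Atilde M] (f : E →ₗ[Atilde] M) (ν : ℂ) (x : E) :
    f (twist ν x) = twist ν (f x) := map_smul f _ x

/-- If `a m = f₀ m` with `f₀` a unit, then in a simple pole module, where `a` maps `b^s M'` into
`b^(s+1) M'`, the image of `m` lies in every `b^s M'`. It is zero by Krull's intersection theorem.
-/
theorem exists_basis_of_regular_rank_one {M : Type u} [AddCommGroup M] [Module Atilde M]
    (hM : IsRegular M) (hr : rank M = 1) :
    ∃ (m : M) (S : PowerSeries ℂ), (∀ x : M, ∃ U : PowerSeries ℂ, x = U • m) ∧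
      (∀ U : PowerSeries ℂ, U • m = 0 → U = 0) ∧ twist 0 m = (X * S) • m := by
  obtain ⟨⟨hfree, hfin⟩, M', _, _, ⟨hfree', hfin'⟩, hpole, f, hf⟩ := hM
  have hbas : Module.Basis Unit (PowerSeries ℂ) M := Module.basisUnique Unit hr
  set m := hbas () with hm
  have hgen : ∀ x : M, ∃ U : PowerSeries ℂ, x = U • m := by
    intro x
    refine ⟨hbas.repr x (), ?_⟩
    conv_lhs => rw [← hbas.sum_repr x]
    simp [hm]
  have hind : ∀ U : PowerSeries ℂ, U • m = 0 → U = 0 := by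
    intro U hU
    have := congrArg (fun y => hbas.repr y ()) hU
    simpa [hm] using this
  obtain ⟨f₀, hf₀⟩ := hgen (twist 0 m)
  have h0 : constantCoeff f₀ = 0 := by
    by_contra hne
    have hy : twist 0 (f m) = f₀ • f m := by
      rw [← map_twist, hf₀, map_series_smul]
    have key : ∀ s : ℕ, ∃ z : M', f m = (X ^ s : PowerSeries ℂ) • z := by
      intro s
      induction s with
      | zero => exact ⟨f m, by simp⟩
      | succ s ih =>
        obtain ⟨z, hz⟩ := ih
        obtain ⟨w, hw⟩ := hpole z
        have h1 : twist 0 (f m) = (X ^ (s + 1) : PowerSeries ℂ)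
            • (w + (C (s : ℂ) : PowerSeries ℂ) • z) := by
          have h2 := twist_X_pow_smul 0 s z
          have h3 := twist_sub_twist 0 (0 + s) ((X ^ s : PowerSeries ℂ) • z)
          rw [h2] at h3
          rw [hz, h3, twist_def, hw, b_smul, map_zero]
          rw [zero_add, sub_zero]
          module
        refine ⟨f₀⁻¹ • (w + (C (s : ℂ) : PowerSeries ℂ) • z), ?_⟩
        rw [smul_comm, ← h1, hy, smul_smul, PowerSeries.inv_mul_cancel _ hne, one_smul]
    have h1 := eq_zero_of_forall_X_pow key
    have h2 : m = 0 := hf (by rw [h1, map_zero])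
    exact one_ne_zero (hind 1 (by rw [h2, smul_zero]))
  obtain ⟨S, rfl⟩ := exists_eq_X_mul h0
  exact ⟨m, S, hgen, hind, hf₀⟩

/-- Here `b⁻¹ a - μ` acts on coefficients as `L = b ∂_b + S - μ`. If `Z = L W` is a nonzero solution
of `L Z = 0`, its order `n` satisfies `n + S(0) = μ`. Comparing lowest terms in `Z = L W` excludes
every possible order of `W`. -/
theorem noLog_rank_one {M : Type u} [AddCommGroup M] [Module Atilde M]
    (hM : IsRegular M) (hr : rank M = 1) : NoLog (⊤ : Submodule Atilde M) ⊥ := by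
  obtain ⟨m, S, hgen, hind, hm⟩ := exists_basis_of_regular_rank_one hM hr
  have htw : ∀ (ν : ℂ) (W : PowerSeries ℂ), twist ν (W • m)
      = (X * (X * derivative ℂ W + (S - C ν) * W)) • m := by
    intro ν W
    rw [twist_smul ν 0, hm, euler, zero_sub, map_neg]
    module
  intro x _ μ hx
  obtain ⟨W, rfl⟩ := hgen x
  rw [Submodule.mem_bot] at hx ⊢
  rw [htw] at hx ⊢
  set Z := X * derivative ℂ W + (S - C μ) * W with hZ
  rw [mul_smul, twist_X_smul, htw, smul_smul] at hx
  have h1 : X * derivative ℂ Z + (S - C μ) * Z = 0 := by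
    have := hind _ hx
    exact (mul_eq_zero.mp ((mul_eq_zero.mp this).resolve_left X_ne_zero)).resolve_left X_ne_zero
  suffices hZ0 : Z = 0 by rw [hZ0]; simp
  by_contra hZ0
  have hW0 : W ≠ 0 := by
    rintro rfl
    exact hZ0 (by rw [hZ]; simp)
  have hop : ∀ (k : ℕ) (Y : PowerSeries ℂ), X * derivative ℂ (X ^ k * Y) + (S - C μ) * (X ^ k * Y)
      = X ^ k * ((C (k : ℂ) + S - C μ) * Y + X * derivative ℂ Y) := by
    intro k Y
    have h2 := euler_X_pow_mul 0 k Y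
    rw [euler, euler, map_zero, zero_mul, add_zero, zero_add] at h2
    rw [h2]
    ring
  obtain ⟨n, V, hV, hZV⟩ := exists_X_pow_mul_unit hZ0
  obtain ⟨k, Y, hY, hWY⟩ := exists_X_pow_mul_unit hW0
  rw [hZV, hop] at h1
  have h2 := congrArg constantCoeff
    ((mul_eq_zero.mp h1).resolve_left (pow_ne_zero _ X_ne_zero))
  simp [hV] at h2
  have h3 : X ^ n * V = X ^ k * ((C (k : ℂ) + S - C μ) * Y + X * derivative ℂ Y) := by
    rw [← hZV, hZ, hWY, hop]
  rcases lt_trichotomy n k with hlt | rfl | hlt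
  · obtain ⟨r, rfl⟩ := Nat.exists_eq_add_of_lt hlt
    rw [add_assoc, pow_add, mul_assoc] at h3
    have h4 := congrArg constantCoeff (mul_left_cancel₀ (pow_ne_zero n X_ne_zero) h3)
    simp at h4
    exact hV h4
  · have h4 := congrArg constantCoeff (mul_left_cancel₀ (pow_ne_zero n X_ne_zero) h3)
    simp [h2] at h4
    exact hV h4
  · obtain ⟨r, rfl⟩ := Nat.exists_eq_add_of_lt hlt
    rw [add_assoc, pow_add, mul_assoc] at h3
    have h4 := congrArg constantCoeff (mul_left_cancel₀ (pow_ne_zero k X_ne_zero) h3)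
    simp [hY] at h4
    have h5 : ((r + 1 : ℕ) : ℂ) = 0 := by
      push_cast at h2 ⊢
      linear_combination h2 - h4
    exact absurd h5 (by norm_cast)

theorem noLog_of_isSemiSimple {E : Type u} [AddCommGroup E] [Module Atilde E]
    (hE : IsSemiSimple E) : NoLog (⊤ : Submodule Atilde E) ⊥ := by
  obtain ⟨n, M, _, _, hM, f, hf⟩ := hE
  intro x _ μ hx
  rw [Submodule.mem_bot] at hx ⊢
  apply hf
  funext i
  have h1 := congrArg (fun y => f y i) hx
  simp only [map_twist, map_zero] at h1 ⊢
  have h2 := noLog_rank_one (hM i).1 (hM i).2 (f x i) trivial μ (by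
    rw [Submodule.mem_bot]
    exact h1)
  rw [Submodule.mem_bot] at h2
  exact h2

theorem noLog_coe {E : Type u} [AddCommGroup E] [Module Atilde E] {P : Submodule Atilde E}
    (h : NoLog (⊤ : Submodule Atilde P) ⊥) : NoLog P ⊥ := by
  intro x hx μ hxx
  rw [Submodule.mem_bot] at hxx ⊢
  have h1 := h ⟨x, hx⟩ trivial μ (by
    rw [Submodule.mem_bot]
    exact Subtype.ext hxx)
  rw [Submodule.mem_bot] at h1
  exact congrArg Subtype.val h1

theorem noLog_of_quotient {E : Type u} [AddCommGroup E] [Module Atilde E] {P : Submodule Atilde E}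
    (h : NoLog (⊤ : Submodule Atilde (E ⧸ P)) ⊥) : NoLog ⊤ P := by
  intro x _ μ hxx
  have h1 := h (P.mkQ x) trivial μ (by
    rw [Submodule.mem_bot, ← map_twist, ← map_twist]
    exact (Submodule.Quotient.mk_eq_zero P).mpr hxx)
  rw [Submodule.mem_bot, ← map_twist] at h1
  exact (Submodule.Quotient.mk_eq_zero P).mp h1

end Krull

/-! ### The invariants `l j` are roots of the Bernstein polynomial up to sign and integers. -/

section Bernstein

variable {E : Type u} [AddCommGroup E] [Module Atilde E]

/-- The image of `N` in `M / b M` is stable under `D`. Modulo it, the class of `y` is nonzero and is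
an eigenvector of `D` for `-ν`. As the minimal polynomial annihilates it, `-ν` is a root. -/
theorem IsSimplePoleBernstein.isRoot {M : Type u} [AddCommGroup M] [Module Atilde M]
    {B : Polynomial ℂ} (hpole : HasSimplePole M) (hB : IsSimplePoleBernstein M B)
    (N : Submodule (PowerSeries ℂ) M) (ha : ∀ x ∈ N, twist 0 x ∈ N)
    (hsat : ∀ x : M, (X : PowerSeries ℂ) • x ∈ N → x ∈ N) {y : M} {ν : ℂ}
    (hy : ∀ z : M, y - (X : PowerSeries ℂ) • z ∉ N) (hν : twist ν y ∈ N) : B.IsRoot (-ν) := by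
  let := complexModule M
  obtain ⟨D, hD, rfl⟩ := hB
  let N' : Submodule ℂ (M ⧸ bSub M) :=
    { carrier := {q | ∃ x ∈ N, (bSub M).mkQ x = q}
      zero_mem' := ⟨0, N.zero_mem, map_zero _⟩
      add_mem' := by
        rintro _ _ ⟨x, hx, rfl⟩ ⟨x', hx', rfl⟩
        exact ⟨x + x', N.add_mem hx hx', map_add _ _ _⟩
      smul_mem' := by
        rintro c _ ⟨x, hx, rfl⟩
        exact ⟨c • x, N.smul_mem (C c : PowerSeries ℂ) hx, map_smul _ _ _⟩ }
  have hDN : ∀ q ∈ N', D q ∈ N' := by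
    rintro _ ⟨x, hx, rfl⟩
    obtain ⟨z, hz⟩ := hpole x
    rw [hD x z hz]
    refine N'.neg_mem ⟨z, hsat z ?_, rfl⟩
    have := ha x hx
    rw [twist_def, hz, b_smul] at this
    simpa using this
  have hyN : (bSub M).mkQ y ∉ N' := by
    rintro ⟨x, hx, hxy⟩
    have h1 : y - x ∈ bSub M := by
      rw [← Submodule.Quotient.eq]
      exact hxy.symm
    obtain ⟨z, hz⟩ := h1
    apply hy z
    rw [← b_smul, ← hz, sub_sub_cancel]
    exact hx
  have hDy : D ((bSub M).mkQ y) - (-ν) • (bSub M).mkQ y ∈ N' := by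
    obtain ⟨z, hz⟩ := hpole y
    rw [hD y z hz]
    have h1 : (C ν : PowerSeries ℂ) • y - z ∈ N := by
      apply hsat
      have := N.neg_mem hν
      rw [twist_def, hz, b_smul] at this
      convert this using 1
      module
    refine ⟨_, h1, ?_⟩
    rw [map_sub]
    have h2 : (bSub M).mkQ ((C ν : PowerSeries ℂ) • y) = ν • (bSub M).mkQ y :=
      map_smul (bSub M).mkQ ν y
    rw [h2]
    module
  have hpoly : ∀ (g : Polynomial ℂ) (q : M ⧸ bSub M), q ∈ N' → Polynomial.aeval D g q ∈ N' := by
    intro g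
    induction g using Polynomial.induction_on' with
    | add g g' hg hg' =>
      intro q hq
      rw [map_add, LinearMap.add_apply]
      exact N'.add_mem (hg q hq) (hg' q hq)
    | monomial n c =>
      intro q hq
      rw [Polynomial.aeval_monomial, Module.End.mul_apply, Module.algebraMap_end_apply]
      refine N'.smul_mem c ?_
      induction n with
      | zero => exact hq
      | succ n ih =>
        rw [pow_succ', Module.End.mul_apply]
        exact hDN _ ih
  obtain ⟨g, hg⟩ := Polynomial.X_sub_C_dvd_sub_C_eval (a := -ν) (p := minpoly ℂ D)
  have h3 := congrArg (fun p => Polynomial.aeval D p ((bSub M).mkQ y)) hg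
  simp only [map_sub, minpoly.aeval, Polynomial.aeval_C, mul_comm (Polynomial.X - _) g, map_mul,
    Module.End.mul_apply, LinearMap.sub_apply, LinearMap.zero_apply, Polynomial.aeval_X,
    Module.algebraMap_end_apply] at h3
  have h4 := hpoly g _ hDy
  rw [map_sub, ← h3, zero_sub] at h4
  rw [Polynomial.IsRoot]
  by_contra hne
  apply hyN
  have h5 := N'.smul_mem ((minpoly ℂ D).eval (-ν))⁻¹ (N'.neg_mem h4)
  rwa [neg_neg, smul_smul, inv_mul_cancel₀ hne, one_smul] at h5

/-- Let `N` be the set of elements of the saturation that some power of `b` brings into the image of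
`F j`. Modulo `N`, the image of `e (j + 1)` is `b^s y` with `s` maximal, and `y` is an eigenvector
for `l (j + 1) - s`. Then `isRoot` applies. -/
theorem Flag.exists_int_of_isPrimitive {k : ℕ} {F : ℕ → Submodule Atilde E} {l : ℕ → ℚ}
    {e : ℕ → E} (hF : Flag k F l e) {lam : ℚ} (hE : IsPrimitive lam E) {j : ℕ} (hj : j < k) :
    ∃ n : ℤ, l (j + 1) - lam = n := by
  obtain ⟨-, B, ⟨M, _, _, f, ⟨⟨-, hfin⟩, hpole, hf, -⟩, hB⟩, hroot⟩ := hE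
  let N : Submodule (PowerSeries ℂ) M :=
    { carrier := {x | ∃ (n : ℕ), ∃ y ∈ F j, (X ^ n : PowerSeries ℂ) • x = f y}
      zero_mem' := ⟨0, 0, zero_mem _, by simp⟩
      add_mem' := by
        rintro x x' ⟨n, y, hy, hxy⟩ ⟨n', y', hy', hxy'⟩
        refine ⟨n + n', (X ^ n' : PowerSeries ℂ) • y + (X ^ n : PowerSeries ℂ) • y',
          (F j).add_mem (series_smul_mem _ _ hy) (series_smul_mem _ _ hy'), ?_⟩
        rw [map_add, map_series_smul, map_series_smul, ← hxy, ← hxy', pow_add]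
        module
      smul_mem' := by
        rintro U x ⟨n, y, hy, hxy⟩
        exact ⟨n, U • y, series_smul_mem _ _ hy, by
          rw [map_series_smul, ← hxy, smul_comm]⟩ }
  have hsat' : ∀ (s : ℕ) (x : M), (X ^ s : PowerSeries ℂ) • x ∈ N → x ∈ N := by
    rintro s x ⟨n, y, hy, hxy⟩
    exact ⟨n + s, y, hy, by rw [pow_add, mul_smul, hxy]⟩
  have hsat : ∀ x : M, (X : PowerSeries ℂ) • x ∈ N → x ∈ N := by
    intro x hx
    exact hsat' 1 x (by simpa using hx)
  have htwN : ∀ x ∈ N, ∀ ν, twist ν x ∈ N := by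
    rintro x ⟨n, y, hy, hxy⟩ ν
    refine ⟨n, twist (ν + n) y, twist_mem _ _ hy, ?_⟩
    rw [map_twist, ← hxy, twist_X_pow_smul]
  have hfN : ∀ y ∈ F j, f y ∈ N := fun y hy => ⟨0, y, hy, by simp⟩
  have heN : f (e (j + 1)) ∉ N := by
    rintro ⟨n, y, hy, hxy⟩
    rw [← map_series_smul] at hxy
    have h1 := hf hxy
    rw [← h1] at hy
    exact pow_ne_zero n X_ne_zero (hF.free j hj _ hy)
  -- By Krull's theorem in `M / N`, a nonzero class is not divisible by all powers of `b`.
  have hexs : ∃ s : ℕ, ∀ z : M, f (e (j + 1)) - (X ^ s : PowerSeries ℂ) • z ∉ N := by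
    by_contra hcon
    push Not at hcon
    have h1 : N.mkQ (f (e (j + 1))) = 0 := by
      refine eq_zero_of_forall_X_pow fun s => ?_
      obtain ⟨z, hz⟩ := hcon s
      refine ⟨N.mkQ z, ?_⟩
      rw [← map_smul]
      exact (Submodule.Quotient.eq N).mpr hz
    exact heN ((Submodule.Quotient.mk_eq_zero N).mp h1)
  classical
  have hs := Nat.find_spec hexs
  have hs0 : Nat.find hexs ≠ 0 := by
    intro h0
    rw [h0] at hs
    exact hs (f (e (j + 1))) (by simp)
  obtain ⟨s, hs1⟩ := Nat.exists_eq_succ_of_ne_zero hs0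
  have hmin := Nat.find_min hexs (m := s) (by omega)
  rw [hs1] at hs
  push Not at hmin
  obtain ⟨y, hy⟩ := hmin
  have htw : twist ((l (j + 1) : ℂ) - s) y ∈ N := by
    apply hsat' s
    rw [← twist_X_pow_smul, sub_add_cancel]
    have h1 := N.sub_mem (hfN _ (hF.eig j hj)) (htwN _ hy (l (j + 1) : ℂ))
    rwa [map_twist, twist_sub, sub_sub_cancel] at h1
  have hroot' := hB.isRoot hpole N (fun x hx => htwN x hx 0) hsat (fun z hz => hs z (by
    have h1 := N.add_mem hy (N.smul_mem (X ^ s : PowerSeries ℂ) hz)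
    convert h1 using 1
    rw [Nat.succ_eq_add_one, pow_succ]
    module)) htw
  obtain ⟨n, hn⟩ := hroot _ hroot'
  refine ⟨s - n, ?_⟩
  have h1 : (l (j + 1) : ℂ) - lam = s - n := by linear_combination -hn
  exact_mod_cast h1

end Bernstein

end

section

/-! ### Eigenvectors in `Ξ`. -/

section Xi

theorem Xi.a_smul (l : ℚ) (N : ℕ) (x : Xi l N) (j : Fin (N + 1)) :
    (a • x) j = xiA l N x j :=
  congrFun ((act_C (xiA l N) Polynomial.X x).trans (by rw [Polynomial.aeval_X])) j

theorem act_map_C {ι : Type} (α : Module.End ℂ (ι → PowerSeries ℂ)) (U : PowerSeries ℂ)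
    (x : ι → PowerSeries ℂ) (j : ι) : act α (PowerSeries.map Polynomial.C U) x j = U * x j := by
  ext n
  rw [act, coeff_mk, coeff_mul,
    Finset.Nat.sum_antidiagonal_eq_sum_range_succ (fun i k => coeff i U * coeff k (x j))]
  refine Finset.sum_congr rfl fun m hm => ?_
  have hmn : m ≤ n := by simpa [Nat.lt_succ_iff] using hm
  rw [coeff_map, Polynomial.aeval_C, Module.algebraMap_end_apply]
  change coeff n (coeff m U • (X ^ m * x j)) = _
  rw [coeff_smul, coeff_X_pow_mul', if_pos hmn, smul_eq_mul]

theorem Xi.series_smul (l : ℚ) (N : ℕ) (U : PowerSeries ℂ) (x : Xi l N) (j : Fin (N + 1)) :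
    (U • x) j = U * x j := act_map_C (xiA l N) U x j

theorem Xi.twist_apply (l : ℚ) (N : ℕ) (ν : ℂ) (x : Xi l N) (j : Fin (N + 1)) :
    twist ν x j = X * (euler ((l : ℂ) - ν) (x j)
      + if h : j.val + 1 < N + 1 then C ((j.val + 1 : ℕ) : ℂ) * x ⟨j.val + 1, h⟩ else 0) := by
  rw [twist_def]
  change (a • x) j - ((C ν * X : PowerSeries ℂ) • x) j = _
  rw [Xi.a_smul, Xi.series_smul]
  simp only [xiA, LinearMap.coe_mk, AddHom.coe_mk, euler, map_sub, PowerSeries.smul_eq_C_mul]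
  split_ifs <;> ring

/-- The operator is diagonal on monomials. -/
theorem euler_eq_zero_of_euler_euler {σ : ℂ} {U : PowerSeries ℂ}
    (h : euler σ (euler σ U) = 0) : euler σ U = 0 := by
  ext n
  have := congrArg (coeff n) h
  rw [coeff_euler, coeff_euler, map_zero] at this
  rw [coeff_euler, map_zero]
  rcases mul_eq_zero.mp this with h1 | h1
  · rw [h1, zero_mul]
  · exact h1

/-- The components satisfy `euler (l - ν) (x j) = -(j + 1) x (j + 1)`. From `j = N` downwards, the
Euler operator kills each component twice, hence once. So every `x (j + 1)` vanishes, and only a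
monomial without logarithm remains. -/
theorem Xi.coeff_eigenvector {l : ℚ} {N : ℕ} {ν : ℂ} {x : Xi l N} (hx : twist ν x = 0)
    {j : Fin (N + 1)} {n : ℕ} (hn : coeff n (x j) ≠ 0) : j = 0 ∧ ν = l + n := by
  have hx' : ∀ j : Fin (N + 1), euler ((l : ℂ) - ν) (x j)
      + (if h : j.val + 1 < N + 1 then C ((j.val + 1 : ℕ) : ℂ) * x ⟨j.val + 1, h⟩ else 0) = 0 := by
    intro j
    have h1 := congrFun hx j
    rw [Xi.twist_apply] at h1
    exact (mul_eq_zero.mp h1).resolve_left X_ne_zero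
  have hCeuler : ∀ (σ c : ℂ) (U : PowerSeries ℂ), euler σ (C c * U) = C c * euler σ U := by
    intro σ c U
    ext n
    rw [coeff_euler, coeff_C_mul, coeff_C_mul, coeff_euler]
    ring
  have hneg : ∀ (σ : ℂ) (U : PowerSeries ℂ), euler σ (-U) = -euler σ U := by
    intro σ U
    rw [euler, euler, map_neg]
    ring
  have key : ∀ (d j : ℕ) (hj : j < N + 1), j + d = N → euler ((l : ℂ) - ν) (x ⟨j, hj⟩) = 0 := by
    intro d
    induction d with
    | zero =>
      intro j hj hjN
      have := hx' ⟨j, hj⟩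
      rwa [dif_neg (by simp only [add_lt_add_iff_right]; omega), add_zero] at this
    | succ d ih =>
      intro j hj hjN
      have h1 := ih (j + 1) (by omega) (by omega)
      have h2 := hx' ⟨j, hj⟩
      rw [dif_pos (by simp only [add_lt_add_iff_right]; omega)] at h2
      apply euler_eq_zero_of_euler_euler
      rw [eq_neg_of_add_eq_zero_left h2, hneg, hCeuler, h1, mul_zero, neg_zero]
  have hj0 : j = 0 := by
    by_contra hj0
    obtain ⟨j, hj⟩ := j
    obtain ⟨i, rfl⟩ : ∃ i, j = i + 1 := ⟨j - 1, by
      have : j ≠ 0 := fun h => hj0 (Fin.ext h)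
      omega⟩
    have h2 := hx' ⟨i, by omega⟩
    rw [key (N - i) i (by omega) (by omega), dif_pos hj, zero_add] at h2
    rcases mul_eq_zero.mp h2 with h3 | h3
    · have := congrArg constantCoeff h3
      simp only [constantCoeff_C, map_zero] at this
      exact absurd this (by norm_cast)
    · rw [h3] at hn
      simp at hn
  refine ⟨hj0, ?_⟩
  have h1 := congrArg (coeff n) (key (N - j.val) j.val j.isLt (by omega))
  rw [coeff_euler, map_zero] at h1
  have h2 := (mul_eq_zero.mp h1).resolve_right hn
  linear_combination -h2

theorem pi_series_smul {ι : Type*} {M : ι → Type*} [∀ i, AddCommGroup (M i)]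
    [∀ i, Module Atilde (M i)] (U : PowerSeries ℂ) (x : (i : ι) → M i) (i : ι) :
    (U • x) i = U • x i := rfl

/-- The eigenspaces in `Ξ_Λ^{(N)}` have dimension at most one. -/
theorem Xi.exists_eq_smul {Λ : Finset ℚ} (hΛ : ∀ l ∈ Λ, 0 < l ∧ l ≤ 1) {N : ℕ} {ν : ℂ}
    {x y : (l : Λ) → Xi l.val N} (hx : twist ν x = 0) (hy : twist ν y = 0) (hx0 : x ≠ 0) :
    ∃ c : ℂ, y = (C c : PowerSeries ℂ) • x := by
  obtain ⟨l, j, n, hn⟩ : ∃ (l : Λ) (j : Fin (N + 1)) (n : ℕ), coeff n (x l j) ≠ 0 := by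
    by_contra hcon
    push Not at hcon
    apply hx0
    funext l j
    ext n
    rw [hcon l j n]
    exact (map_zero _).symm
  obtain ⟨rfl, hν⟩ := Xi.coeff_eigenvector (congrFun hx l) hn
  have huniq : ∀ (z : (l : Λ) → Xi l.val N), twist ν z = 0 → ∀ (l' : Λ) (j : Fin (N + 1)) (n' : ℕ),
      coeff n' (z l' j) ≠ 0 → l' = l ∧ j = 0 ∧ n' = n := by
    intro z hz l' j n' hn'
    obtain ⟨rfl, hν'⟩ := Xi.coeff_eigenvector (congrFun hz l') hn'
    have h1 : (l.val : ℚ) + n = l'.val + n' := by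
      have : (l.val : ℂ) + n = l'.val + n' := hν.symm.trans hν'
      exact_mod_cast this
    have h2 := hΛ l.val l.2
    have h3 := hΛ l'.val l'.2
    -- Since the exponents lie in `]0, 1]`, the sum `l + n` determines both `l` and `n`.
    have h4 : n = n' := by
      have h5 : (n : ℚ) < n' + 1 := by linarith
      have h6 : (n' : ℚ) < n + 1 := by linarith
      have h7 : n < n' + 1 := by exact_mod_cast h5
      have h8 : n' < n + 1 := by exact_mod_cast h6
      omega
    subst h4
    exact ⟨Subtype.ext (by linarith), rfl, rfl⟩
  refine ⟨coeff n (y l 0) / coeff n (x l 0), ?_⟩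
  funext l' j
  rw [pi_series_smul, Xi.series_smul]
  ext n'
  rw [coeff_C_mul]
  by_cases h : l' = l ∧ j = 0 ∧ n' = n
  · obtain ⟨rfl, rfl, rfl⟩ := h
    field_simp
  · have h1 : coeff n' (y l' j) = 0 := by
      by_contra h1
      exact h (huniq y hy l' j n' h1)
    have h2 : coeff n' (x l' j) = 0 := by
      by_contra h2
      exact h (huniq x hx l' j n' h2)
    rw [h1, h2, mul_zero]

theorem IsTheme.exists_eq_smul {T : Type u} [AddCommGroup T] [Module Atilde T] (hT : IsTheme T)
    {ν : ℂ} {x y : T} (hx : twist ν x = 0) (hy : twist ν y = 0) (hx0 : x ≠ 0) :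
    ∃ c : ℂ, y = (C c : PowerSeries ℂ) • x := by
  obtain ⟨Λ, N, φ, hΛ, ⟨f⟩⟩ := hT
  let g := (Submodule.span Atilde {φ}).subtype ∘ₗ f.toLinearMap
  have hg : Function.Injective g := (Submodule.injective_subtype _).comp f.injective
  obtain ⟨c, hc⟩ := Xi.exists_eq_smul hΛ (x := g x) (y := g y) (ν := ν)
    (by rw [← map_twist, hx, map_zero]) (by rw [← map_twist, hy, map_zero])
    (fun h => hx0 (hg (by rw [h, map_zero])))
  exact ⟨c, hg (by rw [hc, map_series_smul])⟩

theorem Xi.eq_zero_of_smul {Λ : Finset ℚ} {N : ℕ} {U : PowerSeries ℂ} (hU : U ≠ 0)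
    {x : (l : Λ) → Xi l.val N} (h : U • x = 0) : x = 0 := by
  funext l j
  have h1 := congrFun (congrFun h l) j
  rw [pi_series_smul, Xi.series_smul] at h1
  exact (mul_eq_zero.mp h1).resolve_left hU

end Xi

/-! ### Rank computations over `ℂ[[b]]`. -/

section Rank

variable {E : Type u} [AddCommGroup E] [Module Atilde E]

theorem rank_le_one {t : E} (h : ∀ x : E, ∃ W : PowerSeries ℂ, x = W • t) : rank E ≤ 1 :=
  finrank_le_one t fun x => (h x).imp fun _ hW => hW.symm

theorem IsABModule.finite_submodule (hE : IsABModule E) (T : Submodule Atilde E) :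
    Module.Finite (PowerSeries ℂ) T := by
  have := hE.2
  exact Module.Finite.of_injective (toSeriesLinear T.subtype) (Submodule.injective_subtype T)

theorem three_le_rank [Module.Finite (PowerSeries ℂ) E] {x y z : E}
    (h : ∀ A B D : PowerSeries ℂ, A • x + B • y + D • z = 0 → A = 0 ∧ B = 0 ∧ D = 0) :
    3 ≤ rank E := by
  have hli : LinearIndependent (PowerSeries ℂ) ![x, y, z] := by
    rw [Fintype.linearIndependent_iff]
    intro g hg
    rw [Fin.sum_univ_three] at hg
    obtain ⟨h0, h1, h2⟩ := h (g 0) (g 1) (g 2) hg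
    intro i
    fin_cases i <;> assumption
  have h3 : 3 ≤ Module.finrank (PowerSeries ℂ) E := by simpa using hli.fintype_card_le_finrank
  exact h3

theorem rank_eq_two {h e : E} (hgen : ∀ x : E, ∃ U V : PowerSeries ℂ, x = U • h + V • e)
    (hind : ∀ U V : PowerSeries ℂ, U • h + V • e = 0 → U = 0 ∧ V = 0) : rank E = 2 := by
  have hli : LinearIndependent (PowerSeries ℂ) ![h, e] := by
    rw [LinearIndependent.pair_iff]
    exact hind
  have hsp : ⊤ ≤ Submodule.span (PowerSeries ℂ) (Set.range ![h, e]) := by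
    intro x _
    obtain ⟨U, V, rfl⟩ := hgen x
    refine Submodule.add_mem _ (Submodule.smul_mem _ _ (Submodule.subset_span ⟨0, rfl⟩))
      (Submodule.smul_mem _ _ (Submodule.subset_span ⟨1, rfl⟩))
  have h2 : Module.finrank (PowerSeries ℂ) E = 2 := by
    simpa using Module.finrank_eq_card_basis (Module.Basis.mk hli hsp)
  exact h2

end Rank

/-! ### Themes of rank two have logarithms. -/

namespace Flag

variable {E : Type u} [AddCommGroup E] [Module Atilde E]
variable {k : ℕ} {F : ℕ → Submodule Atilde E} {l : ℕ → ℚ} {e : ℕ → E}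

/-- The coefficients of `e (j + 1)` in elements of `T ∩ F (j + 1)` form an ideal of `ℂ[[b]]`. It is
generated by some `b^n`, and `t` realizes this generator. -/
theorem exists_jump (hF : Flag k F l e) (T : Submodule Atilde E) {j : ℕ} (hj : j < k) {x : E}
    (hxT : x ∈ T) (hxj : x ∈ F (j + 1)) (hx : x ∉ F j) :
    ∃ (n : ℕ), ∃ t ∈ T, t ∈ F (j + 1) ∧ t - (X ^ n : PowerSeries ℂ) • e (j + 1) ∈ F j ∧
      twist (l (j + 1) + n) t ∈ F j ∧
      ∀ y ∈ T, y ∈ F (j + 1) → ∃ W : PowerSeries ℂ, y - W • t ∈ F j := by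
  classical
  have hlead : ∀ y ∈ T, y ∈ F (j + 1) → y ∉ F j → ∃ (n : ℕ) (V : PowerSeries ℂ),
      (∃ t ∈ T, t ∈ F (j + 1) ∧ t - (X ^ n : PowerSeries ℂ) • e (j + 1) ∈ F j) ∧
      y - (V * X ^ n) • e (j + 1) ∈ F j := by
    intro y hyT hyj hy
    obtain ⟨U, hU⟩ := hF.span j hj y hyj
    have hU0 : U ≠ 0 := by
      rintro rfl
      exact hy (by simpa using hU)
    obtain ⟨n, V, hV, rfl⟩ := exists_X_pow_mul_unit hU0
    refine ⟨n, V, ⟨V⁻¹ • y, series_smul_mem _ _ hyT, series_smul_mem _ _ hyj, ?_⟩,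
      by rwa [mul_comm]⟩
    have := series_smul_mem _ V⁻¹ hU
    rwa [smul_sub, smul_smul, mul_left_comm, PowerSeries.inv_mul_cancel _ hV, mul_one] at this
  have hex : ∃ n : ℕ, ∃ t ∈ T, t ∈ F (j + 1) ∧
      t - (X ^ n : PowerSeries ℂ) • e (j + 1) ∈ F j := by
    obtain ⟨n, V, hn, -⟩ := hlead x hxT hxj hx
    exact ⟨n, hn⟩
  obtain ⟨t, htT, htj, ht⟩ := Nat.find_spec hex
  refine ⟨Nat.find hex, t, htT, htj, ht, ?_, fun y hyT hyj => ?_⟩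
  · have h1 := (F j).add_mem (twist_mem _ (l (j + 1) + (Nat.find hex : ℂ)) ht)
      (series_smul_mem _ (X ^ Nat.find hex) (hF.eig j hj))
    rwa [twist_sub, twist_X_pow_smul, sub_add_cancel] at h1
  · by_cases hy : y ∈ F j
    · exact ⟨0, by simpa using hy⟩
    obtain ⟨n, V, hn, hyV⟩ := hlead y hyT hyj hy
    obtain ⟨r, rfl⟩ := Nat.exists_eq_add_of_le (Nat.find_min' hex hn)
    refine ⟨V * X ^ r, ?_⟩
    have := (F j).sub_mem hyV (series_smul_mem _ (V * X ^ r) ht)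
    convert this using 1
    rw [pow_add]
    module

/-- A theme of rank two has logarithms. -/
theorem not_noLog_of_isTheme (hF : Flag k F l e)
    (hint : ∀ i < k, ∀ j < k, ∃ n : ℤ, l (i + 1) - l (j + 1) = n) {T : Submodule Atilde E}
    (hT : IsTheme T) (hr : 1 < rank T) : ¬ NoLog T ⊥ := by
  classical
  -- Take an eigenvector `t₁` at the first level met by `T`, and `t₂` at the next one. Without
  -- logarithms, `b t₂` can be corrected to a second eigenvector `y`. The eigenvalues differ by an
  -- integer, so powers of `b` bring `t₁` and `y` into one eigenspace, which is at most a line in a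
  -- theme; but they lie at different levels.
  intro hN
  have hgt : ∀ t ∈ T, ∃ x ∈ T, ∀ W : PowerSeries ℂ, x ≠ W • t := by
    intro t ht
    by_contra hcon
    push Not at hcon
    have : rank T ≤ 1 := rank_le_one (t := (⟨t, ht⟩ : T)) fun x => by
      obtain ⟨W, hW⟩ := hcon x x.2
      exact ⟨W, Subtype.ext hW⟩
    omega
  have hk : k ≠ 0 := by
    rintro rfl
    obtain ⟨x, hx, hx0⟩ := hgt 0 (zero_mem _)
    have := hF.mem_top x
    rw [hF.zero, Submodule.mem_bot] at this
    exact hx0 0 (by rw [this, smul_zero])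
  obtain ⟨k, rfl⟩ := Nat.exists_eq_succ_of_ne_zero hk
  -- the first jump
  have hex1 : ∃ j, ∃ x ∈ T, x ∈ F (j + 1) ∧ x ≠ 0 := by
    obtain ⟨x, hx, hx0⟩ := hgt 0 (zero_mem _)
    exact ⟨k, x, hx, hF.mem_top x, by simpa using hx0 0⟩
  have hj1 : Nat.find hex1 ≤ k := Nat.find_min' hex1 (by
    obtain ⟨x, hx, hx0⟩ := hgt 0 (zero_mem _)
    exact ⟨x, hx, hF.mem_top x, by simpa using hx0 0⟩)
  have hz1 : ∀ y ∈ T, y ∈ F (Nat.find hex1) → y = 0 := by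
    intro y hyT hy
    by_contra hy0
    rcases Nat.eq_zero_or_pos (Nat.find hex1) with h0 | h0
    · rw [h0, hF.zero, Submodule.mem_bot] at hy
      exact hy0 hy
    · refine Nat.find_min hex1 (m := Nat.find hex1 - 1) (by omega) ⟨y, hyT, ?_, hy0⟩
      rwa [Nat.sub_add_cancel h0]
  obtain ⟨x₁, hx₁T, hx₁, hx₁0⟩ := Nat.find_spec hex1
  generalize Nat.find hex1 = j₁ at *
  obtain ⟨n₁, t₁, ht₁T, ht₁, -, htw₁, hgen₁⟩ := hF.exists_jump T (by omega) hx₁T hx₁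
    (fun h => hx₁0 (hz1 _ hx₁T h))
  have htw₁0 := hz1 _ (twist_mem T _ ht₁T) htw₁
  have hgen₁' : ∀ y ∈ T, y ∈ F (j₁ + 1) → ∃ W : PowerSeries ℂ, y = W • t₁ := by
    intro y hyT hy
    obtain ⟨W, hW⟩ := hgen₁ y hyT hy
    exact ⟨W, sub_eq_zero.mp (hz1 _ (T.sub_mem hyT (series_smul_mem _ _ ht₁T)) hW)⟩
  have ht₁0 : t₁ ≠ 0 := by
    rintro rfl
    obtain ⟨W, hW⟩ := hgen₁' x₁ hx₁T hx₁
    exact hx₁0 (by rw [hW, smul_zero])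
  -- the second jump
  have hex2' : ∃ x ∈ T, x ∈ F (k + 1) ∧ ∀ W : PowerSeries ℂ, x ≠ W • t₁ := by
    obtain ⟨x, hx, hx0⟩ := hgt t₁ ht₁T
    exact ⟨x, hx, hF.mem_top x, hx0⟩
  have hex2 : ∃ j, ∃ x ∈ T, x ∈ F (j + 1) ∧ ∀ W : PowerSeries ℂ, x ≠ W • t₁ := ⟨k, hex2'⟩
  have hj2 : Nat.find hex2 ≤ k := Nat.find_min' hex2 hex2'
  have hz2 : ∀ y ∈ T, y ∈ F (Nat.find hex2) → ∃ W : PowerSeries ℂ, y = W • t₁ := by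
    intro y hyT hy
    by_contra hy0
    push Not at hy0
    rcases Nat.eq_zero_or_pos (Nat.find hex2) with h0 | h0
    · rw [h0, hF.zero, Submodule.mem_bot] at hy
      exact hy0 0 (by rw [hy, zero_smul])
    · refine Nat.find_min hex2 (m := Nat.find hex2 - 1) (by omega) ⟨y, hyT, ?_, hy0⟩
      rwa [Nat.sub_add_cancel h0]
  obtain ⟨x₂, hx₂T, hx₂, hx₂0⟩ := Nat.find_spec hex2
  generalize Nat.find hex2 = j₂ at *
  have hj12 : j₁ + 1 ≤ j₂ := by
    by_contra hcon
    obtain ⟨W, hW⟩ := hgen₁' x₂ hx₂T (hF.mono (by omega) (by omega) hx₂)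
    exact hx₂0 W hW
  have hx₂j : x₂ ∉ F j₂ := fun h => by
    obtain ⟨W, hW⟩ := hz2 x₂ hx₂T h
    exact hx₂0 W hW
  obtain ⟨n₂, t₂, ht₂T, ht₂, hte₂, htw₂, -⟩ := hF.exists_jump T (by omega) hx₂T hx₂ hx₂j
  obtain ⟨V, hV⟩ := hz2 _ (twist_mem T _ ht₂T) htw₂
  have ht₁j : t₁ ∈ F j₂ := hF.mono hj12 (by omega) ht₁
  have ht₂j : t₂ ∉ F j₂ := by
    intro h
    have h1 := (F j₂).sub_mem h hte₂
    rw [sub_sub_cancel] at h1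
    exact pow_ne_zero n₂ X_ne_zero (hF.free j₂ (by omega) _ h1)
  obtain ⟨r, hr⟩ := hint j₂ (by omega) j₁ (by omega)
  have hrC : (l (j₂ + 1) : ℂ) - l (j₁ + 1) = r := by exact_mod_cast hr
  set ν₁ : ℂ := l (j₁ + 1) + n₁ with hν₁
  set ν₂ : ℂ := l (j₂ + 1) + n₂ with hν₂
  obtain ⟨U, K, hU, hK⟩ := exists_euler (ν₁ - (ν₂ + 1)) V
  set y := (X : PowerSeries ℂ) • t₂ - U • t₁ with hy
  have hyT : y ∈ T := T.sub_mem (series_smul_mem _ _ ht₂T) (series_smul_mem _ _ ht₁T)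
  have htwU : ∀ (ν : ℂ) (W : PowerSeries ℂ), twist ν (W • t₁)
      = (X * euler (ν₁ - ν) W) • t₁ := by
    intro ν W
    rw [twist_smul ν ν₁, htw₁0, smul_zero, zero_add]
  have hytw : twist (ν₂ + 1) y = (X * K) • t₁ := by
    rw [hy, twist_sub, twist_X_smul, hV, htwU, hU]
    module
  have hytw0 : twist (ν₂ + 1) y = 0 := by
    have h1 := hN y hyT (ν₂ + 1) (by
      rw [hytw, htwU, euler_X_mul]
      have : ν₁ - (ν₂ + 1 + 1) + 1 = ν₁ - (ν₂ + 1) := by ring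
      rw [this, hK]
      simp)
    simpa using h1
  obtain ⟨i, i', hii⟩ : ∃ i i' : ℕ, ν₂ + 1 + i = ν₁ + i' := by
    have h1 : ν₂ + 1 - ν₁ = ((r + n₂ + 1 - n₁ : ℤ) : ℂ) := by
      rw [hν₁, hν₂]
      push_cast
      linear_combination hrC
    generalize (r + n₂ + 1 - n₁ : ℤ) = q at h1
    obtain ⟨i, rfl | rfl⟩ := q.eq_nat_or_neg
    · exact ⟨0, i, by push_cast at h1 ⊢; linear_combination h1⟩
    · exact ⟨i, 0, by push_cast at h1 ⊢; linear_combination h1⟩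
  have hsub : ∀ (ν : ℂ) (z : T), ((twist ν z : T) : E) = twist ν (z : E) := fun _ _ => rfl
  obtain ⟨c, hc⟩ := hT.exists_eq_smul (ν := ν₁ + i')
    (x := (⟨_, series_smul_mem T (X ^ i') ht₁T⟩ : T))
    (y := (⟨_, series_smul_mem T (X ^ i) hyT⟩ : T))
    (Subtype.ext (by rw [hsub, twist_X_pow_smul, htw₁0, smul_zero]; rfl))
    (Subtype.ext (by rw [hsub, ← hii, twist_X_pow_smul, hytw0, smul_zero]; rfl))
    (fun h => ht₁0 (hF.smul_eq_zero (pow_ne_zero i' X_ne_zero) (congrArg Subtype.val h)))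
  have hc' : (X ^ i : PowerSeries ℂ) • y
      = (C c : PowerSeries ℂ) • (X ^ i' : PowerSeries ℂ) • t₁ := congrArg Subtype.val hc
  have h1 : y ∈ F j₂ := by
    rw [← hF.X_pow_smul_mem_iff (by omega) i, hc']
    exact series_smul_mem _ _ (series_smul_mem _ _ ht₁j)
  apply ht₂j
  refine hF.mem_of_smul_mem (by omega) X_ne_zero ?_
  have := (F j₂).add_mem h1 (series_smul_mem _ U ht₁j)
  rwa [hy, sub_add_cancel] at this

end Flag

end

/-! ### Normal rank two themes in a good flag. -/

section

variable {E : Type u} [AddCommGroup E] [Module Atilde E]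

theorem IsFresco.exists_generator (hE : IsFresco E) :
    ∃ g : E, Submodule.span Atilde {g} = ⊤ := by
  obtain ⟨Λ, N, n, φ, -, ⟨f⟩⟩ := hE
  refine ⟨f.symm ⟨φ, Submodule.mem_span_singleton_self φ⟩, ?_⟩
  rw [eq_top_iff]
  intro x _
  obtain ⟨v, hv⟩ := Submodule.mem_span_singleton.mp (f x).2
  rw [Submodule.mem_span_singleton]
  refine ⟨v, f.injective ?_⟩
  rw [map_smul, LinearEquiv.apply_symm_apply]
  exact Subtype.ext hv

theorem IsPrincipalJH.exists_goodFlag {k : ℕ} {lam : ℚ} (hE : IsFresco E)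
    (hprim : IsPrimitive lam E) {F : ℕ → Submodule Atilde E} {l : ℕ → ℚ}
    (hF : IsPrincipalJH k F l) (hss : IsSemiSimple (F (k - 1)))
    (hss' : IsSemiSimple (E ⧸ F 1)) : ∃ e, GoodFlag k F l e := by
  obtain ⟨g, hg⟩ := hE.exists_generator
  obtain ⟨e, he⟩ := hF.exists_flag hg
  refine ⟨e, he, hF.principal, fun i hi j hj => ?_, ?_, ?_⟩
  · obtain ⟨n, hn⟩ := he.exists_int_of_isPrimitive hprim hi
    obtain ⟨n', hn'⟩ := he.exists_int_of_isPrimitive hprim hj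
    exact ⟨n - n', by push_cast; linarith⟩
  · rw [he.top]
    exact noLog_of_quotient (noLog_of_isSemiSimple hss')
  · rw [he.zero]
    exact noLog_coe (noLog_of_isSemiSimple hss)

theorem IsNormal.mem_of_X_pow_smul {k : ℕ} {F : ℕ → Submodule Atilde E} {l : ℕ → ℚ} {e : ℕ → E}
    (hF : Flag k F l e) {T : Submodule Atilde E} (hT : IsNormal T) (n : ℕ) {x : E}
    (hx : (X ^ n : PowerSeries ℂ) • x ∈ T) : x ∈ T := by
  induction n with
  | zero => simpa using hx
  | succ n ih =>
    rw [pow_succ', mul_smul] at hx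
    obtain ⟨z, hz, hxz⟩ := (hT _).mp ⟨hx, _, rfl⟩
    apply ih
    have h1 := hF.smul_eq_zero X_ne_zero (x := (X ^ n : PowerSeries ℂ) • x - z)
      (by rw [smul_sub, hxz, b_smul, sub_self])
    rwa [sub_eq_zero.mp h1]

namespace GoodFlag

variable {m p : ℕ} {F : ℕ → Submodule Atilde E} {l : ℕ → ℚ} {e : ℕ → E}

theorem leading_param (hF : GoodFlag (m + 2) F l e) {h : E} {V : PowerSeries ℂ}
    (hh : h ∉ F (m + 1)) (htw : twist ((l (m + 2) : ℂ) + m) h = V • e 1) :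
    ∃ d : ℂ, d ≠ 0 ∧ h - (C d * X ^ m : PowerSeries ℂ) • e (m + 2) ∈ F (m + 1) := by
  have h1m : e 1 ∈ F (m + 1) := hF.mono (by omega) (by omega) (hF.mem 0 (by omega))
  have hμ : ((l (m + 2) + m : ℚ) : ℂ) = (l (m + 2) : ℂ) + m := by push_cast; rfl
  obtain ⟨U, hU⟩ := hF.span (m + 1) (by omega) h (hF.mem_top h)
  obtain ⟨n, d, hd, rfl, hn⟩ := hF.eq_of_twist_zero (by omega) (ν := l (m + 2) + m) hU
    (by rw [hμ, htw]; exact series_smul_mem _ _ h1m) hh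
  have hnm : m = n := by
    have : (m : ℚ) = n := by
      change l (m + 2) + m = l (m + 2) + n at hn
      linarith
    exact_mod_cast this
  subst hnm
  exact ⟨d, hd, hU⟩

theorem independent (hF : GoodFlag (m + 2) F l e) {h : E} (hh : h ∉ F (m + 1))
    (U V : PowerSeries ℂ) (hUV : U • h + V • e 1 = 0) : U = 0 ∧ V = 0 := by
  have hU : U = 0 := by
    by_contra hU
    apply hh
    refine hF.mem_of_smul_mem (by omega) hU ?_
    rw [eq_neg_of_add_eq_zero_left hUV]
    exact Submodule.neg_mem _ (series_smul_mem _ _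
      (hF.mono (by omega : 1 ≤ m + 1) (by omega) (hF.mem 0 (by omega))))
  subst hU
  exact ⟨rfl, hF.smul_one_eq_zero (by omega) (by simpa using hUV)⟩

/-- The logarithms of `T` force `T ⊄ F (m + 1)` and `e 1 ∈ T`; the rank then forces `T ∩ F (m + 1) =
F 1`. An element of `T` with minimal leading power differs from a multiple of `h` by an eigenvector
modulo `F 1`, which lifts to an eigenvector `x`. So `T` has basis `h + x, e 1`. -/
theorem equiv_of_isTheme (hF : GoodFlag (m + 2) F l e) (hE : IsABModule E) {α : ℂ}
    (hα : HasParam m p F l e α) {T : Submodule Atilde E} (hT : IsNormal T) (hr : rank T = 2)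
    (hth : IsTheme T) :
    Nonempty (T ≃ₗ[Atilde] ERankTwo (l 1 : ℂ) (1 + C α * X ^ p) ((l (m + 2) : ℂ) + m)) := by
  obtain ⟨c, hc, h, hh, htw, hαp⟩ := hα
  have hS : constantCoeff (1 + C α * X ^ p : PowerSeries ℂ) ≠ 0 :=
    constantCoeff_one_add (by tauto)
  have hcc : (C c⁻¹ * C c : PowerSeries ℂ) = 1 := by
    rw [← map_mul, inv_mul_cancel₀ hc, map_one]
  have hlog := hF.not_noLog_of_isTheme hF.integral hth (by omega)
  have he1 : e 1 ∈ F 1 := hF.mem 0 (by omega)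
  have hle : F 1 ≤ F (m + 1) := hF.mono (by omega) (by omega)
  obtain ⟨x₀, hx₀T, hx₀⟩ : ∃ x ∈ T, x ∉ F (m + 1) := by
    by_contra hcon
    push Not at hcon
    apply hlog
    have := hF.noLog_bot
    rw [hF.zero] at this
    exact this.mono hcon
  -- A logarithm in `T` gives a nonzero element `U e 1` of `T`, because `E / F 1` has none.
  -- Normality removes the power of `b` in `U`.
  have he1T : e 1 ∈ T := by
    by_contra hcon
    apply hlog
    intro x hx μ hxx
    have h1 := hF.noLog_top x (hF.mem_top x) μ (by
      rw [Submodule.mem_bot] at hxx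
      rw [hxx]
      exact zero_mem _)
    obtain ⟨U, hU⟩ := (hF.mem_one_iff (by omega)).mp h1
    rcases eq_or_ne U 0 with rfl | hU0
    · rw [hU, zero_smul]
      exact zero_mem _
    obtain ⟨n, V, hV, rfl⟩ := exists_X_pow_mul_unit hU0
    exfalso
    apply hcon
    refine hT.mem_of_X_pow_smul hF.toFlag n ((unit_smul_mem_iff T hV).mp ?_)
    rw [smul_smul, mul_comm, ← hU]
    exact twist_mem T μ hx
  have hTF : ∀ y ∈ T, y ∈ F (m + 1) → y ∈ F 1 := by
    intro y hyT hy
    by_contra hy1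
    have := hE.finite_submodule T
    have h3 : 3 ≤ rank T := by
      refine three_le_rank (x := (⟨e 1, he1T⟩ : T)) (y := ⟨y, hyT⟩) (z := ⟨x₀, hx₀T⟩) ?_
      intro A B D hABD
      have h1 : A • e 1 + B • y + D • x₀ = 0 := congrArg Subtype.val hABD
      have hD : D = 0 := by
        by_contra hD
        apply hx₀
        refine hF.mem_of_smul_mem (by omega) hD ?_
        rw [eq_neg_of_add_eq_zero_right h1]
        exact Submodule.neg_mem _ (Submodule.add_mem _ (series_smul_mem _ _ (hle he1))
          (series_smul_mem _ _ hy))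
      subst hD
      rw [zero_smul, add_zero] at h1
      have hB : B = 0 := by
        by_contra hB
        apply hy1
        refine hF.mem_of_smul_mem (by omega) hB ?_
        rw [eq_neg_of_add_eq_zero_right h1]
        exact Submodule.neg_mem _ (series_smul_mem _ _ he1)
      subst hB
      rw [zero_smul, add_zero] at h1
      exact ⟨hF.smul_one_eq_zero (by omega) h1, rfl, rfl⟩
    omega
  obtain ⟨n, t, htT, -, ht, htt, hgen⟩ := hF.exists_jump T (j := m + 1) (by omega) hx₀T
    (hF.mem_top x₀) hx₀
  have htt1 := hTF _ (twist_mem T _ htT) htt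
  obtain ⟨d, hd, hhd⟩ := hF.leading_param hh htw
  have hdd : (C d⁻¹ * C d : PowerSeries ℂ) = 1 := by
    rw [← map_mul, inv_mul_cancel₀ hd, map_one]
  have hmn : m ≤ n := by
    obtain ⟨z, hz⟩ := hF.exists_of_twist_mem htt1 m (by omega)
    rw [add_comm 1 m] at hz
    have h1 := hF.coeff_dvd (by omega) ht hz
    by_contra hcon
    have h2 := PowerSeries.X_pow_dvd_iff.mp h1 n (by omega)
    rw [coeff_X_pow_self] at h2
    exact one_ne_zero h2
  obtain ⟨i, rfl⟩ := Nat.exists_eq_add_of_le hmn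
  have hy : (C d : PowerSeries ℂ) • t - (X ^ i : PowerSeries ℂ) • h ∈ F (m + 1) := by
    have := (F (m + 1)).sub_mem (series_smul_mem _ (C d) ht) (series_smul_mem _ (X ^ i) hhd)
    convert this using 1
    rw [pow_add]
    module
  have hμi : (l (m + 2) : ℂ) + (m + i : ℕ) = l (m + 2) + m + i := by push_cast; ring
  obtain ⟨x, hx, hxt, hyx⟩ := hF.exists_eigen i hy (by
    rw [twist_sub, twist_X_pow_smul, htw, ← hμi,
      twist_smul _ ((l (m + 2) : ℂ) + (m + i : ℕ)), sub_self, euler_C, zero_mul, map_zero,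
      mul_zero, zero_smul, add_zero]
    exact (F 1).sub_mem (series_smul_mem _ _ htt1) (series_smul_mem _ _ (series_smul_mem _ _ he1)))
  have hF1T : F 1 ≤ T := by
    intro z hz
    obtain ⟨U, rfl⟩ := (hF.mem_one_iff (by omega)).mp hz
    exact series_smul_mem _ _ he1T
  -- Modulo `F 1 ⊆ T`, the vector `b^i (h + x)` is `d t`. Normality allows the division by `b^i`.
  have hhT : h + x ∈ T := by
    refine hT.mem_of_X_pow_smul hF.toFlag i ?_
    have := T.sub_mem (series_smul_mem T (C d) htT) (hF1T hyx)
    convert this using 1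
    module
  have hhx : h + x ∉ F (m + 1) := fun hcon => hh (by
    have := (F (m + 1)).sub_mem hcon hx
    rwa [add_sub_cancel_right] at this)
  have htw' : twist ((l (m + 2) : ℂ) + m) (h + x)
      = ((1 + C α * X ^ p) * C c : PowerSeries ℂ) • e 1 := by
    rw [twist_add, hxt, add_zero, htw]
  have hhxd : h + x - (C d * X ^ m : PowerSeries ℂ) • e (m + 2) ∈ F (m + 1) := by
    have := (F (m + 1)).add_mem hhd hx
    convert this using 1
    abel
  -- `h + x` lies in `T` with leading power `b^m`, while every leading coefficient in `T` is a
  -- multiple of `b^(m+i)`.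
  have hi0 : i = 0 := by
    obtain ⟨W, hW⟩ := hgen _ hhT (hF.mem_top _)
    have h1 := hF.coeff_unique (j := m + 1) (by omega) hhxd (V := W * X ^ (m + i)) (by
      have := (F (m + 1)).add_mem hW (series_smul_mem _ W ht)
      convert this using 1
      module)
    have h2 := congrArg (coeff m) h1
    rw [coeff_C_mul, coeff_X_pow_self, mul_one, coeff_mul_X_pow'] at h2
    by_contra hi
    rw [if_neg (by omega)] at h2
    exact hd h2
  subst hi0
  refine equiv_rankTwo hS (h := (⟨h + x, hhT⟩ : T))
    (e := ⟨(C c : PowerSeries ℂ) • e 1, series_smul_mem _ _ he1T⟩) (Subtype.ext ?_)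
    (Subtype.ext ?_) (fun y => ?_) (fun U V hUV => ?_)
  · change twist (l 1 : ℂ) ((C c : PowerSeries ℂ) • e 1) = 0
    rw [hF.twist_smul_one (by omega), sub_self, euler_C, zero_mul, map_zero, mul_zero,
      zero_smul]
  · change twist _ (h + x) = (1 + C α * X ^ p : PowerSeries ℂ) • (C c : PowerSeries ℂ) • e 1
    rw [htw', mul_smul]
  · obtain ⟨W, hW⟩ := hgen y y.2 (hF.mem_top _)
    have h1 : (y : E) - (W * C d⁻¹) • (h + x) ∈ F (m + 1) := by
      have h2 : t - (C d⁻¹ : PowerSeries ℂ) • (h + x) ∈ F (m + 1) := by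
        have := (F (m + 1)).sub_mem ht (series_smul_mem _ (C d⁻¹) hhxd)
        convert this using 1
        rw [smul_sub, smul_smul, ← mul_assoc, hdd, one_mul, add_zero]
        abel
      have := (F (m + 1)).add_mem hW (series_smul_mem _ W h2)
      convert this using 1
      module
    obtain ⟨V, hV⟩ := (hF.mem_one_iff (by omega)).mp
      (hTF _ (T.sub_mem y.2 (series_smul_mem _ _ hhT)) h1)
    refine ⟨W * C d⁻¹, V * C c⁻¹, Subtype.ext ?_⟩
    change (y : E) = (W * C d⁻¹) • (h + x) + (V * C c⁻¹) • (C c : PowerSeries ℂ) • e 1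
    rw [smul_smul, mul_assoc V, hcc, mul_one, ← hV]
    abel
  · have h1 : U • (h + x) + V • (C c : PowerSeries ℂ) • e 1 = 0 := congrArg Subtype.val hUV
    rw [smul_smul] at h1
    obtain ⟨h2, h3⟩ := hF.independent hhx _ _ h1
    refine ⟨h2, ?_⟩
    rw [← mul_one V, ← hcc, mul_comm (C c⁻¹), ← mul_assoc, h3, zero_mul]

/-- The candidate is `Ã h = ℂ[[b]] h ⊕ ℂ[[b]] e 1`, normal by `notMem_of_twist`. A coordinate of the
embedding that is nonzero on `e 1` is injective on it, because the resonant coefficient is nonzero.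
-/
theorem exists_theme (hF : GoodFlag (m + 2) F l e) (hE : IsFresco E)
    (hp : l (m + 2) + m = l 1 + p - 1) {α : ℂ} (hα : HasParam m p F l e α) (hα0 : α ≠ 0) :
    ∃ T : Submodule Atilde E, IsNormal T ∧ rank T = 2 ∧ IsTheme T := by
  obtain ⟨c, hc, h, hh, htw, hαp⟩ := hα
  set S : PowerSeries ℂ := (1 + C α * X ^ p) * C c with hSdef
  have hS : constantCoeff S ≠ 0 := by
    rw [hSdef, map_mul, constantCoeff_C]
    exact mul_ne_zero (constantCoeff_one_add (by tauto)) hc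
  have he1 : e 1 ∈ F 1 := hF.mem 0 (by omega)
  have hhT : h ∈ Submodule.span Atilde {h} := Submodule.mem_span_singleton_self h
  have he1T : e 1 ∈ Submodule.span Atilde {h} := by
    rw [← unit_smul_mem_iff _ hS, ← htw]
    exact twist_mem _ _ hhT
  have hgen : ∀ x ∈ Submodule.span Atilde {h}, ∃ U V : PowerSeries ℂ,
      x = U • h + V • e 1 := by
    intro x hx
    obtain ⟨v, rfl⟩ := Submodule.mem_span_singleton.mp hx
    obtain ⟨U, w, hU⟩ := exists_smul_eq ((l (m + 2) : ℂ) + m) v h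
    have h1 : w • twist ((l (m + 2) : ℂ) + m) h ∈ F 1 := by
      rw [htw]
      exact (F 1).smul_mem w (series_smul_mem _ _ he1)
    obtain ⟨V, hV⟩ := (hF.mem_one_iff (by omega)).mp h1
    exact ⟨U, V, by rw [hU, hV]⟩
  refine ⟨Submodule.span Atilde {h}, fun x => ⟨?_, ?_⟩, ?_, ?_⟩
  · rintro ⟨hx, y, rfl⟩
    obtain ⟨U, V, hUV⟩ := hgen _ hx
    rw [b_smul] at hUV ⊢
    have hU : constantCoeff U = 0 := by
      by_contra hU
      refine hF.notMem_of_twist (by omega) hS htw (U⁻¹ • y) ?_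
      have h1 : h = U⁻¹ • ((X : PowerSeries ℂ) • y - V • e 1) := by
        rw [hUV, add_sub_cancel_right, smul_smul, PowerSeries.inv_mul_cancel _ hU, one_smul]
      have h2 : h - (X : PowerSeries ℂ) • U⁻¹ • y = -(U⁻¹ * V) • e 1 := by
        nth_rw 1 [h1]
        module
      rw [h2]
      exact series_smul_mem _ _ he1
    obtain ⟨U', rfl⟩ := exists_eq_X_mul hU
    have hV : constantCoeff V = 0 := by
      have h1 : (X : PowerSeries ℂ) • (y - U' • h) = V • e 1 := by
        rw [smul_sub, hUV]
        module
      have h2 : y - U' • h ∈ F 1 := by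
        refine hF.mem_of_smul_mem (by omega) X_ne_zero ?_
        rw [h1]
        exact series_smul_mem _ _ he1
      obtain ⟨W, hW⟩ := (hF.mem_one_iff (by omega)).mp h2
      rw [hW] at h1
      have h3 := hF.smul_one_eq_zero (by omega) (U := X * W - V)
        (by rw [sub_smul, mul_smul, h1, sub_self])
      rw [← sub_eq_zero.mp h3]
      simp
    obtain ⟨V', rfl⟩ := exists_eq_X_mul hV
    refine ⟨U' • h + V' • e 1, Submodule.add_mem _ (series_smul_mem _ _ hhT)
      (series_smul_mem _ _ he1T), ?_⟩
    rw [b_smul, hUV]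
    module
  · rintro ⟨z, hz, rfl⟩
    exact ⟨Submodule.smul_mem _ _ hz, z, rfl⟩
  · refine rank_eq_two (h := (⟨h, hhT⟩ : Submodule.span Atilde {h})) (e := ⟨e 1, he1T⟩) ?_ ?_
    · intro x
      obtain ⟨U, V, hUV⟩ := hgen x x.2
      exact ⟨U, V, Subtype.ext hUV⟩
    · intro U V hUV
      exact hF.independent hh U V (congrArg Subtype.val hUV)
  · obtain ⟨Λ, N, n, φ, hΛ, ⟨f⟩⟩ := hE
    let g : E →ₗ[Atilde] Fin n → (l : Λ) → Xi l.val N :=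
      (Submodule.span Atilde {φ}).subtype ∘ₗ f.toLinearMap
    have hg : Function.Injective g := (Submodule.injective_subtype _).comp f.injective
    have he10 : e 1 ≠ 0 := by
      intro h0
      exact one_ne_zero (hF.smul_one_eq_zero (U := 1) (by omega) (by rw [h0, smul_zero]))
    obtain ⟨r, hr⟩ : ∃ r, g (e 1) r ≠ 0 := by
      by_contra hcon
      push Not at hcon
      exact he10 (hg (by rw [map_zero]; exact funext hcon))
    let ψ : E →ₗ[Atilde] (l : Λ) → Xi l.val N := LinearMap.proj r ∘ₗ g
    have hψe : ∀ V : PowerSeries ℂ, ψ (V • e 1) = 0 → V = 0 := by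
      intro V hV
      by_contra hV0
      rw [map_series_smul] at hV
      exact hr (Xi.eq_zero_of_smul hV0 hV)
    have hker : ∀ x ∈ Submodule.span Atilde {h}, ψ x = 0 → x = 0 := by
      intro x hx hψ
      obtain ⟨U, V, rfl⟩ := hgen x hx
      rcases eq_or_ne U 0 with rfl | hU
      · rw [zero_smul, zero_add] at hψ ⊢
        rw [hψe V hψ, zero_smul]
      exfalso
      -- A kernel element outside `ℂ[[b]] e 1` can be normalized to `b^n h + V e 1`. Applying `a -
      -- (μ + n) b`, with `μ = l_k + k - 2`, yields a relation on `e 1` alone.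
      obtain ⟨n, Y, hY, rfl⟩ := exists_X_pow_mul_unit hU
      have h1 : ψ ((X ^ n : PowerSeries ℂ) • h + (Y⁻¹ * V) • e 1) = 0 := by
        have h2 : (X ^ n : PowerSeries ℂ) • h + (Y⁻¹ * V) • e 1
            = Y⁻¹ • ((X ^ n * Y) • h + V • e 1) := by
          rw [smul_add, smul_smul, smul_smul, mul_left_comm, PowerSeries.inv_mul_cancel _ hY,
            mul_one]
        rw [h2, map_series_smul, hψ, smul_zero]
      have h3 := congrArg (twist ((l (m + 2) : ℂ) + m + n)) h1
      rw [← map_twist, twist_add, twist_X_pow_smul, htw, hF.twist_smul_one (by omega),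
        twist_zero, smul_smul, ← add_smul] at h3
      have h4 := congrArg (coeff (n + p)) (hψe _ h3)
      have hl : (l 1 : ℂ) - (l (m + 2) + m + n) = 1 - p - n := by
        have : l 1 - (l (m + 2) + m + n) = 1 - p - n := by linarith
        exact_mod_cast this
      -- The multiple of `e 1` does not contribute in the resonant degree `n + p`. There `b^n (1 + α
      -- b^p) c` has coefficient `c α`, or `2 c` when `p = 0`, and this is nonzero.
      have h5 : coeff (n + p) (X * euler (1 - p - n : ℂ) (Y⁻¹ * V)) = 0 := by
        rcases Nat.eq_zero_or_pos (n + p) with h0 | h0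
        · rw [h0]; simp
        · obtain ⟨q, hq⟩ : ∃ q, n + p = q + 1 := ⟨n + p - 1, by omega⟩
          rw [hq, coeff_succ_X_mul, coeff_euler]
          have : (q : ℂ) + (1 - p - n) = 0 := by
            have : (n : ℂ) + p = q + 1 := by exact_mod_cast hq
            linear_combination -this
          rw [this, zero_mul]
      rw [map_add, hl, h5, add_zero, map_zero, hSdef, coeff_X_pow_mul', if_pos (by omega),
        Nat.add_sub_cancel_left, coeff_mul_C, map_add, coeff_C_mul, coeff_X_pow_self, mul_one,
        coeff_one] at h4
      have h6 := (mul_eq_zero.mp h4).resolve_right hc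
      split_ifs at h6 with hp0
      · rw [hαp hp0] at h6
        norm_num at h6
      · exact hα0 (by simpa using h6)
    let ψT : Submodule.span Atilde {h} →ₗ[Atilde] (l : Λ) → Xi l.val N :=
      ψ ∘ₗ (Submodule.span Atilde {h}).subtype
    have hψT : Function.Injective ψT := by
      rw [injective_iff_map_eq_zero]
      intro x hx
      exact Subtype.ext (hker x x.2 hx)
    have hrange : LinearMap.range ψT = Submodule.span Atilde {ψ h} := by
      rw [LinearMap.range_comp, Submodule.range_subtype, Submodule.map_span, Set.image_singleton]
    exact ⟨Λ, N, ψ h, hΛ,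
      ⟨(LinearEquiv.ofInjective ψT hψT).trans (LinearEquiv.ofEq _ _ hrange)⟩⟩

/-- `l (j + 1) - l j + 1` is an integer by primitivity and is nonnegative since the sequence is
principal. -/
theorem exists_steps {k : ℕ} (hF : GoodFlag k F l e) :
    ∃ p : ℕ → ℕ, ∀ j : ℕ, 1 ≤ j → j < k → l (j + 1) = l j + p j - 1 := by
  have h : ∀ j : ℕ, ∃ q : ℕ, 1 ≤ j → j < k → l (j + 1) = l j + q - 1 := by
    intro j
    by_cases hj : 1 ≤ j ∧ j < k
    · obtain ⟨i, rfl⟩ : ∃ i, j = i + 1 := ⟨j - 1, by omega⟩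
      obtain ⟨n, hn⟩ := hF.integral (i + 1) hj.2 i (by omega)
      have h1 := hF.principal (i + 1) (i + 1 + 1) (by omega) (by omega) (by omega)
      push_cast at h1
      have h2 : (0 : ℚ) ≤ ((n + 1 : ℤ) : ℚ) := by push_cast; linarith
      obtain ⟨q, hq⟩ := Int.eq_ofNat_of_zero_le (by exact_mod_cast h2 : (0 : ℤ) ≤ n + 1)
      refine ⟨q, fun _ _ => ?_⟩
      have h3 : ((n + 1 : ℤ) : ℚ) = q := by rw [hq]; simp
      push_cast at h3
      linarith
    · exact ⟨0, fun h1 h2 => absurd ⟨h1, h2⟩ hj⟩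
  choose p hp using h
  exact ⟨p, hp⟩

end GoodFlag

end

end ABModule

/-! ### Conclusion. -/

theorem mainTheorem7 {E : Type*} [AddCommGroup E] [Module ABModule.Atilde E]
    (k : ℕ) (hk : 2 ≤ k) (lam : ℚ) (hlam_pos : 0 < lam) (hlam_le : lam ≤ 1)
    (hfresco : ABModule.IsFresco E) (hrank : ABModule.rank E = k)
    (hprim : ABModule.IsPrimitive lam E)
    (F : ℕ → Submodule ABModule.Atilde E) (l : ℕ → ℚ) (hF : ABModule.IsPrincipalJH k F l)
    (hss : ABModule.IsSemiSimple (F (k - 1))) (hss' : ABModule.IsSemiSimple (E ⧸ F 1)) :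
    (∃! α : ℂ, ABModule.IsAlpha k E α) ∧
    ∃ p : ℕ → ℕ, (∀ j : ℕ, 1 ≤ j → j < k → l (j + 1) = l j + p j - 1) ∧
      ∀ α : ℂ, ABModule.IsAlpha k E α → α ≠ 0 →
        (∃ T : Submodule ABModule.Atilde E,
          ABModule.IsNormal T ∧ ABModule.rank T = 2 ∧ ABModule.IsTheme T) ∧
        ∀ T : Submodule ABModule.Atilde E,
          ABModule.IsNormal T → ABModule.rank T = 2 → ABModule.IsTheme T →
            Nonempty (T ≃ₗ[ABModule.Atilde]
              ABModule.ERankTwo (l 1 : ℂ)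
                (1 + α • PowerSeries.X ^ (∑ j ∈ Finset.Icc 1 (k - 1), p j))
                ((l k : ℂ) + k - 2)) := by
  obtain ⟨m, rfl⟩ : ∃ m, k = m + 2 := ⟨k - 2, by omega⟩
  obtain ⟨e, he⟩ := hF.exists_goodFlag hfresco hprim hss hss'
  obtain ⟨p, hp⟩ := he.exists_steps
  have hsum : ∀ n : ℕ, n + 1 ≤ m + 2 →
      l (n + 1) + n = l 1 + ((∑ j ∈ Finset.Icc 1 n, p j : ℕ) : ℚ) := by
    intro n
    induction n with
    | zero => intro _; simp
    | succ n ih =>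
      intro hn
      have h1 := ih (by omega)
      have h2 := hp (n + 1) (by omega) (by omega)
      rw [Finset.sum_Icc_succ_top (by omega), h2]
      push_cast at h1 ⊢
      linarith
  -- Telescoping the steps shows that `p(E)` is exactly the resonant exponent: `l_k + k - 2 = l_1 +
  -- p(E) - 1`.
  have hpm : l (m + 2) + m = l 1 + ((∑ j ∈ Finset.Icc 1 (m + 1), p j : ℕ) : ℚ) - 1 := by
    have h1 := hsum (m + 1) le_rfl
    rw [← h1]
    push_cast
    ring
  have hiff := ABModule.isAlpha_iff m he hpm
  refine ⟨?_, p, hp, fun α hα hα0 => ?_⟩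
  · obtain ⟨α, hα⟩ := he.exists_param hpm
    exact ⟨α, (hiff α).mpr hα, fun β hβ => he.param_unique hpm ((hiff β).mp hβ) hα⟩
  · have hparam := (hiff α).mp hα
    refine ⟨he.exists_theme hfresco hpm hparam hα0, fun T hT hr hth => ?_⟩
    have h1 := he.equiv_of_isTheme hprim.1.1 hparam hT hr hth
    have h2 : ((l (m + 2) : ℂ) + (m + 2 : ℕ) - 2) = (l (m + 2) : ℂ) + m := by push_cast; ring
    rw [h2, PowerSeries.smul_eq_C_mul]
    exact h1
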